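/- Let $K$ be a field, let $G$ be a finite simple graph on the vertex set $\{x_1,\dots,x_n\}$, and let $H_1,\dots,H_n$ be finite simple graphs, each with at least one vertex. Let $G'=G(H_1,\dots,H_n)$ be the graph on the disjoint union $V(G)\cup V(H_1)\cup\dots\cup V(H_n)$ whose edges are those of $G$, those of every $H_i$, and all pairs $\{x_i,z\}$ with $1\le i\le n$ and $z\in V(H_i)$. Suppose that each $H_i$ belongs to one of the following families: (a) unmixed chordal graphs, i.e. graphs in which every cycle of length at least $4$ has a chord and all minimal vertex covers have the same cardinality; (b) Cohen–Macaulay bipartite graphs, i.e. bipartite graphs $H$ such that the quotient of $K[z : z\in V(H)]$ by the edge ideal $(zz' : \{z,z'\}\in E(H))$ is a Cohen–Macaulay ring; (c) path graphs; (d) Cameron–Walker graphs whose bipartite part is complete, i.e. graphs consisting of a complete bipartite graph with non-empty vertex classes $X$ and $Y$, at least one leaf attached to each vertex of $X$, and possibly some pendant triangles attached to vertices of $Y$. Let $S$ be the polynomial ring over $K$ whose variables are the vertices of $G'$, and let $I_{G'}\subset S$ be the cover ideal, generated by the monomials $u_C=\prod_{v\in C}v$ where $C$ runs through the minimal vertex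 covers of $G'$. Then for every $k\ge 0$ the minimal monomial generating set of the power $I_{G'}^k$ can be ordered as $f_1,\dots,f_m$ so that each colon ideal $(f_1,\dots,f_{j-1}):f_j$, $1\le j\le m$, is generated by linear forms; and $I_{G'}^k$ is componentwise linear, that is, for each $j\geq 0$ the ideal generated by all homogeneous elements of degree $j$ of $I_{G'}^k$ has a linear resolution (the zero ideal being regarded as having one). -/

import Mathlib

noncomputable section

/-! ### Graphs -/

namespace CoverPowers

section Graphs

variable {V : Type*}

/-- Adjacency of `G(H_v : v ∈ V)` on `V ⊔ ⨆ v, W v`: the edges of `G`, the edges of every `H v`,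
and all edges joining `v` to the vertices of `H v`. -/
inductive AttachAdj {W : V → Type*} (G : SimpleGraph V) (H : ∀ v, SimpleGraph (W v)) :
    (V ⊕ (Σ v, W v)) → (V ⊕ (Σ v, W v)) → Prop
  | base {u v : V} (h : G.Adj u v) : AttachAdj G H (Sum.inl u) (Sum.inl v)
  | fiber {v : V} {a b : W v} (h : (H v).Adj a b) :
      AttachAdj G H (Sum.inr ⟨v, a⟩) (Sum.inr ⟨v, b⟩)
  | up (v : V) (a : W v) : AttachAdj G H (Sum.inl v) (Sum.inr ⟨v, a⟩)
  | down (v : V) (a : W v) : AttachAdj G H (Sum.inr ⟨v, a⟩) (Sum.inl v)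

/-- The graph `G(H_v : v ∈ V)` obtained from `G` by attaching `H v` to each vertex `v`, with `v`
joined to all vertices of `H v`. -/
def attach {W : V → Type*} (G : SimpleGraph V) (H : ∀ v, SimpleGraph (W v)) :
    SimpleGraph (V ⊕ (Σ v, W v)) where
  Adj := AttachAdj G H
  symm := ⟨by
    rintro _ _ (h | h | ⟨v, a⟩ | ⟨v, a⟩)
    · exact .base h.symm
    · exact .fiber h.symm
    · exact .down v a
    · exact .up v a⟩
  loopless := ⟨by
    rintro _ (h | h)
    · exact h.ne rfl
    · exact h.ne rfl⟩

/-- `C` is a minimal vertex cover of `G`. -/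
def IsMinVertexCover (G : SimpleGraph V) (C : Finset V) : Prop :=
  Minimal (fun D : Finset V => G.IsVertexCover (D : Set V)) C

/-- All minimal vertex covers have the same cardinality. -/
def IsUnmixed (G : SimpleGraph V) : Prop :=
  ∀ C D : Finset V, IsMinVertexCover G C → IsMinVertexCover G D → C.card = D.card

/-- Every cycle of length at least four has a chord. -/
def IsChordal (G : SimpleGraph V) : Prop :=
  ∀ (v : V) (c : G.Walk v v), c.IsCycle → 4 ≤ c.length →
    ∃ a ∈ c.support, ∃ b ∈ c.support, G.Adj a b ∧ s(a, b) ∉ c.edges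

/-- `G` is isomorphic to a path `P_r`. -/
def IsPathGraph (G : SimpleGraph V) : Prop :=
  ∃ r : ℕ, Nonempty (G ≃g SimpleGraph.pathGraph r)

/-- `v` is a leaf whose only neighbour is `x`. -/
def IsLeafAt (G : SimpleGraph V) (x v : V) : Prop :=
  ∀ w, G.Adj v w ↔ w = x

/-- `{y, v, v'}` is a pendant triangle at `y`: `v` and `v'` have degree two. -/
def IsPendantTriangleAt (G : SimpleGraph V) (y v v' : V) : Prop :=
  (∀ w, G.Adj v w ↔ w = y ∨ w = v') ∧ (∀ w, G.Adj v' w ↔ w = y ∨ w = v)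

/-- `G` is a Cameron–Walker graph with bipartite part on `X ⊔ Y`: a connected bipartite graph with
vertex classes `X` and `Y`, together with at least one leaf attached to each vertex of `X` and
possibly some pendant triangles attached to vertices of `Y`. -/
structure IsCameronWalkerOn (G : SimpleGraph V) (X Y : Set V) : Prop where
  disjoint : Disjoint X Y
  nonempty_left : X.Nonempty
  nonempty_right : Y.Nonempty
  indep_left : ∀ a ∈ X, ∀ b ∈ X, ¬ G.Adj a b
  indep_right : ∀ a ∈ Y, ∀ b ∈ Y, ¬ G.Adj a b
  connected : (G.induce (X ∪ Y)).Connected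
  exists_leaf : ∀ x ∈ X, ∃ v ∉ X ∪ Y, IsLeafAt G x v
  rest : ∀ v ∉ X ∪ Y, (∃ x ∈ X, IsLeafAt G x v) ∨
    (∃ y ∈ Y, ∃ v' ∉ X ∪ Y, IsPendantTriangleAt G y v v')

/-- `G` is a Cameron–Walker graph whose bipartite part is a complete bipartite graph. -/
def IsCompleteCameronWalker (G : SimpleGraph V) : Prop :=
  ∃ X Y : Set V, IsCameronWalkerOn G X Y ∧ ∀ x ∈ X, ∀ y ∈ Y, G.Adj x y

end Graphs

/-! ### Cohen–Macaulay rings -/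

/-- A (Noetherian) local ring is Cohen–Macaulay if its maximal ideal contains a regular sequence
whose length is the Krull dimension. -/
def IsCohenMacaulayLocal (R : Type*) [CommRing R] [IsLocalRing R] : Prop :=
  ∃ rs : List R, (∀ r ∈ rs, r ∈ IsLocalRing.maximalIdeal R) ∧
    RingTheory.Sequence.IsRegular R rs ∧ ((rs.length : ℕ) : WithBot ℕ∞) = ringKrullDim R

/-- A (Noetherian) ring is Cohen–Macaulay if all its local rings are. -/
def IsCohenMacaulay (R : Type*) [CommRing R] : Prop :=
  ∀ (p : Ideal R) [p.IsPrime], IsCohenMacaulayLocal (Localization.AtPrime p)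

section Ideals

variable {σ : Type*} (K : Type*) [Field K]

/-! ### Edge ideal and cover ideal -/

/-- The edge ideal `(x_a x_b : {a, b} an edge)`. -/
def edgeIdeal (G : SimpleGraph σ) : Ideal (MvPolynomial σ K) :=
  Ideal.span {f | ∃ a b, G.Adj a b ∧ f = MvPolynomial.X a * MvPolynomial.X b}

/-- `G` is Cohen–Macaulay over `K`: the quotient by its edge ideal is a Cohen–Macaulay ring. -/
def IsCohenMacaulayGraph (G : SimpleGraph σ) : Prop :=
  IsCohenMacaulay (MvPolynomial σ K ⧸ edgeIdeal K G)

/-- The cover ideal, generated by `u_C = ∏ v ∈ C, x_v` for the minimal vertex covers `C`. -/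
def coverIdeal (G : SimpleGraph σ) : Ideal (MvPolynomial σ K) :=
  Ideal.span {f | ∃ C : Finset σ, IsMinVertexCover G C ∧ f = ∏ v ∈ C, MvPolynomial.X v}

variable {K}

/-! ### Linear quotients and componentwise linearity -/

/-- The monomials in `I` that are minimal with respect to divisibility; for a monomial ideal this
is its minimal monomial generating set. -/
def minimalMonomials (I : Ideal (MvPolynomial σ K)) : Set (MvPolynomial σ K) :=
  {f | ∃ s : σ →₀ ℕ, Minimal (fun t => MvPolynomial.monomial t (1 : K) ∈ I) s ∧
    f = MvPolynomial.monomial s 1}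

/-- For `l = [f_0, f_1, …]`, every colon ideal `(f_0, …, f_{j-1}) : f_j` is generated by linear
forms. -/
def IsLinearQuotientsOrder (l : List (MvPolynomial σ K)) : Prop :=
  ∀ (j : ℕ) (hj : j < l.length), ∃ L : Set (MvPolynomial σ K), (∀ f ∈ L, f.IsHomogeneous 1) ∧
    Submodule.colon (Ideal.span {f | f ∈ l.take j}) {l[j]} = Ideal.span L

/-- `I` is generated by its minimal monomials, which are finitely many and can be enumerated
without repetition in an order of linear quotients. -/
def HasLinearQuotientsOnMinGens (I : Ideal (MvPolynomial σ K)) : Prop :=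
  ∃ l : List (MvPolynomial σ K), l.Nodup ∧ {f | f ∈ l} = minimalMonomials I ∧
    Ideal.span {f | f ∈ l} = I ∧ IsLinearQuotientsOrder l

/-- `I` has a `d`-linear resolution
`⋯ → S(-d-2)^{b 2} → S(-d-1)^{b 1} → S(-d)^{b 0} → I → 0`: the generators are homogeneous of
degree `d`, the entries of the matrices of the differentials are linear forms, and the complex is
exact. (Such a resolution is minimal, as all entries lie in the irrelevant maximal ideal; the zero
ideal has the zero resolution.) -/
def HasLinearResolution (d : ℕ) (I : Ideal (MvPolynomial σ K)) : Prop :=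
  ∃ (b : ℕ → ℕ) (g : Fin (b 0) → MvPolynomial σ K)
    (D : ∀ i, Matrix (Fin (b i)) (Fin (b (i + 1))) (MvPolynomial σ K)),
    (∀ a, (g a).IsHomogeneous d) ∧
    (∀ i a c, (D i a c).IsHomogeneous 1) ∧
    Ideal.span (Set.range g) = I ∧
    Function.Exact (D 0).mulVecLin (Fintype.linearCombination (MvPolynomial σ K) g) ∧
    ∀ i, Function.Exact (D (i + 1)).mulVecLin (D i).mulVecLin

/-- For each `j`, the ideal generated by the homogeneous elements of degree `j` of `I` has a linear
resolution. -/
def IsComponentwiseLinear (I : Ideal (MvPolynomial σ K)) : Prop :=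
  ∀ j : ℕ, HasLinearResolution j (Ideal.span {f | f ∈ I ∧ f.IsHomogeneous j})

end Ideals

end CoverPowers

end

/-!
For `k` vertex covers of `G(H₁, …, Hₙ)`, let `a v` be the number of those that contain the vertex
`v` of `G`. The other `k - a v` of them contain all of `H v`, so on `H v` their sum consists of the
constant `k - a v` plus a sum of `a v` vertex covers of `H v`. Passing from `a v` to `a v + 1` thus
weakens what is required on `H v`. Hence the minimal generators of the `k`-th power of the cover
ideal can be sorted by decreasing degree in the variables of `G` and, for a fixed `a`, by the
product of orders of linear quotients for the powers of the cover ideals of the `H v`: the theorem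
reduces to linear quotients for all powers of the cover ideals of the `H v`.

* The vertices of an unmixed chordal graph are partitioned into cliques each of which has a vertex
  without neighbours outside the clique; one sorts by the degree in these vertices.
* For a bipartite graph the sums of `k` covers are described by the inequalities `k ≤ t u + t v`,
  one for each edge. If the graph is Cohen–Macaulay, then the links of its independent sets are not
  joins unless they are complete. So outside a maximal independent set there is a vertex with
  exactly one neighbour in it; this permits an exchange step when one sorts by decreasing degree in
  one of the two vertex classes.
* For a forest one splits at the neighbour of a leaf and uses induction on the number of vertices.
* A Cameron–Walker graph arises from its bipartite part by attaching single vertices and edges, so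
  the fibration argument above applies once more.

Linear quotients are inherited by each degree component of a monomial ideal, and for generators of
a single degree they give a linear resolution, because the syzygy module again has generators with
linear colons.
-/

namespace CoverPowers

/-! ### Linear quotients for sets of exponent vectors -/

section LinearQuotients

variable {σ τ α : Type*}

/-- The relation `g ≤ f + eᵢ` on exponent vectors, i.e. `x ^ g` divides `xᵢ x ^ f`; it is spelled
out coordinatewise to avoid decidable equality on `σ`. -/
def LeAddSingle (i : σ) (g f : σ → ℕ) : Prop :=
  g i ≤ f i + 1 ∧ ∀ j, j ≠ i → g j ≤ f j

theorem LeAddSingle.of_le_left {i : σ} {g h f : σ → ℕ} (hhf : LeAddSingle i h f) (hgh : g ≤ h) :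
    LeAddSingle i g f :=
  ⟨(hgh i).trans hhf.1, fun j hj => (hgh j).trans (hhf.2 j hj)⟩

theorem leAddSingle_iff_le [DecidableEq σ] {i : σ} {g f : σ → ℕ} :
    LeAddSingle i g f ↔ g ≤ f + Pi.single i 1 := by
  refine ⟨fun h j => ?_, fun h => ⟨by simpa using h i, fun j hj => by simpa [hj] using h j⟩⟩
  rcases eq_or_ne j i with rfl | hj
  · simpa using h.1
  · simpa [hj] using h.2 j hj

theorem leAddSingle_add_single [DecidableEq σ] (f : σ → ℕ) (i : σ) :
    LeAddSingle i (f + Pi.single i 1) f :=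
  leAddSingle_iff_le.2 le_rfl

/-- `key` sorts the exponent vectors in `M` into an order of linear quotients: whichever way ties
are broken, the colon ideal of the monomials before `x ^ f` by `x ^ f` is generated by variables.
Indeed each earlier `f'` satisfies `f i < f' i` for a variable `xᵢ` in that colon ideal. -/
def IsLinearQuotientsKey [LinearOrder α] (key : (σ → ℕ) → α) (M : Set (σ → ℕ)) : Prop :=
  ∀ f ∈ M, ∀ f' ∈ M, f' ≠ f → key f' ≤ key f →
    ∃ i, f i < f' i ∧ ∃ g ∈ M, key g < key f ∧ LeAddSingle i g f

/-- The monomials with exponents in `M` can be put into an order of linear quotients. -/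
def HasLinearQuotientsOrder (M : Set (σ → ℕ)) : Prop :=
  ∃ key : (σ → ℕ) → ℕ, IsLinearQuotientsKey key M

/-- The set of minimal elements of a set of exponent vectors: for the exponents of the monomials in
a monomial ideal, these are the exponents of its minimal generators. -/
def minElts (U : Set (σ → ℕ)) : Set (σ → ℕ) := {f | Minimal (· ∈ U) f}

/-- The minimal generators of the monomial ideal generated by `U` have linear quotients. -/
def HasLinearQuotients (U : Set (σ → ℕ)) : Prop := HasLinearQuotientsOrder (minElts U)

theorem exists_mem_minElts_le [Finite σ] {U : Set (σ → ℕ)} {f : σ → ℕ} (hf : f ∈ U) :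
    ∃ g ∈ minElts U, g ≤ f :=
  (exists_minimal_le_of_wellFoundedLT (· ∈ U) f hf).imp fun _ h => ⟨h.2, h.1⟩

theorem finite_minElts [Finite σ] (U : Set (σ → ℕ)) : (minElts U).Finite :=
  (setOfPred_minimal_antichain _).finite_of_partiallyWellOrderedOn
    (Set.isPWO_of_wellQuasiOrderedLE _)

theorem IsLinearQuotientsKey.hasLinearQuotientsOrder [LinearOrder α] {M : Set (σ → ℕ)}
    {key : (σ → ℕ) → α} (h : IsLinearQuotientsKey key M) (hM : M.Finite) :
    HasLinearQuotientsOrder M := by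
  let rank (f : σ → ℕ) : ℕ := {h ∈ M | key h < key f}.ncard
  have rank_lt_rank : ∀ f ∈ M, ∀ g, key f < key g → rank f < rank g := fun f hf g hfg =>
    Set.ncard_lt_ncard ⟨fun x hx => ⟨hx.1, hx.2.trans hfg⟩, fun hsub =>
      lt_irrefl _ (hsub (show f ∈ {h ∈ M | key h < key g} from ⟨hf, hfg⟩)).2⟩
      (hM.subset fun x hx => hx.1)
  refine ⟨rank, fun f hf f' hf' hne hle => ?_⟩
  have hkey : key f' ≤ key f := not_lt.1 fun hlt => (rank_lt_rank f hf f' hlt).not_ge hle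
  obtain ⟨i, hi, g, hg, hgf, hle⟩ := h f hf f' hf' hne hkey
  exact ⟨i, hi, g, hg, rank_lt_rank g hg f hgf, hle⟩

theorem HasLinearQuotientsOrder.image {M : Set (σ → ℕ)} (hM : HasLinearQuotientsOrder M)
    {φ : (σ → ℕ) → τ → ℕ} (hφ : φ.Injective) (e : σ → τ)
    (hlt : ∀ f f' i, f i < f' i → φ f (e i) < φ f' (e i))
    (hle : ∀ f g i, LeAddSingle i g f → LeAddSingle (e i) (φ g) (φ f)) :
    HasLinearQuotientsOrder (φ '' M) := by
  obtain ⟨key, hkey⟩ := hM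
  refine ⟨key ∘ Function.invFun φ, ?_⟩
  rintro _ ⟨f, hf, rfl⟩ _ ⟨f', hf', rfl⟩ hne
  simp only [Function.comp_apply, Function.leftInverse_invFun hφ _]
  intro hk
  obtain ⟨i, hi, g, hg, hgk, hgf⟩ := hkey f hf f' hf' (fun h => hne (h ▸ rfl)) hk
  exact ⟨e i, hlt f f' i hi, φ g, ⟨g, hg, rfl⟩,
    by rwa [Function.leftInverse_invFun hφ], hle f g i hgf⟩

/-- The order is `M₁` first, then the rest of `M₂`. -/
theorem HasLinearQuotientsOrder.union {M₁ M₂ : Set (σ → ℕ)} (h₁ : HasLinearQuotientsOrder M₁)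
    (h₂ : HasLinearQuotientsOrder M₂) (hfin : (M₁ ∪ M₂).Finite)
    (h : ∀ f ∈ M₂, ∀ f' ∈ M₁, ∃ i, f i < f' i ∧ ∃ g ∈ M₁, LeAddSingle i g f) :
    HasLinearQuotientsOrder (M₁ ∪ M₂) := by
  classical
  obtain ⟨key₁, h₁⟩ := h₁
  obtain ⟨key₂, h₂⟩ := h₂
  let key (f : σ → ℕ) : ℕ ×ₗ ℕ := if f ∈ M₁ then toLex (0, key₁ f) else toLex (1, key₂ f)
  have key_lt : ∀ f g, f ∉ M₁ → (g ∈ M₁ ∨ key₂ g < key₂ f) → key g < key f := by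
    intro f g hf hg
    by_cases hg₁ : g ∈ M₁
    · simp [key, hf, hg₁, Prod.Lex.toLex_lt_toLex]
    · simpa [key, hf, hg₁, Prod.Lex.toLex_lt_toLex] using hg
  refine IsLinearQuotientsKey.hasLinearQuotientsOrder (key := key) ?_ hfin
  intro f hf f' hf' hne hle
  by_cases hf₁ : f ∈ M₁
  · have hf'₁ : f' ∈ M₁ := by
      by_contra hf'₁
      simp [key, hf₁, hf'₁, Prod.Lex.toLex_le_toLex] at hle
    obtain ⟨i, hi, g, hg, hgf, hgle⟩ := h₁ f hf₁ f' hf'₁ hne (by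
      simpa [key, hf₁, hf'₁, Prod.Lex.toLex_le_toLex] using hle)
    exact ⟨i, hi, g, .inl hg, by simpa [key, hg, hf₁, Prod.Lex.toLex_lt_toLex] using hgf, hgle⟩
  have hf₂ : f ∈ M₂ := hf.resolve_left hf₁
  by_cases hf'₁ : f' ∈ M₁
  · obtain ⟨i, hi, g, hg, hgle⟩ := h f hf₂ f' hf'₁
    exact ⟨i, hi, g, .inl hg, key_lt f g hf₁ (.inl hg), hgle⟩
  · obtain ⟨i, hi, g, hg, hgf, hgle⟩ := h₂ f hf₂ f' (hf'.resolve_left hf'₁) hne (by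
      simpa [key, hf₁, hf'₁, Prod.Lex.toLex_le_toLex] using hle)
    exact ⟨i, hi, g, .inr hg, key_lt f g hf₁ (.inr hgf), hgle⟩

theorem hasLinearQuotients_Ici (l : σ → ℕ) : HasLinearQuotients (Set.Ici l) := by
  have eq_of_mem : ∀ f ∈ minElts (Set.Ici l), f = l := fun f hf =>
    (hf.eq_of_le Set.self_mem_Ici hf.1).symm
  exact ⟨0, fun f hf f' hf' hne => (hne ((eq_of_mem f' hf').trans (eq_of_mem f hf).symm)).elim⟩

theorem minElts_comp_equiv (e : σ ≃ τ) (U : Set (τ → ℕ)) :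
    minElts {t : σ → ℕ | t ∘ e.symm ∈ U} = (· ∘ e) '' minElts U := by
  ext f
  have hf : (f ∘ e.symm) ∘ e = f := by ext; simp
  refine ⟨fun h => ⟨f ∘ e.symm, ⟨h.1, fun g hg hgf => ?_⟩, hf⟩, ?_⟩
  · have hge : (g ∘ e) ∘ e.symm = g := by ext; simp
    have := h.2 (y := g ∘ e) (by simpa only [Set.mem_ofPred_eq, hge] using hg)
      fun x => by simpa using hgf (e x)
    exact fun y => by simpa using this (e.symm y)
  · rintro ⟨g, hg, rfl⟩
    have hge : (g ∘ e) ∘ e.symm = g := by ext; simp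
    refine ⟨by simpa only [Set.mem_ofPred_eq, hge] using hg.1, fun h hh hle x => ?_⟩
    simpa using hg.2 hh (fun y => by simpa using hle (e.symm y)) (e x)

theorem HasLinearQuotients.comp_equiv (e : σ ≃ τ) {U : Set (τ → ℕ)} (hU : HasLinearQuotients U) :
    HasLinearQuotients {t : σ → ℕ | t ∘ e.symm ∈ U} := by
  rw [HasLinearQuotients, minElts_comp_equiv]
  refine HasLinearQuotientsOrder.image hU e.surjective.injective_comp_right e.symm
    (fun f f' i h => by simpa using h) fun f g i h => ⟨by simpa using h.1, fun j hj => h.2 _ ?_⟩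
  exact fun h => hj (by simp [← h])

theorem minElts_add_const (U : Set (σ → ℕ)) (c : σ → ℕ) :
    minElts {s | ∃ m ∈ U, m + c ≤ s} = (· + c) '' minElts U := by
  ext f
  constructor
  · intro hf
    obtain ⟨m, hm, hmf⟩ := hf.1
    have hfm : m + c = f := hf.eq_of_le ⟨m, hm, le_rfl⟩ hmf
    refine ⟨m, ⟨hm, fun m' hm' hle => ?_⟩, hfm⟩
    have hfm' : m' + c = f := hf.eq_of_le ⟨m', hm', le_rfl⟩ (hfm ▸ add_le_add_left hle c)
    exact (add_right_cancel (hfm.trans hfm'.symm)).le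
  · rintro ⟨m, hm, rfl⟩
    refine ⟨⟨m, hm.1, le_rfl⟩, ?_⟩
    rintro s ⟨m', hm', hs⟩ hle
    exact (add_le_add_left (hm.2 hm' (le_of_add_le_add_right (hs.trans hle))) c).trans hs

theorem HasLinearQuotients.add_const {U : Set (σ → ℕ)} (hU : HasLinearQuotients U) (c : σ → ℕ) :
    HasLinearQuotients {s | ∃ m ∈ U, m + c ≤ s} := by
  rw [HasLinearQuotients, minElts_add_const]
  exact HasLinearQuotientsOrder.image hU (add_left_injective c) id
    (fun f f' i h => Nat.add_lt_add_right h (c i)) fun f g i h =>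
      ⟨by have := h.1; simp only [id, Pi.add_apply]; omega,
        fun j hj => Nat.add_le_add_right (h.2 j hj) (c j)⟩

section Split

variable [Finite σ] {U U₂ : Set (σ → ℕ)} {i : σ} {t : ℕ}

theorem minElts_eq_union_of_split (hsub : U₂ ⊆ U) (hU₂ : ∀ c ∈ U, c i ≤ t → c ∈ U₂)
    (hmin₂ : ∀ c ∈ minElts U₂, c i ≤ t)
    (hup : ∀ c ∈ minElts U₂, ∃ d ∈ U, t < d i ∧ LeAddSingle i d c ∧ ∃ w, d w < c w) :
    minElts U = minElts {c ∈ U | t < c i} ∪ minElts U₂ := by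
  ext c
  constructor
  · intro hc
    rcases lt_or_ge t (c i) with hci | hci
    · exact .inl ⟨⟨hc.1, hci⟩, fun d hd hdc => hc.2 hd.1 hdc⟩
    · exact .inr ⟨hU₂ c hc.1 hci, fun d hd hdc => hc.2 (hsub hd) hdc⟩
  rintro (hc | hc)
  · refine ⟨hc.1.1, fun d hd hdc => ?_⟩
    by_cases hdi : t < d i
    · exact hc.2 ⟨hd, hdi⟩ hdc
    obtain ⟨d', hd', hd'd⟩ := exists_mem_minElts_le (hU₂ d hd (not_lt.1 hdi))
    have hd'c := hd'd.trans hdc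
    obtain ⟨e, he, hei, hed', w, hw⟩ := hup d' hd'
    have hec : e ≤ c := fun j => by
      rcases eq_or_ne j i with rfl | hj
      · exact hed'.1.trans (((Nat.succ_le_succ (hmin₂ d' hd')).trans hc.1.2))
      · exact (hed'.2 j hj).trans (hd'c j)
    exact absurd (hc.2 ⟨he, hei⟩ hec w) (not_le.2 (hw.trans_le (hd'c w)))
  · exact ⟨hsub hc.1, fun d hd hdc => hc.2 (hU₂ d hd ((hdc i).trans (hmin₂ c hc))) hdc⟩

theorem HasLinearQuotients.of_split (h₁ : HasLinearQuotients {c ∈ U | t < c i})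
    (h₂ : HasLinearQuotients U₂) (hsub : U₂ ⊆ U) (hU₂ : ∀ c ∈ U, c i ≤ t → c ∈ U₂)
    (hmin₂ : ∀ c ∈ minElts U₂, c i ≤ t)
    (hup : ∀ c ∈ minElts U₂, ∃ d ∈ U, t < d i ∧ LeAddSingle i d c ∧ ∃ w, d w < c w) :
    HasLinearQuotients U := by
  rw [HasLinearQuotients, minElts_eq_union_of_split hsub hU₂ hmin₂ hup]
  refine h₁.union h₂ ((finite_minElts _).union (finite_minElts _)) fun f hf f' hf' => ?_
  obtain ⟨d, hd, hdi, hdf, -⟩ := hup f hf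
  obtain ⟨g, hg, hgd⟩ := exists_mem_minElts_le (U := {c ∈ U | t < c i}) ⟨hd, hdi⟩
  exact ⟨i, (hmin₂ f hf).trans_lt hf'.1.2, g, hg, hdf.of_le_left hgd⟩

end Split

section Sigma

variable {I : Type*} {W : I → Type*}

/-- The exponent vectors on `⨆ i, W i` whose restriction to each `W i` lies in `F i`: for exponents
of monomial ideals in disjoint sets of variables, this is their product ideal. -/
def sigmaSet (F : ∀ i, Set (W i → ℕ)) : Set ((Σ i, W i) → ℕ) :=
  {s | ∀ i, (fun w => s ⟨i, w⟩) ∈ F i}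

/-- The vector `s` with its restriction to `W i` replaced by `r`. -/
def updateBlock [DecidableEq I] (s : (Σ i, W i) → ℕ) (i : I) (r : W i → ℕ) : (Σ i, W i) → ℕ :=
  fun p => Function.update (fun j w => s ⟨j, w⟩) i r p.1 p.2

variable [DecidableEq I] {s s' : (Σ i, W i) → ℕ} {i : I} {r : W i → ℕ}

theorem updateBlock_same (s : (Σ i, W i) → ℕ) (i : I) (r : W i → ℕ) (w : W i) :
    updateBlock s i r ⟨i, w⟩ = r w := by simp [updateBlock]

theorem updateBlock_of_ne {j : I} (hj : j ≠ i) (w : W j) :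
    updateBlock s i r ⟨j, w⟩ = s ⟨j, w⟩ := by simp [updateBlock, hj]

theorem updateBlock_mem_sigmaSet {F : ∀ i, Set (W i → ℕ)} (hs : s ∈ sigmaSet F) (hr : r ∈ F i) :
    updateBlock s i r ∈ sigmaSet F := fun j => by
  rcases eq_or_ne j i with rfl | hj
  · simpa only [updateBlock_same] using hr
  · simpa only [updateBlock_of_ne hj] using hs j

theorem updateBlock_le (hr : ∀ w, r w ≤ s ⟨i, w⟩) : updateBlock s i r ≤ s := by
  rintro ⟨j, w⟩
  rcases eq_or_ne j i with rfl | hj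
  · simpa only [updateBlock_same] using hr w
  · rw [updateBlock_of_ne hj]

theorem leAddSingle_updateBlock {w : W i} (hr : LeAddSingle w r fun w => s ⟨i, w⟩) :
    LeAddSingle ⟨i, w⟩ (updateBlock s i r) s := by
  refine ⟨by simpa only [updateBlock_same] using hr.1, ?_⟩
  rintro ⟨j, w'⟩ hne
  rcases eq_or_ne j i with rfl | hj
  · rw [updateBlock_same]
    exact hr.2 w' fun h => hne (h ▸ rfl)
  · rw [updateBlock_of_ne hj]

omit [DecidableEq I] in
theorem minElts_sigmaSet (F : ∀ i, Set (W i → ℕ)) :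
    minElts (sigmaSet F) = sigmaSet fun i => minElts (F i) := by
  classical
  ext s
  refine ⟨fun hs i => ⟨hs.1 i, fun r hr hrs w => ?_⟩, fun hs => ⟨fun i => (hs i).1, ?_⟩⟩
  · simpa only [updateBlock_same] using
      hs.2 (updateBlock_mem_sigmaSet hs.1 hr) (updateBlock_le hrs) ⟨i, w⟩
  · exact fun s' hs' hle p => (hs p.1).2 (hs' p.1) (fun w => hle ⟨p.1, w⟩) p.2

omit [DecidableEq I] in
theorem HasLinearQuotients.sigmaSet [Finite I] {F : ∀ i, Set (W i → ℕ)}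
    (hF : ∀ i, HasLinearQuotients (F i)) : HasLinearQuotients (sigmaSet F) := by
  classical
  have := Fintype.ofFinite I
  rw [HasLinearQuotients, minElts_sigmaSet]
  choose key hkey using hF
  refine ⟨fun s => ∑ i, key i fun w => s ⟨i, w⟩, fun f hf f' hf' hne hle => ?_⟩
  obtain ⟨i, hi, hik⟩ : ∃ i, (fun w => f' ⟨i, w⟩) ≠ (fun w => f ⟨i, w⟩) ∧
      key i (fun w => f' ⟨i, w⟩) ≤ key i fun w => f ⟨i, w⟩ := by
    by_contra! hlt
    obtain ⟨⟨i, w⟩, hiw⟩ := Function.ne_iff.1 hne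
    refine hle.not_gt (Finset.sum_lt_sum (fun j _ => ?_)
      ⟨i, Finset.mem_univ i, hlt i fun h => hiw (congrFun h w)⟩)
    by_cases hj : (fun w => f' ⟨j, w⟩) = fun w => f ⟨j, w⟩
    · rw [hj]
    · exact (hlt j hj).le
  obtain ⟨w, hw, r, hr, hrk, hrf⟩ := hkey i _ (hf i) _ (hf' i) hi hik
  refine ⟨⟨i, w⟩, hw, updateBlock f i r, updateBlock_mem_sigmaSet hf hr, ?_,
    leAddSingle_updateBlock hrf⟩
  refine Finset.sum_lt_sum (fun j _ => ?_)
    ⟨i, Finset.mem_univ i, by simpa only [updateBlock_same] using hrk⟩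
  rcases eq_or_ne j i with rfl | hj
  · simpa only [updateBlock_same] using hrk.le
  · simp only [updateBlock_of_ne hj, le_refl]

end Sigma

section Fibered

variable {V : Type*}

/-- The exponent vectors on `V ⊔ τ` whose restriction to `V` is at least some `a ∈ A` and whose
restriction to `τ` lies in `F a`. -/
def fiberedSet (A : Set (V → ℕ)) (F : (V → ℕ) → Set (τ → ℕ)) : Set (V ⊕ τ → ℕ) :=
  {t | ∃ a ∈ A, a ≤ t ∘ Sum.inl ∧ t ∘ Sum.inr ∈ F a}

/-- The conditions on a family `F` of sets of exponent vectors over a base `A` under which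
`fiberedSet A F` inherits linear quotients from the fibres `F a`. Increasing a coordinate of the
base by one strictly decreases the exponents that are needed in the fibre. -/
structure IsFiberedFamily [DecidableEq V] (A : Set (V → ℕ)) (F : (V → ℕ) → Set (τ → ℕ)) :
    Prop where
  add_single_mem : ∀ a ∈ A, ∀ b ∈ A, ∀ v, a v < b v → a + Pi.single v 1 ∈ A
  mono : ∀ a ∈ A, ∀ b ∈ A, a ≤ b → F a ⊆ F b
  exists_lt : ∀ a ∈ A, ∀ v, a + Pi.single v 1 ∈ A →
    ∀ s ∈ F a, ∃ s' ∈ F (a + Pi.single v 1), s' < s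

variable [DecidableEq V] {A : Set (V → ℕ)} {F : (V → ℕ) → Set (τ → ℕ)}

theorem IsFiberedFamily.exists_lt_of_lt (hF : IsFiberedFamily A F) {a b : V → ℕ} (ha : a ∈ A)
    (hb : b ∈ A) (hab : a < b) {s : τ → ℕ} (hs : s ∈ F a) : ∃ s' ∈ F b, s' < s := by
  obtain ⟨hle, v, hv⟩ := Pi.lt_def.1 hab
  have hav := hF.add_single_mem a ha b hb v hv
  obtain ⟨s', hs', hlt⟩ := hF.exists_lt a ha v hav s hs
  refine ⟨s', hF.mono _ hav b hb (fun u => ?_) hs', hlt⟩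
  rcases eq_or_ne u v with rfl | hu
  · simpa using hv
  · simpa [hu] using hle u

theorem IsFiberedFamily.elim_mem_minElts_iff (hF : IsFiberedFamily A F) (a : V → ℕ) (s : τ → ℕ) :
    Sum.elim a s ∈ minElts (fiberedSet A F) ↔ a ∈ A ∧ s ∈ minElts (F a) := by
  constructor
  · intro h
    obtain ⟨b, hb, hba, hs⟩ := h.1
    obtain rfl : b = a := hba.antisymm fun v =>
      h.2 (y := Sum.elim b s) ⟨b, hb, le_rfl, hs⟩ (Sum.elim_le_elim_iff.2 ⟨hba, le_rfl⟩) (.inl v)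
    refine ⟨hb, hs, fun r hr hrs w => ?_⟩
    exact h.2 (y := Sum.elim b r) ⟨b, hb, le_rfl, hr⟩
      (Sum.elim_le_elim_iff.2 ⟨le_rfl, hrs⟩) (.inr w)
  · rintro ⟨ha, hs⟩
    refine ⟨⟨a, ha, le_rfl, hs.1⟩, ?_⟩
    rintro t ⟨b, hb, hbt, ht⟩ hts
    have hta : t ∘ Sum.inl ≤ a := fun v => hts (.inl v)
    have hts' : t ∘ Sum.inr ≤ s := fun w => hts (.inr w)
    obtain rfl | hlt := (hbt.trans hta).eq_or_lt
    · exact Sum.forall.2 ⟨hbt, hs.2 ht hts'⟩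
    · obtain ⟨s', hs', hlt⟩ := hF.exists_lt_of_lt hb ha hlt ht
      exact absurd (hs.2 hs' (hlt.le.trans hts')) (hlt.trans_le hts').not_ge

theorem IsFiberedFamily.exists_mem_minElts_leAddSingle [Finite τ] (hF : IsFiberedFamily A F)
    {a a' : V → ℕ} {s : τ → ℕ} (h : Sum.elim a s ∈ minElts (fiberedSet A F)) (ha' : a' ∈ A)
    {v : V} (hv : a v < a' v) :
    ∃ g, Sum.elim (a + Pi.single v 1) g ∈ minElts (fiberedSet A F) ∧
      LeAddSingle (.inl v) (Sum.elim (a + Pi.single v 1) g) (Sum.elim a s) := by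
  obtain ⟨ha, hs⟩ := (hF.elim_mem_minElts_iff a s).1 h
  have hav := hF.add_single_mem a ha a' ha' v hv
  obtain ⟨g, hg, hgs⟩ := exists_mem_minElts_le (hF.mono a ha _ hav le_self_add hs.1)
  refine ⟨g, (hF.elim_mem_minElts_iff _ _).2 ⟨hav, hg⟩, by simp, ?_⟩
  rintro (u | w) hj
  · exact (leAddSingle_add_single a v).2 u fun h => hj (h ▸ rfl)
  · exact hgs w

/-- The generators are sorted by decreasing degree in the variables of the base, and those over
the same point of the base as in its fibre. -/
theorem IsFiberedFamily.hasLinearQuotients [Finite V] [Finite τ] (hF : IsFiberedFamily A F)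
    (hfib : ∀ a ∈ A, HasLinearQuotients (F a)) : HasLinearQuotients (fiberedSet A F) := by
  have := Fintype.ofFinite V
  have hkey : ∀ a, ∃ key : (τ → ℕ) → ℕ, a ∈ A → IsLinearQuotientsKey key (minElts (F a)) :=
    fun a => by
      by_cases ha : a ∈ A
      · exact (hfib a ha).imp fun _ h _ => h
      · exact ⟨0, fun h => absurd h ha⟩
  choose key hkey using hkey
  let fullKey (t : V ⊕ τ → ℕ) : ℕᵒᵈ ×ₗ ℕ :=
    toLex (OrderDual.toDual (∑ v, t (.inl v)), key (t ∘ Sum.inl) (t ∘ Sum.inr))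
  refine IsLinearQuotientsKey.hasLinearQuotientsOrder (key := fullKey) ?_ (finite_minElts _)
  intro f hf f' hf' hne hle
  obtain ⟨a, s, rfl⟩ : ∃ a s, f = Sum.elim a s := ⟨_, _, (Sum.elim_comp_inl_inr f).symm⟩
  obtain ⟨a', s', rfl⟩ : ∃ a s, f' = Sum.elim a s := ⟨_, _, (Sum.elim_comp_inl_inr f').symm⟩
  obtain ⟨ha, hs⟩ := (hF.elim_mem_minElts_iff a s).1 hf
  obtain ⟨ha', hs'⟩ := (hF.elim_mem_minElts_iff a' s').1 hf'
  simp only [fullKey, Sum.elim_comp_inl, Sum.elim_comp_inr, Sum.elim_inl,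
    Prod.Lex.toLex_le_toLex, OrderDual.toDual_lt_toDual, OrderDual.toDual_inj] at hle
  obtain rfl | haa := eq_or_ne a' a
  · obtain ⟨w, hw, g, hg, hgk, hgs⟩ := hkey a' ha s hs s' hs' (fun h => hne (h ▸ rfl)) (by
      simpa using hle)
    refine ⟨.inr w, hw, Sum.elim a' g, (hF.elim_mem_minElts_iff a' g).2 ⟨ha, hg⟩, ?_, hgs.1, ?_⟩
    · simpa [fullKey, Prod.Lex.toLex_lt_toLex] using hgk
    · rintro (v | w') hj
      · exact le_rfl
      · exact hgs.2 w' fun h => hj (h ▸ rfl)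
  · obtain ⟨v, hv⟩ : ∃ v, a v < a' v := by
      by_contra! hge
      have hlt : ∑ v, a' v < ∑ v, a v :=
        Fintype.sum_strictMono (lt_of_le_of_ne (show a' ≤ a from hge) haa)
      omega
    obtain ⟨g, hg, hgs⟩ := hF.exists_mem_minElts_leAddSingle hf ha' hv
    refine ⟨.inl v, hv, _, hg, ?_, hgs⟩
    refine Prod.Lex.toLex_lt_toLex.2 (.inl (OrderDual.toDual_lt_toDual.2 ?_))
    exact Finset.sum_lt_sum (fun u _ => by simp) ⟨v, Finset.mem_univ v, by simp⟩

end Fibered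

end LinearQuotients

/-! ### Linear resolutions from linear quotients -/

section Resolution

open MvPolynomial

variable {σ K ι κ M : Type*} [Field K] [AddCommGroup M] [Module (MvPolynomial σ K) M]

/-- For a sequence `g` of elements of a module over the polynomial ring: each colon
`(gₗ : l < j) : gⱼ` is generated by the variables `xᵢ` with `i ∈ s j`, and each relation
`xᵢ gⱼ = ∑ l < j, c j i l • gₗ` has linear coefficients. -/
structure IsLinearColonData [Fintype ι] [LinearOrder ι] (g : ι → M) (s : ι → Set σ)
    (c : ι → σ → ι → MvPolynomial σ K) : Prop where
  isHomogeneous : ∀ j, ∀ i ∈ s j, ∀ l, (c j i l).IsHomogeneous 1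
  eq_zero : ∀ j, ∀ i ∈ s j, ∀ l, j ≤ l → c j i l = 0
  X_smul : ∀ j, ∀ i ∈ s j, (X i : MvPolynomial σ K) • g j = ∑ l, c j i l • g l
  mem_span_X : ∀ j, ∀ p : MvPolynomial σ K,
    p • g j ∈ Submodule.span (MvPolynomial σ K) (g '' Set.Iio j) → p ∈ Ideal.span (X '' s j)

variable (σ K) in
/-- The sequence `g` has colons generated by variables, with linear relations. This property passes
to a suitably ordered generating sequence of the first syzygies, and therefore yields linear
resolutions. -/
def HasLinearColons [Fintype ι] [LinearOrder ι] (g : ι → M) : Prop :=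
  ∃ (s : ι → Set σ) (c : ι → σ → ι → MvPolynomial σ K), IsLinearColonData g s c

theorem HasLinearColons.comp_orderIso [Fintype ι] [LinearOrder ι] [Fintype κ] [LinearOrder κ]
    {g : ι → M} (hg : HasLinearColons σ K g) (e : κ ≃o ι) : HasLinearColons σ K (g ∘ e) := by
  obtain ⟨s, c, h⟩ := hg
  refine ⟨s ∘ e, fun j i l => c (e j) i (e l), fun j i hi l => h.isHomogeneous _ i hi _,
    fun j i hi l hl => h.eq_zero _ i hi _ (e.monotone hl), fun j i hi => ?_,
    fun j p hp => h.mem_span_X _ p ?_⟩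
  · rw [Function.comp_apply, h.X_smul _ i hi]
    exact (Equiv.sum_comp e.toEquiv fun l => c (e j) i l • g l).symm
  · rwa [Set.image_comp, e.image_Iio] at hp

theorem homogeneousComponent_mul_of_isHomogeneous {v : MvPolynomial σ K} {d : ℕ}
    (hv : v.IsHomogeneous d) (a : MvPolynomial σ K) (e : ℕ) :
    homogeneousComponent (e + d) (a * v) = homogeneousComponent e a * v := by
  let _ := gradedAlgebra (σ := σ) (R := K)
  rw [← decomposition.decompose'_apply, ← decomposition.decompose'_apply]
  exact DirectSum.coe_decompose_mul_add_of_right_mem (homogeneousSubmodule σ K) hv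

theorem exists_isHomogeneous_coeff_of_mem_span [Fintype κ] {v : κ → ι → MvPolynomial σ K} {d e : ℕ}
    (hv : ∀ q l, (v q l).IsHomogeneous d) {w : ι → MvPolynomial σ K}
    (hw : ∀ l, (w l).IsHomogeneous (e + d)) {Q : Set κ}
    (hmem : w ∈ Submodule.span (MvPolynomial σ K) (v '' Q)) :
    ∃ a : κ → MvPolynomial σ K, (∀ q, (a q).IsHomogeneous e) ∧ (∀ q ∉ Q, a q = 0) ∧
      w = ∑ q, a q • v q := by
  obtain ⟨a, ha, haw⟩ := (Finsupp.mem_span_image_iff_linearCombination _).1 hmem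
  rw [Finsupp.linearCombination_apply, Finsupp.sum_fintype _ _ (by simp)] at haw
  refine ⟨fun q => homogeneousComponent e (a q), fun q => homogeneousComponent_isHomogeneous e _,
    fun q hq => ?_, ?_⟩
  · have : a q = 0 := Finsupp.notMem_support_iff.1 fun h => hq (ha h)
    simp only [this, map_zero]
  · ext1 l
    calc w l = homogeneousComponent (e + d) (w l) := by
          rw [homogeneousComponent_of_mem (hw l), if_pos rfl]
      _ = ∑ q, homogeneousComponent (e + d) (a q * v q l) := by
          rw [← haw, Finset.sum_apply, map_sum]; rfl
      _ = (∑ q, homogeneousComponent e (a q) • v q) l := by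
          simp only [Finset.sum_apply, Pi.smul_apply, smul_eq_mul,
            homogeneousComponent_mul_of_isHomogeneous (hv _ l)]

theorem mem_span_X_of_mul_X_mem {s : Set σ} {i : σ} (hi : i ∉ s) {q : MvPolynomial σ K}
    (h : q * X i ∈ Ideal.span (X '' s : Set (MvPolynomial σ K))) :
    q ∈ Ideal.span (X '' s : Set (MvPolynomial σ K)) := by
  rw [mem_ideal_span_X_image] at h ⊢
  intro m hm
  obtain ⟨l, hl, hne⟩ := h (m + Finsupp.single i 1) (by
    rw [mem_support_iff] at hm ⊢
    rwa [coeff_mul_X])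
  have hli : l ≠ i := fun h => hi (h ▸ hl)
  exact ⟨l, hl, by simpa [hli] using hne⟩

section Syzygies

variable [LinearOrder ι] {g : ι → M} {s : ι → Set σ} {c : ι → σ → ι → MvPolynomial σ K}

/-- The syzygy of `g` given by the relation `xᵢ gⱼ = ∑ l, c j i l • gₗ`. -/
noncomputable def syzygyVec (c : ι → σ → ι → MvPolynomial σ K) (j : ι) (i : σ) :
    ι → MvPolynomial σ K :=
  Pi.single j (X i) - c j i

/-- The index set of the generating syzygies `syzygyVec c j i` with `i ∈ s j`, in lexicographic
order. -/
abbrev SyzygyIndex (s : ι → Set σ) : Type _ := {p : ι ×ₗ σ // (ofLex p).2 ∈ s (ofLex p).1}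

instance [Finite ι] [Finite σ] : Finite (SyzygyIndex s) := Subtype.finite (α := ι × σ)

/-- The generating syzygies as a family. -/
noncomputable def syzygyFamily (s : ι → Set σ) (c : ι → σ → ι → MvPolynomial σ K)
    (p : SyzygyIndex s) : ι → MvPolynomial σ K :=
  syzygyVec c (ofLex p.1).1 (ofLex p.1).2

theorem image_syzygyFamily (L : Finset ι) :
    syzygyFamily s c '' {p | (ofLex p.1).1 ∈ L} = ⋃ j ∈ L, syzygyVec c j '' s j := by
  ext v
  simp only [Set.mem_iUnion]
  constructor
  · rintro ⟨p, hp, rfl⟩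
    exact ⟨_, hp, _, p.2, rfl⟩
  · rintro ⟨j, hj, i, hi, rfl⟩
    exact ⟨⟨toLex (j, i), hi⟩, hj, rfl⟩

variable [Fintype ι] {j : ι} {i : σ}

namespace IsLinearColonData

theorem isHomogeneous_syzygyVec (h : IsLinearColonData g s c) (hi : i ∈ s j) (l : ι) :
    (syzygyVec c j i l).IsHomogeneous 1 := by
  refine IsHomogeneous.sub ?_ (h.isHomogeneous j i hi l)
  rcases eq_or_ne l j with rfl | hl
  · simpa using isHomogeneous_X K i
  · simpa [hl] using isHomogeneous_zero σ K 1

theorem syzygyVec_self (h : IsLinearColonData g s c) (hi : i ∈ s j) :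
    syzygyVec c j i j = X i := by
  simp [syzygyVec, h.eq_zero j i hi j le_rfl]

theorem syzygyVec_of_gt (h : IsLinearColonData g s c) (hi : i ∈ s j) {l : ι} (hl : j < l) :
    syzygyVec c j i l = 0 := by
  simp [syzygyVec, h.eq_zero j i hi l hl.le, hl.ne']

theorem syzygyVec_mem_ker (h : IsLinearColonData g s c) (hi : i ∈ s j) :
    syzygyVec c j i ∈ LinearMap.ker (Fintype.linearCombination (MvPolynomial σ K) g) := by
  rw [LinearMap.mem_ker, syzygyVec, map_sub, Fintype.linearCombination_apply_single,
    h.X_smul j i hi, Fintype.linearCombination_apply, sub_self]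

/-- Colon ideals are the leading coefficients of syzygies, so this is the division step in the
proof that the `syzygyVec`s generate all syzygies. -/
theorem exists_mem_span_syzygyVec (h : IsLinearColonData g s c) {a : ι → MvPolynomial σ K}
    (ha : a ∈ LinearMap.ker (Fintype.linearCombination (MvPolynomial σ K) g))
    (ha0 : ∀ l, j < l → a l = 0) :
    ∃ v ∈ Submodule.span (MvPolynomial σ K) (syzygyVec c j '' s j), v j = a j ∧
      (∀ l, j < l → v l = 0) ∧
        v ∈ LinearMap.ker (Fintype.linearCombination (MvPolynomial σ K) g) := by
  have hcolon : a j ∈ Ideal.span (X '' s j) := by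
    refine h.mem_span_X j _ ?_
    rw [LinearMap.mem_ker, Fintype.linearCombination_apply,
      ← Finset.add_sum_erase _ _ (Finset.mem_univ j), ← eq_neg_iff_add_eq_zero] at ha
    rw [ha]
    refine neg_mem (Submodule.sum_mem _ fun l hl => ?_)
    rcases lt_or_gt_of_ne (Finset.ne_of_mem_erase hl) with hlj | hlj
    · exact Submodule.smul_mem _ _ (Submodule.subset_span ⟨l, hlj, rfl⟩)
    · simp [ha0 l hlj]
  have hmap : Ideal.span (X '' s j) =
      (Submodule.span (MvPolynomial σ K) (syzygyVec c j '' s j)).map (LinearMap.proj j) := by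
    rw [Submodule.map_span, Set.image_image]
    exact congrArg _ (Set.image_congr fun i hi => (h.syzygyVec_self hi).symm)
  obtain ⟨v, hv, hvj⟩ := hmap ▸ hcolon
  refine ⟨v, hv, hvj, fun l hl => ?_, ?_⟩
  · refine LinearMap.mem_ker.1 (Submodule.span_le (p := LinearMap.ker
      (LinearMap.proj (R := MvPolynomial σ K) (φ := fun _ => MvPolynomial σ K) l)).2 ?_ hv)
    rintro _ ⟨i, hi, rfl⟩
    exact h.syzygyVec_of_gt hi hl
  · refine Submodule.span_le.2 ?_ hv
    rintro _ ⟨i, hi, rfl⟩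
    exact h.syzygyVec_mem_ker hi

theorem mem_span_syzygyVec (h : IsLinearColonData g s c) {L : Finset ι}
    (hL : IsLowerSet (L : Set ι)) {a : ι → MvPolynomial σ K} (ha0 : ∀ l ∉ L, a l = 0)
    (ha : a ∈ LinearMap.ker (Fintype.linearCombination (MvPolynomial σ K) g)) :
    a ∈ Submodule.span (MvPolynomial σ K) (⋃ j ∈ L, syzygyVec c j '' s j) := by
  induction L using Finset.induction_on_max generalizing a with
  | empty =>
    obtain rfl : a = 0 := funext fun l => ha0 l (Finset.notMem_empty l)
    exact zero_mem _
  | insert j L hj ih =>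
    obtain ⟨v, hv, hvj, hv0, hvker⟩ := h.exists_mem_span_syzygyVec (j := j) ha fun l hl =>
      ha0 l fun hmem => (Finset.mem_insert.1 hmem).elim hl.ne' fun hmem => (hj l hmem).not_gt hl
    have hL' : IsLowerSet (L : Set ι) := fun x y hyx hx =>
      (Finset.mem_insert.1 (hL hyx (Finset.mem_insert_of_mem hx))).resolve_left
        (hyx.trans_lt (hj x hx)).ne
    have hsub := ih hL' (a := a - v) (fun l hl => ?_) (sub_mem ha hvker)
    · rw [← sub_add_cancel a v]
      refine add_mem (Submodule.span_mono (Set.biUnion_subset_biUnion_left ?_) hsub)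
        (Submodule.span_mono (Set.subset_biUnion_of_mem (Finset.mem_insert_self j L)) hv)
      exact fun _ => Finset.mem_insert_of_mem
    · rcases lt_trichotomy l j with hlj | rfl | hlj
      · have hlL : l ∈ insert j L := hL hlj.le (Finset.mem_insert_self j L)
        exact absurd ((Finset.mem_insert.1 hlL).resolve_left hlj.ne) hl
      · simp [hvj]
      · rw [Pi.sub_apply, hv0 l hlj, sub_zero]
        exact ha0 l (by simp [hl, hlj.ne'])

theorem ker_eq_span_range (h : IsLinearColonData g s c) :
    LinearMap.ker (Fintype.linearCombination (MvPolynomial σ K) g) =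
      Submodule.span (MvPolynomial σ K) (Set.range (syzygyFamily s c)) := by
  refine le_antisymm (fun a ha => ?_) (Submodule.span_le.2 ?_)
  · have := h.mem_span_syzygyVec (L := Finset.univ) (fun _ _ _ _ => Finset.mem_univ _)
      (fun l hl => absurd (Finset.mem_univ l) hl) ha
    rw [← image_syzygyFamily] at this
    exact Submodule.span_mono (Set.image_subset_range _ _) this
  · rintro _ ⟨p, rfl⟩
    exact h.syzygyVec_mem_ker p.2

/-- The syzygy `x_{i'} (syzygyVec c j i) - x_i (syzygyVec c j i')` has no entry at `j` or beyond, so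
it reduces to syzygies with smaller first index. -/
theorem exists_X_smul_syzygyVec_sub_eq [LinearOrder σ] [Fintype (SyzygyIndex s)]
    (h : IsLinearColonData g s c) {i' : σ} (hi : i ∈ s j) (hi' : i' ∈ s j) :
    ∃ a : SyzygyIndex s → MvPolynomial σ K, (∀ q, (a q).IsHomogeneous 1) ∧
      (∀ q, j ≤ (ofLex q.1).1 → a q = 0) ∧
      (X i' : MvPolynomial σ K) • syzygyVec c j i - (X i : MvPolynomial σ K) • syzygyVec c j i' =
        ∑ q, a q • syzygyFamily s c q := by
  have hmem := h.mem_span_syzygyVec (L := Finset.univ.filter (· < j))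
    (a := (X i' : MvPolynomial σ K) • syzygyVec c j i - (X i : MvPolynomial σ K) • syzygyVec c j i')
    (fun x y hyx hx => by simpa using hyx.trans_lt (by simpa using hx)) (fun l hl => ?_)
    (sub_mem (Submodule.smul_mem _ _ (h.syzygyVec_mem_ker hi))
      (Submodule.smul_mem _ _ (h.syzygyVec_mem_ker hi')))
  · rw [← image_syzygyFamily] at hmem
    obtain ⟨a, ha, ha0, haw⟩ := exists_isHomogeneous_coeff_of_mem_span (d := 1) (e := 1)
      (fun q l => h.isHomogeneous_syzygyVec q.2 l) (fun l =>
        ((isHomogeneous_X K i').mul (h.isHomogeneous_syzygyVec hi l)).sub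
          ((isHomogeneous_X K i).mul (h.isHomogeneous_syzygyVec hi' l))) hmem
    exact ⟨a, ha, fun q hq => ha0 q (by simpa using hq), haw⟩
  · have hjl : j ≤ l := by simpa using hl
    rcases hjl.eq_or_lt with rfl | hjl
    · simp [h.syzygyVec_self hi, h.syzygyVec_self hi', mul_comm]
    · simp [h.syzygyVec_of_gt hi hjl, h.syzygyVec_of_gt hi' hjl]

theorem mem_span_X_of_smul_syzygyVec_mem [LinearOrder σ] (h : IsLinearColonData g s c)
    (hi : i ∈ s j) {q : MvPolynomial σ K}
    (hq : q • syzygyVec c j i ∈ Submodule.span (MvPolynomial σ K)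
      (syzygyFamily s c '' Set.Iio ⟨toLex (j, i), hi⟩)) :
    q ∈ Ideal.span (X '' {l | l < i ∧ l ∈ s j} : Set (MvPolynomial σ K)) := by
  have hproj := Submodule.mem_map_of_mem (f := LinearMap.proj (R := MvPolynomial σ K) j) hq
  rw [Submodule.map_span] at hproj
  refine mem_span_X_of_mul_X_mem (i := i) (by simp) ?_
  have hqX : LinearMap.proj (R := MvPolynomial σ K) (φ := fun _ => MvPolynomial σ K) j
      (q • syzygyVec c j i) = q * X i := by simp [h.syzygyVec_self hi]
  rw [← hqX]
  refine Submodule.span_le.2 ?_ hproj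
  rintro _ ⟨_, ⟨⟨p, hp⟩, hlt, rfl⟩, rfl⟩
  obtain ⟨⟨j', i'⟩, rfl⟩ := toLex.surjective p
  change syzygyVec c j' i' j ∈ Ideal.span _
  change i' ∈ s j' at hp
  rcases Prod.Lex.toLex_lt_toLex.1 hlt with (hj' : j' < j) | ⟨rfl : j' = j, hi' : i' < i⟩
  · rw [h.syzygyVec_of_gt hp hj']
    exact zero_mem _
  · rw [h.syzygyVec_self hp]
    exact Ideal.subset_span ⟨i', ⟨hi', hp⟩, rfl⟩

theorem hasLinearColons_syzygyFamily [LinearOrder σ] [Fintype (SyzygyIndex s)]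
    (h : IsLinearColonData g s c) : HasLinearColons σ K (syzygyFamily s c) := by
  have hrel : ∀ p : SyzygyIndex s, ∀ i' ∈ {l | l < (ofLex p.1).2 ∧ l ∈ s (ofLex p.1).1},
      ∃ a : SyzygyIndex s → MvPolynomial σ K, (∀ q, (a q).IsHomogeneous 1) ∧
        (∀ q, p ≤ q → a q = 0) ∧
        (X i' : MvPolynomial σ K) • syzygyFamily s c p = ∑ q, a q • syzygyFamily s c q := by
    rintro ⟨p, hi⟩ i' ⟨hlt : i' < (ofLex p).2, hi' : i' ∈ s (ofLex p).1⟩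
    obtain ⟨⟨j, i⟩, rfl⟩ := toLex.surjective p
    obtain ⟨a, ha, ha0, haw⟩ := h.exists_X_smul_syzygyVec_sub_eq hi hi'
    let p' : SyzygyIndex s := ⟨toLex (j, i'), hi'⟩
    refine ⟨a + Pi.single p' (X i), fun q => (ha q).add ?_, fun q hq => ?_, ?_⟩
    · rcases eq_or_ne q p' with rfl | hq
      · simpa using isHomogeneous_X K i
      · simpa [hq] using isHomogeneous_zero σ K 1
    · have hp'q : p' < q := lt_of_lt_of_le
        (show toLex (j, i') < toLex (j, i) from Prod.Lex.toLex_lt_toLex.2 (.inr ⟨rfl, hlt⟩)) hq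
      have hjq : j ≤ (ofLex q.1).1 := (Prod.Lex.le_iff.1 hq).elim (fun h => h.le) fun h => h.1.le
      simp [ha0 q hjq, hp'q.ne']
    · simp only [Pi.add_apply, add_smul, Finset.sum_add_distrib, ← haw,
        ← Fintype.linearCombination_apply (MvPolynomial σ K) (v := syzygyFamily s c),
        Fintype.linearCombination_apply_single]
      exact (sub_add_cancel _ _).symm
  choose! a ha ha0 haw using hrel
  refine ⟨_, a, ha, ha0, haw, ?_⟩
  rintro ⟨p, hi⟩ q hq
  exact h.mem_span_X_of_smul_syzygyVec_mem hi hq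

end IsLinearColonData

end Syzygies

theorem HasLinearColons.exists_exact_mulVecLin [Finite σ] {b : ℕ} {g : Fin b → M}
    (hg : HasLinearColons σ K g) :
    ∃ (b' : ℕ) (D : Matrix (Fin b) (Fin b') (MvPolynomial σ K)),
      ((∀ a c, (D a c).IsHomogeneous 1) ∧ HasLinearColons σ K D.col) ∧
      Function.Exact D.mulVecLin (Fintype.linearCombination (MvPolynomial σ K) g) := by
  obtain ⟨n, ⟨eσ⟩⟩ := Finite.exists_equiv_fin σ
  let _ : LinearOrder σ := LinearOrder.lift' eσ eσ.injective
  obtain ⟨s, c, h⟩ := hg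
  have := Fintype.ofFinite (SyzygyIndex s)
  let e : Fin (Fintype.card (SyzygyIndex s)) ≃o SyzygyIndex s :=
    Fintype.orderIsoFinOfCardEq (SyzygyIndex s) rfl
  refine ⟨_, Matrix.of fun l q => syzygyFamily s c (e q) l,
    ⟨fun l q => h.isHomogeneous_syzygyVec (e q).2 l,
      h.hasLinearColons_syzygyFamily.comp_orderIso e⟩, LinearMap.exact_iff.2 ?_⟩
  rw [h.ker_eq_span_range, Matrix.range_mulVecLin]
  exact congrArg _ (e.surjective.range_comp (syzygyFamily s c)).symm

theorem mulVecLin_eq_linearCombination_col {R m n : Type*} [CommSemiring R] [Fintype n]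
    (D : Matrix m n R) : D.mulVecLin = Fintype.linearCombination R D.col := by
  ext1 x
  rw [Matrix.mulVecLin_apply, Matrix.mulVec_eq_sum, Fintype.linearCombination_apply]
  exact Finset.sum_congr rfl fun i _ => op_smul_eq_smul _ _

theorem HasLinearResolution.of_hasLinearColons [Finite σ] {d b : ℕ} {g : Fin b → MvPolynomial σ K}
    (hg : HasLinearColons σ K g) (hd : ∀ a, (g a).IsHomogeneous d) :
    HasLinearResolution d (Ideal.span (Set.range g)) := by
  let Step := Σ (b b' : ℕ), {D : Matrix (Fin b) (Fin b') (MvPolynomial σ K) //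
    (∀ a c, (D a c).IsHomogeneous 1) ∧ HasLinearColons σ K D.col}
  have hnext : ∀ t : Step, ∃ (b : ℕ) (E : Matrix (Fin t.2.1) (Fin b) (MvPolynomial σ K)),
      ((∀ a c, (E a c).IsHomogeneous 1) ∧ HasLinearColons σ K E.col) ∧
      Function.Exact E.mulVecLin t.2.2.1.mulVecLin := fun t => by
    rw [mulVecLin_eq_linearCombination_col t.2.2.1]
    exact t.2.2.2.2.exists_exact_mulVecLin
  choose next_b next_D hnext_D hexact using hnext
  obtain ⟨b', D, hD, hexact₀⟩ := hg.exists_exact_mulVecLin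
  let resolution : ℕ → Step := fun i =>
    Nat.rec ⟨b, b', D, hD⟩ (fun _ t => ⟨t.2.1, next_b t, next_D t, hnext_D t⟩) i
  exact ⟨fun i => (resolution i).1, g, fun i => (resolution i).2.2.1, hd,
    fun i => (resolution i).2.2.2.1, rfl, hexact₀, fun i => hexact (resolution i)⟩

end Resolution

/-! ### Monomial ideals and exponent vectors -/

section Monomial

open MvPolynomial

variable {σ : Type*}

theorem HasLinearQuotientsOrder.exists_enumeration {M : Set (σ → ℕ)}
    (h : HasLinearQuotientsOrder M) (hM : M.Finite) :
    ∃ (n : ℕ) (f : Fin n → σ → ℕ), f.Injective ∧ Set.range f = M ∧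
      ∀ j, ∀ g ∈ f '' Set.Iio j, ∃ i, f j i < g i ∧
        ∃ g' ∈ f '' Set.Iio j, LeAddSingle i g' (f j) := by
  obtain ⟨key, hkey⟩ := h
  have := hM.to_subtype
  obtain ⟨n, ⟨e⟩⟩ := Finite.exists_equiv_fin M
  let e' : Fin n ≃ M := (Tuple.sort fun k => key (e.symm k)).trans e.symm
  have hmono : Monotone fun k => key (e' k) := Tuple.monotone_sort fun k => key (e.symm k)
  refine ⟨n, fun k => e' k, Subtype.val_injective.comp e'.injective, ?_, ?_⟩
  · rw [← Function.comp_def, e'.surjective.range_comp, Subtype.range_coe]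
  · rintro j _ ⟨k, hkj, rfl⟩
    have hlt : k < j := hkj
    obtain ⟨i, hi, g, hg, hgj, hle⟩ := hkey (e' j) (e' j).2 (e' k) (e' k).2
      (fun h => hlt.ne (e'.injective (Subtype.ext h))) (hmono hlt.le)
    obtain ⟨l, hl⟩ := e'.surjective ⟨g, hg⟩
    obtain rfl : (e' l : σ → ℕ) = g := congrArg Subtype.val hl
    exact ⟨i, hi, _, ⟨l, hmono.reflect_lt hgj, rfl⟩, hle⟩

variable [Finite σ] (K : Type*) [Field K]

/-- The monomial with exponent vector `f`. -/
noncomputable def mon (f : σ → ℕ) : MvPolynomial σ K :=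
  monomial (Finsupp.equivFunOnFinite.symm f) 1

theorem mon_injective : Function.Injective (mon K : (σ → ℕ) → MvPolynomial σ K) := fun _ _ h =>
  Finsupp.equivFunOnFinite.symm.injective (monomial_left_injective one_ne_zero h)

theorem mon_zero : mon K (0 : σ → ℕ) = 1 :=
  congrArg (monomial · 1) (Finsupp.ext fun _ => rfl)

theorem mon_add (f g : σ → ℕ) : mon K (f + g) = mon K f * mon K g := by
  rw [mon, mon, mon, monomial_mul, one_mul]
  exact congrArg (monomial · 1) (Finsupp.ext fun _ => rfl)

theorem mon_single [DecidableEq σ] (i : σ) : mon K (Pi.single i 1) = X i := by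
  rw [mon, X]
  congr 1
  ext j
  simp

variable {K}

theorem isHomogeneous_mon [Fintype σ] (f : σ → ℕ) : (mon K f).IsHomogeneous (∑ i, f i) :=
  isHomogeneous_monomial _ (by rw [Finsupp.degree_eq_sum]; rfl)

theorem mem_span_mon {p : MvPolynomial σ K} {M : Set (σ → ℕ)} :
    p ∈ Ideal.span (mon K '' M) ↔ ∀ m ∈ p.support, ∃ g ∈ M, g ≤ ⇑m := by
  have himage : mon K '' M =
      (fun s => monomial s (1 : K)) '' (Finsupp.equivFunOnFinite.symm '' M) := by
    rw [Set.image_image]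
    rfl
  rw [himage, mem_ideal_span_monomial_image]
  simp only [Set.exists_mem_image]
  rfl

theorem monomial_mem_span_mon {m : σ →₀ ℕ} {M : Set (σ → ℕ)} :
    monomial m (1 : K) ∈ Ideal.span (mon K '' M) ↔ ∃ g ∈ M, g ≤ ⇑m := by
  classical
  rw [mem_span_mon, support_monomial, if_neg one_ne_zero]
  simp

theorem mon_mem_span_mon {f : σ → ℕ} {M : Set (σ → ℕ)} :
    mon K f ∈ Ideal.span (mon K '' M) ↔ ∃ g ∈ M, g ≤ f :=
  monomial_mem_span_mon

theorem colon_span_mon {M : Set (σ → ℕ)} {f : σ → ℕ}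
    (h : ∀ g ∈ M, ∃ i, f i < g i ∧ ∃ g' ∈ M, LeAddSingle i g' f) :
    (Ideal.span (mon K '' M)).colon {mon K f} =
      Ideal.span (X '' {i | ∃ g ∈ M, LeAddSingle i g f}) := by
  classical
  refine le_antisymm (fun p hp => ?_) (Ideal.span_le.2 ?_)
  · rw [Submodule.mem_colon_singleton, smul_eq_mul, mem_span_mon] at hp
    rw [mem_ideal_span_X_image]
    intro m hm
    obtain ⟨g, hg, hle⟩ := hp (m + Finsupp.equivFunOnFinite.symm f) (by
      rw [mem_support_iff] at hm ⊢
      rwa [mon, coeff_mul_monomial, mul_one])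
    obtain ⟨i, hi, hcolon⟩ := h g hg
    have hgi : g i ≤ m i + f i := hle i
    exact ⟨i, hcolon, by omega⟩
  · rintro _ ⟨i, ⟨g, hg, hle⟩, rfl⟩
    rw [SetLike.mem_coe, Submodule.mem_colon_singleton, smul_eq_mul, ← mon_single, ← mon_add,
      mon_mem_span_mon, add_comm]
    exact ⟨g, hg, leAddSingle_iff_le.1 hle⟩

theorem span_mon_minElts (U : Set (σ → ℕ)) :
    Ideal.span (mon K '' minElts U) = Ideal.span (mon K '' U) := by
  refine le_antisymm (Ideal.span_mono (Set.image_mono fun f hf => hf.1)) (Ideal.span_le.2 ?_)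
  rintro _ ⟨f, hf, rfl⟩
  exact mon_mem_span_mon.2 (exists_mem_minElts_le hf)

theorem minimalMonomials_span_mon {U : Set (σ → ℕ)} (hU : IsUpperSet U) :
    minimalMonomials (Ideal.span (mon K '' U)) = mon K '' minElts U := by
  have hmem : ∀ m : σ →₀ ℕ, monomial m (1 : K) ∈ Ideal.span (mon K '' U) ↔ ⇑m ∈ U := fun m => by
    rw [monomial_mem_span_mon]
    exact ⟨fun ⟨g, hg, h⟩ => hU h hg, fun h => ⟨_, h, le_rfl⟩⟩
  ext p
  simp only [minimalMonomials, hmem]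
  constructor
  · rintro ⟨s, hs, rfl⟩
    refine ⟨⇑s, ⟨hs.1, fun g hg hle => ?_⟩, by simp [mon]⟩
    exact hs.2 (y := Finsupp.equivFunOnFinite.symm g) hg fun i => hle i
  · rintro ⟨f, hf, rfl⟩
    exact ⟨Finsupp.equivFunOnFinite.symm f, ⟨hf.1, fun t ht hle => hf.2 ht hle⟩, rfl⟩

theorem setOf_mem_take_ofFn {α : Type*} {n : ℕ} (f : Fin n → α) (j : Fin n) :
    {a | a ∈ (List.ofFn f).take j} = f '' Set.Iio j := by
  ext a
  constructor
  · intro ha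
    obtain ⟨k, hk, rfl⟩ := List.mem_take_iff_getElem.1 ha
    rw [List.length_ofFn, lt_min_iff] at hk
    exact ⟨⟨k, hk.2⟩, hk.1, (List.getElem_ofFn _).symm⟩
  · rintro ⟨k, hk, rfl⟩
    exact List.mem_take_iff_getElem.2 ⟨k, lt_min hk (by simp), List.getElem_ofFn _⟩

theorem HasLinearQuotients.hasLinearQuotientsOnMinGens {U : Set (σ → ℕ)}
    (h : HasLinearQuotients U) (hU : IsUpperSet U) :
    HasLinearQuotientsOnMinGens (Ideal.span (mon K '' U)) := by
  obtain ⟨n, f, hinj, hrange, hf⟩ := h.exists_enumeration (finite_minElts U)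
  let l := List.ofFn fun j => mon K (f j)
  have hl : {p | p ∈ l} = mon K '' minElts U := by
    rw [← hrange, ← Set.range_comp]
    exact Set.ext fun p => List.mem_ofFn
  refine ⟨l, List.nodup_ofFn.2 ((mon_injective K).comp hinj), ?_, ?_, fun j hj => ?_⟩
  · rw [hl, minimalMonomials_span_mon hU]
  · rw [hl, span_mon_minElts]
  · obtain ⟨j, rfl⟩ : ∃ j' : Fin n, ↑j' = j := ⟨⟨j, by simpa [l] using hj⟩, rfl⟩
    simp only [l, List.getElem_ofFn, setOf_mem_take_ofFn, ← Set.image_image (mon K) f]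
    refine ⟨_, ?_, colon_span_mon (hf j)⟩
    rintro _ ⟨i, -, rfl⟩
    exact isHomogeneous_X K i

theorem exists_X_mul_mon_eq [Fintype σ] {i : σ} {g f : σ → ℕ} (hle : LeAddSingle i g f)
    (hsum : ∑ x, g x = ∑ x, f x) :
    ∃ q : MvPolynomial σ K, q.IsHomogeneous 1 ∧ X i * mon K f = q * mon K g := by
  classical
  have hadd : (f + Pi.single i 1 - g) + g = f + Pi.single i 1 :=
    tsub_add_cancel_of_le (leAddSingle_iff_le.1 hle)
  refine ⟨mon K (f + Pi.single i 1 - g), ?_, ?_⟩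
  · have hsum' := congrArg (fun w => ∑ x, w x) hadd
    simp only [Pi.add_apply, Finset.sum_add_distrib, Finset.sum_pi_single', Finset.mem_univ,
      if_true, hsum] at hsum'
    convert isHomogeneous_mon (K := K) (f + Pi.single i 1 - g) using 1
    omega
  · rw [← mon_add, hadd, mon_add, mon_single, mul_comm]

theorem hasLinearColons_mon [Fintype σ] {n d : ℕ} {f : Fin n → σ → ℕ} (hd : ∀ j, ∑ i, f j i = d)
    (hf : ∀ j, ∀ g ∈ f '' Set.Iio j, ∃ i, f j i < g i ∧
      ∃ g' ∈ f '' Set.Iio j, LeAddSingle i g' (f j)) :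
    HasLinearColons σ K fun j => mon K (f j) := by
  let s (j : Fin n) : Set σ := {i | ∃ g ∈ f '' Set.Iio j, LeAddSingle i g (f j)}
  have hrel : ∀ j, ∀ i ∈ s j, ∃ c : Fin n → MvPolynomial σ K, (∀ l, (c l).IsHomogeneous 1) ∧
      (∀ l, j ≤ l → c l = 0) ∧
        (X i : MvPolynomial σ K) • mon K (f j) = ∑ l, c l • mon K (f l) := by
    rintro j i ⟨_, ⟨k, hk, rfl⟩, hle⟩
    obtain ⟨q, hq, hqk⟩ := exists_X_mul_mon_eq (K := K) hle ((hd k).trans (hd j).symm)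
    refine ⟨Pi.single k q, fun l => ?_, fun l hl => Pi.single_eq_of_ne (hk.trans_le hl).ne' _, ?_⟩
    · rcases eq_or_ne l k with rfl | hl
      · rwa [Pi.single_eq_same]
      · rw [Pi.single_eq_of_ne hl]
        exact isHomogeneous_zero σ K 1
    · rw [← Fintype.linearCombination_apply (MvPolynomial σ K) (v := fun l => mon K (f l)),
        Fintype.linearCombination_apply_single]
      exact hqk
  choose! c hhom hzero hX using hrel
  refine ⟨s, c, hhom, hzero, hX, fun j p hp => ?_⟩
  rw [← Set.image_image (mon K) f] at hp
  rw [← colon_span_mon (hf j)]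
  exact Submodule.mem_colon_singleton.2 hp

theorem HasLinearQuotientsOrder.hasLinearResolution [Fintype σ] {M : Set (σ → ℕ)}
    (h : HasLinearQuotientsOrder M) (hM : M.Finite) {d : ℕ} (hd : ∀ f ∈ M, ∑ i, f i = d) :
    HasLinearResolution d (Ideal.span (mon K '' M)) := by
  obtain ⟨n, f, -, rfl, hf⟩ := h.exists_enumeration hM
  have hd' : ∀ j, ∑ i, f j i = d := fun j => hd _ ⟨j, rfl⟩
  rw [← Set.range_comp]
  exact .of_hasLinearColons (hasLinearColons_mon hd' hf) fun j => hd' j ▸ isHomogeneous_mon _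

end Monomial

/-! ### Componentwise linearity from linear quotients -/

section Components

open MvPolynomial

variable {σ : Type*}

/-- The exponent vector `w - eₗ + eᵢ`, i.e. the exponent of `xᵢ x ^ w / xₗ`; it is meant for
`w l ≠ 0`. -/
def exchange [DecidableEq σ] (w : σ → ℕ) (l i : σ) : σ → ℕ :=
  w - Pi.single l 1 + Pi.single i 1

section Exchange

variable [DecidableEq σ] {w g : σ → ℕ} {l i : σ}

theorem exchange_apply (hli : l ≠ i) (j : σ) :
    exchange w l i j = if j = i then w i + 1 else if j = l then w l - 1 else w j := by
  simp only [exchange, Pi.add_apply, Pi.sub_apply, Pi.single_apply]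
  grind

theorem sum_exchange [Fintype σ] (hl : w l ≠ 0) (i : σ) : ∑ x, exchange w l i x = ∑ x, w x := by
  have hle : Pi.single l 1 ≤ w := fun x => by
    rcases eq_or_ne x l with rfl | hx
    · simpa [Nat.one_le_iff_ne_zero] using hl
    · simp [hx]
  calc ∑ x, exchange w l i x = ∑ x, (w - Pi.single l 1 : σ → ℕ) x + 1 := by
        simp [exchange, Finset.sum_add_distrib]
    _ = ∑ x, (w - Pi.single l 1 + Pi.single l 1 : σ → ℕ) x := by simp [Finset.sum_add_distrib]
    _ = ∑ x, w x := by rw [tsub_add_cancel_of_le hle]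

theorem leAddSingle_exchange (w : σ → ℕ) (l i : σ) : LeAddSingle i (exchange w l i) w :=
  leAddSingle_iff_le.2 (add_le_add_left tsub_le_self _)

theorem le_exchange (hg : LeAddSingle i g w) (hl : g l < w l) : g ≤ exchange w l i := by
  intro x
  have hgx := leAddSingle_iff_le.1 hg x
  rcases eq_or_ne x l with rfl | hx
  · simp only [exchange, Pi.add_apply, Pi.sub_apply, Pi.single_eq_same]
    omega
  · simpa [exchange, hx] using hgx

theorem toLex_lt_toLex_exchange [LinearOrder σ] {w : σ → ℕ} {l i : σ} (hil : i < l) :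
    toLex w < toLex (exchange w l i) := by
  refine ⟨i, fun x hx => ?_, ?_⟩
  · simp [exchange, hx.ne, (hx.trans hil).ne]
  · simp [exchange, hil.ne]

end Exchange

theorem exists_lt_and_lt_of_toLex_lt [Fintype σ] [LinearOrder σ] {w w' : σ → ℕ}
    (hsum : ∑ x, w x = ∑ x, w' x) (hlt : toLex w < toLex w') :
    ∃ i l, i < l ∧ w i < w' i ∧ w' l < w l := by
  obtain ⟨i, heq : ∀ x < i, w x = w' x, hi : w i < w' i⟩ := hlt
  obtain ⟨l, -, hl⟩ : ∃ l ∈ Finset.univ, w' l < w l := by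
    by_contra! hle
    exact (Finset.sum_lt_sum hle ⟨i, Finset.mem_univ i, hi⟩).ne hsum
  refine ⟨i, l, ?_, hi, hl⟩
  rcases lt_trichotomy i l with h | rfl | h
  · exact h
  · omega
  · exact absurd (heq l h) hl.ne'

theorem exists_minElts_isMinOn_key [Finite σ] {U : Set (σ → ℕ)} (key : (σ → ℕ) → ℕ) {w : σ → ℕ}
    (hw : w ∈ U) : ∃ f ∈ minElts U, f ≤ w ∧ ∀ g ∈ minElts U, g ≤ w → key f ≤ key g := by
  let S : Set (σ → ℕ) := {f | f ∈ minElts U ∧ f ≤ w}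
  have hne : S.Nonempty := exists_mem_minElts_le hw
  have hmem : Function.argminOn key S hne ∈ S := Function.argminOn_mem key S hne
  exact ⟨_, hmem.1, hmem.2, fun g hg hgw => Function.argminOn_le key S (a := g) ⟨hg, hgw⟩⟩

theorem exists_le_exchange_of_key_lt [DecidableEq σ] {U : Set (σ → ℕ)} {key : (σ → ℕ) → ℕ}
    {f g w : σ → ℕ} {i : σ} (hf : f ∈ minElts U) (hfw : f ≤ w)
    (hmin : ∀ h ∈ minElts U, h ≤ w → key f ≤ key h) (hg : g ∈ minElts U) (hgf : key g < key f)
    (hle : LeAddSingle i g f) : w i = f i ∧ ∃ l, w l ≠ 0 ∧ g ≤ exchange w l i := by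
  have hgw : ¬ g ≤ w := fun h => (hmin g hg h).not_gt hgf
  have hlt : w i < g i := by
    by_contra! hi
    exact hgw fun x => (eq_or_ne x i).elim (· ▸ hi) fun hx => (hle.2 x hx).trans (hfw x)
  obtain ⟨l, hl⟩ : ∃ l, g l < f l := by
    by_contra! hfg
    exact hgf.ne (congrArg key (hg.eq_of_le hf.1 hfg).symm)
  have hwl : g l < w l := hl.trans_le (hfw l)
  refine ⟨le_antisymm ?_ (hfw i), l,
    (Nat.zero_le _).trans_lt hwl |>.ne', le_exchange ⟨?_, fun x hx => ?_⟩ hwl⟩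
  · exact Nat.le_of_lt_succ (hlt.trans_le hle.1)
  · exact hle.1.trans (Nat.add_le_add_right (hfw i) 1)
  · exact (hle.2 x hx).trans (hfw x)

theorem finite_sum_eq [Fintype σ] (U : Set (σ → ℕ)) (d : ℕ) : {w ∈ U | ∑ i, w i = d}.Finite := by
  classical
  exact (Set.finite_Iic (fun _ : σ => d)).subset fun w hw i =>
    (Finset.single_le_sum (fun _ _ => Nat.zero_le _) (Finset.mem_univ i)).trans hw.2.le

/-- Monomials of degree `d` are compared by the first generator dividing them, ties being broken by
the lexicographic order. -/
theorem HasLinearQuotients.hasLinearQuotientsOrder_sum_eq [Fintype σ] {U : Set (σ → ℕ)}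
    (h : HasLinearQuotients U) (hU : IsUpperSet U) (d : ℕ) :
    HasLinearQuotientsOrder {w ∈ U | ∑ i, w i = d} := by
  let eσ := Fintype.equivFin σ
  let _ : LinearOrder σ := LinearOrder.lift' eσ eσ.injective
  obtain ⟨key, hkey⟩ := h
  choose! p hp_mem hp_le hp_min using fun w => exists_minElts_isMinOn_key (U := U) key (w := w)
  let key' (w : σ → ℕ) : ℕ ×ₗ (Lex (σ → ℕ))ᵒᵈ := toLex (key (p w), OrderDual.toDual (toLex w))
  refine IsLinearQuotientsKey.hasLinearQuotientsOrder (key := key') ?_ (finite_sum_eq U d)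
  rintro w ⟨hw, hwd⟩ w' ⟨hw', hwd'⟩ hne hle
  have key'_exchange : ∀ {l i}, w l ≠ 0 → exchange w l i ∈ U → key' (exchange w l i) < key' w →
      ∃ g ∈ {w ∈ U | ∑ i, w i = d}, key' g < key' w ∧ LeAddSingle i g w := fun hl hu hlt =>
    ⟨_, ⟨hu, (sum_exchange hl _).trans hwd⟩, hlt, leAddSingle_exchange w _ _⟩
  by_cases hpp : p w' = p w
  · have hlex : toLex w < toLex w' := by
      rcases Prod.Lex.toLex_le_toLex.1 hle with hlt | ⟨-, hle⟩
      · exact absurd (congrArg key hpp) hlt.ne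
      · exact lt_of_le_of_ne hle fun heq => hne (toLex.injective heq).symm
    obtain ⟨i, l, hil, hi, hl⟩ := exists_lt_and_lt_of_toLex_lt (hwd.trans hwd'.symm) hlex
    have hpl : p w l ≤ w' l := hpp ▸ hp_le w' hw' l
    have hpu : p w ≤ exchange w l i :=
      le_exchange ⟨(hp_le w hw i).trans (Nat.le_succ _), fun x _ => hp_le w hw x⟩ (hpl.trans_lt hl)
    have hu : exchange w l i ∈ U := hU hpu (hp_mem w hw).1
    refine ⟨i, hi, key'_exchange (by omega) hu (Prod.Lex.toLex_lt_toLex.2 ?_)⟩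
    rcases (hp_min _ hu _ (hp_mem w hw) hpu).lt_or_eq with hlt | heq
    · exact .inl hlt
    · exact .inr ⟨heq, toLex_lt_toLex_exchange hil⟩
  · have hk : key (p w') ≤ key (p w) := by
      rcases Prod.Lex.toLex_le_toLex.1 hle with h | h
      exacts [h.le, h.1.le]
    obtain ⟨i, hi, g, hg, hgk, hgf⟩ := hkey _ (hp_mem w hw) _ (hp_mem w' hw') hpp hk
    obtain ⟨hwi, l, hl, hgu⟩ :=
      exists_le_exchange_of_key_lt (hp_mem w hw) (hp_le w hw) (hp_min w hw) hg hgk hgf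
    have hu : exchange w l i ∈ U := hU hgu hg.1
    exact ⟨i, hwi ▸ hi.trans_le (hp_le w' hw' i), key'_exchange hl hu
      (Prod.Lex.toLex_lt_toLex.2 (.inl ((hp_min _ hu g hg hgu).trans_lt hgk)))⟩

theorem span_isHomogeneous_span_mon [Fintype σ] {K : Type*} [Field K] {U : Set (σ → ℕ)}
    (hU : IsUpperSet U) (d : ℕ) :
    Ideal.span {f | f ∈ Ideal.span (mon K '' U) ∧ f.IsHomogeneous d} =
      Ideal.span (mon K '' {w ∈ U | ∑ i, w i = d}) := by
  refine le_antisymm (Ideal.span_le.2 ?_) (Ideal.span_mono ?_)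
  · rintro f ⟨hf, hd⟩
    rw [mem_span_mon] at hf
    refine mem_span_mon.2 fun m hm => ?_
    obtain ⟨g, hg, hgm⟩ := hf m hm
    refine ⟨⇑m, ⟨hU hgm hg, ?_⟩, le_rfl⟩
    rw [← Finsupp.degree_eq_sum, Finsupp.degree_eq_weight_one]
    exact hd (mem_support_iff.1 hm)
  · rintro _ ⟨w, ⟨hw, rfl⟩, rfl⟩
    exact ⟨Ideal.subset_span ⟨w, hw, rfl⟩, isHomogeneous_mon w⟩

theorem HasLinearQuotients.isComponentwiseLinear [Finite σ] {K : Type*} [Field K]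
    {U : Set (σ → ℕ)} (h : HasLinearQuotients U) (hU : IsUpperSet U) :
    IsComponentwiseLinear (Ideal.span (mon K '' U)) := by
  intro d
  have := Fintype.ofFinite σ
  rw [span_isHomogeneous_span_mon hU]
  exact (h.hasLinearQuotientsOrder_sum_eq hU d).hasLinearResolution (finite_sum_eq U d)
    fun _ hf => hf.2

end Components

/-! ### Powers of cover ideals -/

section CoverSums

variable {σ : Type*}

/-- The exponent vectors lying above a sum of `k` indicator vectors of vertex covers of `G`. They
are the exponent vectors of the monomials in the `k`-th power of the cover ideal. -/
def coverSums (k : ℕ) (G : SimpleGraph σ) : Set (σ → ℕ) :=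
  {t | ∃ C : Fin k → Set σ, (∀ j, G.IsVertexCover (C j)) ∧
    ∀ v, ∑ j, (C j).indicator (1 : σ → ℕ) v ≤ t v}

theorem isUpperSet_coverSums (k : ℕ) (G : SimpleGraph σ) : IsUpperSet (coverSums k G) :=
  fun _ _ hst ⟨C, hC, h⟩ => ⟨C, hC, fun v => (h v).trans (hst v)⟩

theorem mem_coverSums_of_fintype {ι : Type*} [Fintype ι] {k : ℕ} (hk : Fintype.card ι = k)
    {G : SimpleGraph σ} {C : ι → Set σ} (hC : ∀ j, G.IsVertexCover (C j)) {t : σ → ℕ}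
    (ht : ∀ v, ∑ j, (C j).indicator (1 : σ → ℕ) v ≤ t v) : t ∈ coverSums k G := by
  let e := (Fintype.equivFinOfCardEq hk).symm
  refine ⟨C ∘ e, fun j => hC _, fun v => ?_⟩
  exact (Equiv.sum_comp e fun j => (C j).indicator (1 : σ → ℕ) v).trans_le (ht v)

theorem mem_coverSums_zero (G : SimpleGraph σ) (t : σ → ℕ) : t ∈ coverSums 0 G :=
  ⟨Fin.elim0, fun j => j.elim0, fun v => by simp⟩

theorem mem_coverSums_succ {k : ℕ} {G : SimpleGraph σ} {t : σ → ℕ} :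
    t ∈ coverSums (k + 1) G ↔
      ∃ C : Set σ, G.IsVertexCover C ∧ ∃ s ∈ coverSums k G, s + C.indicator 1 ≤ t := by
  constructor
  · rintro ⟨C, hC, ht⟩
    refine ⟨C 0, hC 0, fun v => ∑ j : Fin k, (C j.succ).indicator (1 : σ → ℕ) v,
      ⟨fun j => C j.succ, fun j => hC _, fun v => le_rfl⟩, fun v => ?_⟩
    rw [Pi.add_apply, add_comm, ← Fin.sum_univ_succ (fun j => (C j).indicator (1 : σ → ℕ) v)]
    exact ht v
  · rintro ⟨C, hC, s, ⟨D, hD, hs⟩, ht⟩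
    refine ⟨Fin.cons C D, Fin.cases hC hD, fun v => ?_⟩
    simp only [Fin.sum_univ_succ, Fin.cons_zero, Fin.cons_succ]
    rw [add_comm]
    exact (Nat.add_le_add_right (hs v) _).trans (ht v)

theorem mem_coverSums_one {G : SimpleGraph σ} {t : σ → ℕ} :
    t ∈ coverSums 1 G ↔ ∃ C : Set σ, G.IsVertexCover C ∧ C.indicator 1 ≤ t := by
  rw [mem_coverSums_succ]
  refine exists_congr fun C => and_congr_right fun _ => ⟨?_, fun h => ?_⟩
  · rintro ⟨s, -, h⟩
    exact le_add_self.trans h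
  · exact ⟨0, mem_coverSums_zero _ _, by rwa [zero_add]⟩

theorem sum_indicator_le {ι : Type*} [Fintype ι] (C : ι → Set σ) (v : σ) :
    ∑ j, (C j).indicator (1 : σ → ℕ) v ≤ Fintype.card ι := by
  refine (Finset.sum_le_sum (g := fun _ => 1) fun j _ => ?_).trans (by simp)
  exact Set.indicator_apply_le' (fun _ => le_rfl) fun _ => Nat.zero_le _

theorem le_of_mem_minElts_coverSums {k : ℕ} {G : SimpleGraph σ} {t : σ → ℕ}
    (ht : t ∈ minElts (coverSums k G)) (v : σ) : t v ≤ k := by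
  obtain ⟨C, hC, h⟩ := ht.1
  rw [← ht.eq_of_le (y := fun v => ∑ j, (C j).indicator (1 : σ → ℕ) v)
    ⟨C, hC, fun v => le_rfl⟩ h]
  simpa using sum_indicator_le C v

theorem le_add_of_mem_coverSums {k : ℕ} {G : SimpleGraph σ} {t : σ → ℕ} (ht : t ∈ coverSums k G)
    {u v : σ} (huv : G.Adj u v) : k ≤ t u + t v := by
  obtain ⟨C, hC, h⟩ := ht
  calc k = ∑ _j : Fin k, 1 := by simp
    _ ≤ ∑ j, ((C j).indicator (1 : σ → ℕ) u + (C j).indicator (1 : σ → ℕ) v) := by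
      refine Finset.sum_le_sum fun j _ => ?_
      rcases hC j huv with hmem | hmem <;> simp [hmem]
    _ ≤ t u + t v := by
      rw [Finset.sum_add_distrib]
      exact Nat.add_le_add (h u) (h v)

theorem exists_side_of_isBipartite {G : SimpleGraph σ} (hG : G.IsBipartite) :
    ∃ X : Set σ, ∀ u v, G.Adj u v → (u ∈ X ↔ v ∉ X) := by
  obtain ⟨X, Y, hXY⟩ := hG.exists_isBipartiteWith
  refine ⟨X, fun u v huv => ?_⟩
  have := hXY.mem_of_adj huv
  have := Set.disjoint_left.1 hXY.disjoint
  grind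

theorem mem_coverSums_iff_of_bipartite {k : ℕ} {G : SimpleGraph σ} {X : Set σ}
    (hX : ∀ u v, G.Adj u v → (u ∈ X ↔ v ∉ X)) {t : σ → ℕ} :
    t ∈ coverSums k G ↔ ∀ u v, G.Adj u v → k ≤ t u + t v := by
  classical
  refine ⟨fun ht _ _ huv => le_add_of_mem_coverSums ht huv, fun ht => ?_⟩
  -- Level sets: on `X` fill the covers from the left, off `X` from the right.
  refine ⟨fun j => {u | if u ∈ X then (j : ℕ) < t u else k ≤ j + t u}, fun j u v huv => ?_,
    fun v => ?_⟩
  · have hle := ht u v huv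
    have hside := hX u v huv
    by_cases hv : v ∈ X <;> simp [hside, hv] <;> omega
  · have hcount : ∑ j : Fin k,
        {u | if u ∈ X then (j : ℕ) < t u else k ≤ j + t u}.indicator (1 : σ → ℕ) v =
        ((Finset.range k).filter fun j => if v ∈ X then j < t v else k ≤ j + t v).card := by
      simp only [Set.indicator_apply, Pi.one_apply, Set.mem_ofPred_eq, Finset.card_filter]
      exact Fin.sum_univ_eq_sum_range (fun j => if (if v ∈ X then j < t v else k ≤ j + t v)
        then 1 else 0) k
    rw [hcount]
    by_cases hv : v ∈ X
    · calc _ ≤ (Finset.range (t v)).card :=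
            Finset.card_le_card fun j => by simp [hv]
        _ = t v := Finset.card_range _
    · calc _ ≤ (Finset.Ico (k - t v) k).card :=
            Finset.card_le_card fun j => by simp [hv]; omega
        _ ≤ t v := by rw [Nat.card_Ico]; omega

theorem comp_symm_mem_coverSums_iff {τ : Type*} {G : SimpleGraph σ} {H : SimpleGraph τ}
    (e : G ≃g H) {k : ℕ} {t : σ → ℕ} : t ∘ e.symm ∈ coverSums k H ↔ t ∈ coverSums k G := by
  constructor
  · rintro ⟨C, hC, ht⟩
    refine ⟨fun j => {w | e w ∈ C j}, fun j u v huv => hC j (e.map_rel_iff.2 huv), fun v => ?_⟩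
    exact (ht (e v)).trans_eq (congrArg t (e.symm_apply_apply v))
  · rintro ⟨C, hC, ht⟩
    exact ⟨fun j => {w | e.symm w ∈ C j}, fun j u v huv => hC j (e.symm.map_rel_iff.2 huv),
      fun v => ht (e.symm v)⟩

theorem HasLinearQuotients.coverSums_of_iso {τ : Type*} {G : SimpleGraph σ} {H : SimpleGraph τ}
    (e : G ≃g H) {k : ℕ} (h : HasLinearQuotients (coverSums k H)) :
    HasLinearQuotients (coverSums k G) := by
  convert h.comp_equiv e.toEquiv using 1
  exact Set.ext fun t => (comp_symm_mem_coverSums_iff e).symm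

open MvPolynomial

variable [Finite σ] (K : Type*) [Field K]

theorem prod_X_eq_mon (C : Finset σ) :
    ∏ v ∈ C, (X v : MvPolynomial σ K) = mon K ((C : Set σ).indicator 1) := by
  classical
  have hexp : Finsupp.equivFunOnFinite.symm ((C : Set σ).indicator (1 : σ → ℕ)) =
      ∑ v ∈ C, Finsupp.single v 1 := by
    ext w
    simp [Finsupp.finsetSum_apply, Finsupp.single_apply, Set.indicator_apply]
  rw [mon, hexp, monomial_sum_one]
  rfl

theorem coverIdeal_eq_span_mon (G : SimpleGraph σ) :
    coverIdeal K G = Ideal.span (mon K '' coverSums 1 G) := by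
  classical
  have := Fintype.ofFinite σ
  refine le_antisymm (Ideal.span_le.2 ?_) (Ideal.span_le.2 ?_)
  · rintro _ ⟨C, hC, rfl⟩
    rw [prod_X_eq_mon]
    exact Ideal.subset_span ⟨_, mem_coverSums_one.2 ⟨C, hC.1, le_rfl⟩, rfl⟩
  · rintro _ ⟨t, ht, rfl⟩
    obtain ⟨C, hC, hCt⟩ := mem_coverSums_one.1 ht
    obtain ⟨D, hDC, hD⟩ := exists_minimal_le_of_wellFoundedLT
      (fun D : Finset σ => G.IsVertexCover (D : Set σ)) C.toFinset (by simpa using hC)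
    have hDt : (D : Set σ).indicator 1 ≤ t :=
      (Set.indicator_le_indicator_of_subset (by simpa using Finset.coe_subset.2 hDC)
        fun _ => Nat.zero_le _).trans hCt
    rw [← tsub_add_cancel_of_le hDt, SetLike.mem_coe, mon_add, ← prod_X_eq_mon]
    exact Ideal.mul_mem_left _ _ (Ideal.subset_span ⟨D, hD, rfl⟩)

open scoped Pointwise in
theorem image_mon_coverSums_succ (G : SimpleGraph σ) (k : ℕ) :
    mon K '' coverSums (k + 1) G = (mon K '' coverSums k G) * (mon K '' coverSums 1 G) := by
  ext p
  constructor
  · rintro ⟨t, ht, rfl⟩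
    obtain ⟨C, hC, s, hs, hst⟩ := mem_coverSums_succ.1 ht
    have hle : s ≤ t := le_self_add.trans hst
    refine ⟨_, ⟨s, hs, rfl⟩, _, ⟨t - s, mem_coverSums_one.2 ⟨C, hC, ?_⟩, rfl⟩, ?_⟩
    · exact le_tsub_of_add_le_left hst
    · change mon K s * mon K (t - s) = mon K t
      rw [← mon_add, add_tsub_cancel_of_le hle]
  · rintro ⟨_, ⟨s, hs, rfl⟩, _, ⟨u, hu, rfl⟩, rfl⟩
    obtain ⟨C, hC, hCu⟩ := mem_coverSums_one.1 hu
    exact ⟨s + u, mem_coverSums_succ.2 ⟨C, hC, s, hs, add_le_add_right hCu s⟩, mon_add K s u⟩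

theorem coverIdeal_pow_eq_span_mon (G : SimpleGraph σ) (k : ℕ) :
    coverIdeal K G ^ k = Ideal.span (mon K '' coverSums k G) := by
  induction k with
  | zero =>
    rw [pow_zero, eq_comm, Ideal.one_eq_top, Ideal.eq_top_iff_one]
    exact Ideal.subset_span ⟨0, mem_coverSums_zero _ _, mon_zero K⟩
  | succ k ih =>
    rw [pow_succ, ih, coverIdeal_eq_span_mon, image_mon_coverSums_succ K G k,
      Ideal.span_mul_span']

end CoverSums

section Attach

theorem sum_indicator_eq_sum_add {k : ℕ} {σ : Type*} (C : Fin k → Set σ) (w : σ)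
    {J : Finset (Fin k)} (hJ : ∀ j ∉ J, w ∈ C j) :
    ∑ j, (C j).indicator (1 : σ → ℕ) w =
      ∑ j : J, (C j).indicator (1 : σ → ℕ) w + (k - J.card) := by
  classical
  have hcompl : ∑ j ∈ Jᶜ, (C j).indicator (1 : σ → ℕ) w = k - J.card := by
    rw [Finset.sum_congr rfl (g := fun _ => 1) fun j hj => by simp [hJ j (Finset.mem_compl.1 hj)]]
    simp [Finset.card_compl]
  rw [← Finset.sum_add_sum_compl J, hcompl,
    Finset.sum_coe_sort J fun j => (C j).indicator (1 : σ → ℕ) w]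

theorem sum_indicator_preimage {V ι : Type*} [Fintype ι] (J : V → Finset ι) (v : V) :
    ∑ j, {u | j ∈ J u}.indicator (1 : V → ℕ) v = (J v).card := by
  classical
  simp [Set.indicator_apply]

/-- The exponent vectors of the multiples of the monomials `∏ w, x_w ^ (k - n) * u`, where `u` runs
through the `n`-th power of the cover ideal of `H`. They describe the contribution of `H v` to
`k` covers of `attach G H`, of which exactly `n` contain `v`. -/
def shiftedCoverSums (k n : ℕ) {τ : Type*} (H : SimpleGraph τ) : Set (τ → ℕ) :=
  {s | ∃ m ∈ coverSums n H, m + (fun _ => k - n) ≤ s}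

theorem mem_shiftedCoverSums_card_iff {τ : Type*} {H : SimpleGraph τ} {k : ℕ}
    {J : Finset (Fin k)} {s : τ → ℕ} :
    s ∈ shiftedCoverSums k J.card H ↔ ∃ D : Fin k → Set τ, (∀ j, H.IsVertexCover (D j)) ∧
      (∀ j ∉ J, D j = Set.univ) ∧ ∀ w, ∑ j, (D j).indicator (1 : τ → ℕ) w ≤ s w := by
  classical
  constructor
  · rintro ⟨m, ⟨D, hD, hDm⟩, hms⟩
    let e : J ≃ Fin J.card := J.equivFin
    refine ⟨fun j => if hj : j ∈ J then D (e ⟨j, hj⟩) else Set.univ, fun j => ?_,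
      fun j hj => dif_neg hj, fun w => ?_⟩
    · by_cases hj : j ∈ J
      · simpa only [dif_pos hj] using hD _
      · simpa only [dif_neg hj] using SimpleGraph.isVertexCover_univ
    · rw [sum_indicator_eq_sum_add _ w (J := J) fun j hj => by simp only [dif_neg hj, Set.mem_univ]]
      simp only [Finset.coe_mem, ↓reduceDIte]
      rw [Equiv.sum_comp e fun j => (D j).indicator (1 : τ → ℕ) w]
      exact (Nat.add_le_add_right (hDm w) _).trans (hms w)
  · rintro ⟨D, hD, hJ, hDs⟩
    refine ⟨fun w => ∑ j : J, (D j).indicator (1 : τ → ℕ) w,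
      mem_coverSums_of_fintype (Fintype.card_coe J) (fun j => hD j) fun w => le_rfl, fun w => ?_⟩
    exact (sum_indicator_eq_sum_add D w fun j hj => hJ j hj ▸ Set.mem_univ w).symm.trans_le (hDs w)

variable {V : Type*} {W : V → Type*} {G : SimpleGraph V} {H : ∀ v, SimpleGraph (W v)} {k : ℕ}

theorem isVertexCover_attach_iff {C : Set (V ⊕ Σ v, W v)} :
    (attach G H).IsVertexCover C ↔ G.IsVertexCover (Sum.inl ⁻¹' C) ∧ ∀ v,
      (H v).IsVertexCover {w | Sum.inr ⟨v, w⟩ ∈ C} ∧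
        (Sum.inl v ∉ C → {w | Sum.inr ⟨v, w⟩ ∈ C} = Set.univ) := by
  refine ⟨fun hC => ⟨fun u v huv => hC (AttachAdj.base huv), fun v =>
    ⟨fun a b hab => hC (AttachAdj.fiber hab), fun hv => Set.eq_univ_of_forall fun w =>
      (hC (AttachAdj.up v w)).resolve_left hv⟩⟩, fun ⟨hG, hH⟩ x y hxy => ?_⟩
  have hup (v : V) (w : W v) : Sum.inl v ∈ C ∨ Sum.inr ⟨v, w⟩ ∈ C := by
    by_cases hv : Sum.inl v ∈ C
    · exact Or.inl hv
    · exact Or.inr (Set.eq_univ_iff_forall.1 ((hH v).2 hv) w)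
  rcases hxy with huv | hab | ⟨v, w⟩ | ⟨v, w⟩
  · exact hG huv
  · exact (hH _).1 hab
  · exact hup v w
  · exact (hup v w).symm

theorem exists_mem_shiftedCoverSums_of_mem_coverSums_attach {t : (V ⊕ Σ v, W v) → ℕ}
    (ht : t ∈ coverSums k (attach G H)) :
    ∃ a, (a ∈ coverSums k G ∧ ∀ v, a v ≤ k) ∧ a ≤ t ∘ Sum.inl ∧
      ∀ v, (fun w => t (.inr ⟨v, w⟩)) ∈ shiftedCoverSums k (a v) (H v) := by
  classical
  obtain ⟨C, hC, ht⟩ := ht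
  simp only [isVertexCover_attach_iff] at hC
  let J (v : V) : Finset (Fin k) := Finset.univ.filter fun j => Sum.inl v ∈ C j
  have hJ (v : V) : (J v).card =
      ∑ j, (C j).indicator (1 : (V ⊕ Σ v, W v) → ℕ) (Sum.inl v) := by
    simp [J, Set.indicator_apply]
  refine ⟨fun v => (J v).card, ⟨⟨fun j => Sum.inl ⁻¹' C j, fun j => (hC j).1, fun v => (hJ v).ge⟩,
    fun v => (Finset.card_le_univ _).trans_eq (Fintype.card_fin k)⟩,
    fun v => (hJ v).trans_le (ht _), fun v => mem_shiftedCoverSums_card_iff.2 ?_⟩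
  refine ⟨fun j => {w | Sum.inr ⟨v, w⟩ ∈ C j}, fun j => ((hC j).2 v).1,
    fun j hj => ((hC j).2 v).2 fun h => hj (Finset.mem_filter.2 ⟨Finset.mem_univ _, h⟩),
    fun w => ?_⟩
  exact ht (.inr ⟨v, w⟩)

theorem mem_coverSums_attach_of_mem_shiftedCoverSums {t : (V ⊕ Σ v, W v) → ℕ} {a : V → ℕ}
    (ha : a ∈ coverSums k G) (hak : ∀ v, a v ≤ k) (hat : a ≤ t ∘ Sum.inl)
    (ht : ∀ v, (fun w => t (.inr ⟨v, w⟩)) ∈ shiftedCoverSums k (a v) (H v)) :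
    t ∈ coverSums k (attach G H) := by
  classical
  obtain ⟨B, hB, hBa⟩ := ha
  have hJ (v : V) : ∃ J : Finset (Fin k), (Finset.univ.filter fun j => v ∈ B j) ⊆ J ∧
      J.card = a v :=
    Finset.exists_superset_card_eq (by simpa [Set.indicator_apply] using hBa v)
      (by simpa using hak v)
  choose J hBJ hJ using hJ
  simp only [← hJ, mem_shiftedCoverSums_card_iff] at ht
  choose D hD hDJ hDt using ht
  refine ⟨fun j => {x | Sum.elim (fun v => j ∈ J v) (fun p => p.2 ∈ D p.1 j) x}, fun j => ?_, ?_⟩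
  · refine isVertexCover_attach_iff.2 ⟨fun u v huv => ?_, fun v => ⟨hD v j, hDJ v j⟩⟩
    have hmem (v : V) (hv : v ∈ B j) : j ∈ J v := hBJ v (by simpa using hv)
    exact (hB j huv).imp (hmem u) (hmem v)
  · rintro (v | ⟨v, w⟩)
    · exact (sum_indicator_preimage J v).trans_le ((hJ v).trans_le (hat v))
    · exact hDt v w

theorem coverSums_attach_eq_fiberedSet :
    coverSums k (attach G H) = fiberedSet {a | a ∈ coverSums k G ∧ ∀ v, a v ≤ k}
      fun a => sigmaSet fun v => shiftedCoverSums k (a v) (H v) :=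
  Set.ext fun _ => ⟨exists_mem_shiftedCoverSums_of_mem_coverSums_attach,
    fun ⟨_, ha, hat, ht⟩ => mem_coverSums_attach_of_mem_shiftedCoverSums ha.1 ha.2 hat ht⟩

section Shifted

variable {τ : Type*} {H : SimpleGraph τ}

theorem HasLinearQuotients.shiftedCoverSums {n : ℕ} (h : HasLinearQuotients (coverSums n H))
    (k : ℕ) : HasLinearQuotients (shiftedCoverSums k n H) :=
  h.add_const fun _ => k - n

theorem shiftedCoverSums_mono {n n' : ℕ} (hn : n ≤ n') (hn' : n' ≤ k) :
    shiftedCoverSums k n H ⊆ shiftedCoverSums k n' H := by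
  induction n', hn using Nat.le_induction with
  | base => exact subset_rfl
  | succ l _ ih =>
    intro s hs
    obtain ⟨m, hm, hms⟩ := ih (by omega) hs
    refine ⟨m + 1, mem_coverSums_succ.2 ⟨Set.univ, SimpleGraph.isVertexCover_univ, m, hm,
      by rw [Set.indicator_univ]⟩, fun w => ?_⟩
    have := hms w
    simp only [Pi.add_apply, Pi.one_apply] at this ⊢
    omega

theorem exists_lt_mem_shiftedCoverSums {n : ℕ} (hn : n < k) (w₀ : τ) {s : τ → ℕ}
    (hs : s ∈ shiftedCoverSums k n H) : ∃ s' ∈ shiftedCoverSums k (n + 1) H, s' < s := by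
  classical
  obtain ⟨m, hm, hms⟩ := hs
  have hcover : H.IsVertexCover ({w₀}ᶜ : Set τ) := by simp
  refine ⟨s - Pi.single w₀ 1, ⟨m + ({w₀}ᶜ : Set τ).indicator 1,
    mem_coverSums_succ.2 ⟨_, hcover, m, hm, le_rfl⟩, fun w => ?_⟩,
    lt_of_le_of_ne tsub_le_self fun h => ?_⟩
  · have := hms w
    rcases eq_or_ne w w₀ with rfl | hw
    · simp at this ⊢
      omega
    · simp [hw] at this ⊢
      omega
  · have hpos := hms w₀
    have heq := congrFun h w₀
    simp only [Pi.add_apply, Pi.sub_apply, Pi.single_eq_same] at hpos heq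
    omega

end Shifted

theorem isFiberedFamily_shiftedCoverSums [DecidableEq V] [∀ v, Nonempty (W v)]
    (G : SimpleGraph V) (H : ∀ v, SimpleGraph (W v)) (k : ℕ) :
    IsFiberedFamily {a | a ∈ coverSums k G ∧ ∀ v, a v ≤ k}
      fun a => sigmaSet fun v => shiftedCoverSums k (a v) (H v) := by
  have hmono : ∀ a, ∀ b ∈ {b | b ∈ coverSums k G ∧ ∀ v, b v ≤ k}, a ≤ b →
      sigmaSet (fun v => shiftedCoverSums k (a v) (H v)) ⊆
        sigmaSet fun v => shiftedCoverSums k (b v) (H v) :=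
    fun a b hb hab s hs v => shiftedCoverSums_mono (hab v) (hb.2 v) (hs v)
  refine ⟨fun a ha b hb v hv => ⟨isUpperSet_coverSums k G le_self_add ha.1, fun u => ?_⟩,
    fun a _ b => hmono a b, fun a _ v hav s hs => ?_⟩
  · rcases eq_or_ne u v with rfl | hu
    · simpa using hv.trans_le (hb.2 u)
    · simpa [hu] using ha.2 u
  · have hlt : a v < k := by simpa using hav.2 v
    obtain ⟨r, hr, hrs⟩ := exists_lt_mem_shiftedCoverSums hlt (Classical.arbitrary (W v)) (hs v)
    refine ⟨updateBlock s v r, updateBlock_mem_sigmaSet (hmono a _ hav le_self_add hs)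
      (by simpa using hr), lt_of_le_of_ne (updateBlock_le hrs.le) fun h => hrs.ne ?_⟩
    exact funext fun w => by rw [← updateBlock_same s v r w, h]

theorem hasLinearQuotients_coverSums_attach [Finite V] [∀ v, Finite (W v)]
    [∀ v, Nonempty (W v)] (G : SimpleGraph V) (H : ∀ v, SimpleGraph (W v))
    (h : ∀ v n, HasLinearQuotients (coverSums n (H v))) (k : ℕ) :
    HasLinearQuotients (coverSums k (attach G H)) := by
  classical
  rw [coverSums_attach_eq_fiberedSet]
  exact (isFiberedFamily_shiftedCoverSums G H k).hasLinearQuotients fun a _ =>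
    HasLinearQuotients.sigmaSet fun v => (h v (a v)).shiftedCoverSums k

end Attach

/-! ### Unmixed chordal graphs -/

section Cliques

variable {σ : Type*} {H : SimpleGraph σ} {k : ℕ} {f f' : σ → ℕ} {v : σ}

theorem exists_eq_add_indicator_of_mem_minElts_succ (hf : f ∈ minElts (coverSums (k + 1) H)) :
    ∃ s ∈ minElts (coverSums k H), ∃ C, Minimal H.IsVertexCover C ∧ f = s + C.indicator 1 := by
  obtain ⟨C, hC, s, hs, hle⟩ := mem_coverSums_succ.1 hf.1
  obtain rfl : f = s + C.indicator 1 :=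
    (hf.eq_of_le (mem_coverSums_succ.2 ⟨C, hC, s, hs, le_rfl⟩) hle).symm
  refine ⟨s, ⟨hs, fun s' hs' hle' => ?_⟩, C, ⟨hC, fun D hD hDC v hv => ?_⟩, rfl⟩
  · exact le_of_add_le_add_right (hf.2 (mem_coverSums_succ.2 ⟨C, hC, s', hs', le_rfl⟩)
      (add_le_add_left hle' _))
  · have hlt := hf.2 (mem_coverSums_succ.2 ⟨D, hD, s, hs, le_rfl⟩) (add_le_add_right
      (Set.indicator_le_indicator_of_subset hDC fun _ => Nat.zero_le _) s) v
    by_contra hvD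
    simp [hv, hvD] at hlt

theorem exists_notMem_add_indicator_le_of_lt (hf : f ∈ coverSums (k + 1) H)
    (hv : f v < k + 1) :
    ∃ s ∈ coverSums k H, ∃ C, H.IsVertexCover C ∧ v ∉ C ∧ s + C.indicator 1 ≤ f := by
  obtain ⟨C, hC, hle⟩ := hf
  obtain ⟨j, hj⟩ : ∃ j, v ∉ C j := by
    by_contra! hmem
    refine hv.not_ge (le_trans (le_of_eq ?_) (hle v))
    simp [hmem]
  refine ⟨fun u => ∑ i, (C (j.succAbove i)).indicator (1 : σ → ℕ) u,
    ⟨_, fun i => hC _, fun u => le_rfl⟩, C j, hC j, hj, fun u => ?_⟩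
  rw [Pi.add_apply, add_comm,
    ← Fin.sum_univ_succAbove (fun i => (C i).indicator (1 : σ → ℕ) u) j]
  exact hle u

theorem isVertexCover_diff_singleton {C : Set σ} (hC : H.IsVertexCover C)
    (hv : ∀ w, H.Adj v w → w ∈ C) : H.IsVertexCover (C \ {v}) := by
  intro x y hxy
  by_cases hx : x = v
  · exact Or.inr ⟨hv y (hx ▸ hxy), fun hy => hxy.ne (hx.trans hy.symm)⟩
  by_cases hy : y = v
  · exact Or.inl ⟨hv x (hy ▸ hxy.symm), hx⟩
  exact (hC hxy).imp (fun h => ⟨h, hx⟩) fun h => ⟨h, hy⟩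

theorem exists_lt_of_forall_fiber_sum_eq [Fintype σ] [DecidableEq σ] {ρ : σ → σ}
    (hsum : ∀ v, ∑ u with ρ u = ρ v, f u = ∑ u with ρ u = ρ v, f' u) (hne : f ≠ f')
    (hle : ∑ v with ρ v = v, f' v ≤ ∑ v with ρ v = v, f v) : ∃ v, ρ v ≠ v ∧ f v < f' v := by
  by_contra! hoff
  have hfree_le : ∀ w ∈ Finset.univ.filter fun w => ρ w = w, f w ≤ f' w := fun w hw => by
    rw [Finset.mem_filter] at hw
    have hmem : w ∈ Finset.univ.filter fun u => ρ u = ρ w := by simp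
    have herase : ∑ u ∈ (Finset.univ.filter fun u => ρ u = ρ w).erase w, f' u ≤
        ∑ u ∈ (Finset.univ.filter fun u => ρ u = ρ w).erase w, f u := by
      refine Finset.sum_le_sum fun u hu => hoff u fun hfix => ?_
      rw [Finset.mem_erase, Finset.mem_filter, hfix, hw.2] at hu
      exact hu.1 hu.2.2
    have := hsum w
    rw [← Finset.add_sum_erase _ _ hmem, ← Finset.add_sum_erase _ _ hmem] at this
    omega
  have hfree_eq := (Finset.sum_eq_sum_iff_of_le hfree_le).1
    ((Finset.sum_le_sum hfree_le).antisymm hle)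
  have hall (u : σ) : f' u ≤ f u := by
    by_cases hu : ρ u = u
    · exact (hfree_eq u (by simp [hu])).ge
    · exact hoff u hu
  exact hne (funext fun u => ((Finset.sum_eq_sum_iff_of_le fun x _ => hall x).1 (hsum u).symm u
    (by simp)).symm)

/-- The fibres of `ρ` form a partition of the vertices of `H` into cliques, and `ρ v` is a free
vertex of the clique containing `v`: all its neighbours belong to that clique. -/
structure IsFreeCliquePartition (H : SimpleGraph σ) (ρ : σ → σ) : Prop where
  idem : ∀ v, ρ (ρ v) = ρ v
  adj : ∀ u v, ρ u = ρ v → u ≠ v → H.Adj u v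
  eq_of_adj : ∀ v w, H.Adj (ρ v) w → ρ w = ρ v

namespace IsFreeCliquePartition

variable {ρ : σ → σ}

theorem exists_notMem (hρ : IsFreeCliquePartition H ρ) {C : Set σ}
    (hC : Minimal H.IsVertexCover C) (v : σ) : ∃ u, ρ u = ρ v ∧ u ∉ C := by
  by_contra! hmem
  have hcover := isVertexCover_diff_singleton hC.1 fun w hw => hmem w (hρ.eq_of_adj v w hw)
  exact (hC.2 hcover Set.sdiff_subset (hmem _ (hρ.idem v))).2 rfl

theorem exists_leAddSingle_of_lt [Finite σ] (hρ : IsFreeCliquePartition H ρ)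
    (hf : f ∈ coverSums (k + 1) H) (hv : f v < k + 1) (hfree : ρ v ≠ v) :
    ∃ g ∈ minElts (coverSums (k + 1) H), g (ρ v) < f (ρ v) ∧ LeAddSingle v g f := by
  obtain ⟨s, hs, C, hC, hvC, hle⟩ := exists_notMem_add_indicator_le_of_lt hf hv
  have hcover : H.IsVertexCover (insert v C \ {ρ v}) := by
    refine isVertexCover_diff_singleton (hC.subset (Set.subset_insert v C)) fun y hy => ?_
    rcases eq_or_ne y v with rfl | hyv
    · exact Set.mem_insert _ _
    · exact Or.inr ((hC (hρ.adj y v (hρ.eq_of_adj v y hy) hyv)).resolve_right hvC)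
  obtain ⟨g, hg, hgle⟩ := exists_mem_minElts_le
    (mem_coverSums_succ.2 ⟨_, hcover, s, hs, le_rfl⟩)
  refine ⟨g, hg, (hgle (ρ v)).trans_lt (lt_of_lt_of_le ?_ (hle (ρ v))),
    (hgle v).trans (le_trans ?_ (Nat.add_le_add_right (hle v) 1)),
    fun u hu => (hgle u).trans (le_trans ?_ (hle u))⟩
  · have hmem : ρ v ∈ C := (hC (hρ.adj (ρ v) v (hρ.idem v) hfree)).resolve_right hvC
    simp [hmem]
  · simp [hvC, hfree.symm]
  · by_cases huC : u ∈ C <;> by_cases hur : u = ρ v <;> simp [huC, hu, hur]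

section Fintype

variable [Fintype σ] [DecidableEq σ]

theorem sum_indicator_add_one (hρ : IsFreeCliquePartition H ρ) {C : Set σ}
    (hC : Minimal H.IsVertexCover C) (v : σ) :
    ∑ u with ρ u = ρ v, C.indicator (1 : σ → ℕ) u + 1 =
      (Finset.univ.filter fun u => ρ u = ρ v).card := by
  obtain ⟨u, hu, huC⟩ := hρ.exists_notMem hC v
  have hu' : u ∈ Finset.univ.filter fun u => ρ u = ρ v := by simp [hu]
  have hone : ∀ x ∈ (Finset.univ.filter fun u => ρ u = ρ v).erase u,
      C.indicator (1 : σ → ℕ) x = 1 := fun x hx => by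
    rw [Finset.mem_erase, Finset.mem_filter] at hx
    have hadj := hρ.adj x u (hx.2.2.trans hu.symm) hx.1
    simp [(hC.1 hadj).resolve_right huC]
  rw [← Finset.add_sum_erase _ _ hu', Set.indicator_of_notMem huC, zero_add,
    Finset.sum_congr rfl hone, Finset.sum_const, smul_eq_mul, mul_one,
    Finset.card_erase_add_one hu']

theorem sum_fiber_add (hρ : IsFreeCliquePartition H ρ) (hf : f ∈ minElts (coverSums k H))
    (v : σ) :
    ∑ u with ρ u = ρ v, f u + k = k * (Finset.univ.filter fun u => ρ u = ρ v).card := by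
  induction k generalizing f with
  | zero => simpa using fun i _ => Nat.le_zero.1 (le_of_mem_minElts_coverSums hf i)
  | succ k ih =>
    obtain ⟨s, hs, C, hC, rfl⟩ := exists_eq_add_indicator_of_mem_minElts_succ hf
    have := ih hs
    have := hρ.sum_indicator_add_one hC v
    simp only [Pi.add_apply, Finset.sum_add_distrib, add_one_mul]
    omega

end Fintype

theorem hasLinearQuotients_coverSums [Finite σ] (hρ : IsFreeCliquePartition H ρ)
    (k : ℕ) : HasLinearQuotients (coverSums k H) := by
  classical
  have := Fintype.ofFinite σ
  refine ⟨fun f => ∑ v with ρ v = v, f v, fun f hf f' hf' hne hle => ?_⟩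
  obtain ⟨v, hfree, hlt⟩ := exists_lt_of_forall_fiber_sum_eq (fun v => Nat.add_right_cancel
    ((hρ.sum_fiber_add hf v).trans (hρ.sum_fiber_add hf' v).symm)) hne.symm hle
  have hvk : f v < k := hlt.trans_le (le_of_mem_minElts_coverSums hf' v)
  obtain ⟨k, rfl⟩ := Nat.exists_eq_succ_of_ne_zero (Nat.ne_zero_of_lt hvk)
  obtain ⟨g, hg, hgf, hle⟩ := hρ.exists_leAddSingle_of_lt hf.1 hvk hfree
  refine ⟨v, hlt, g, hg, Finset.sum_lt_sum (fun u hu => hle.2 u ?_) ⟨ρ v, by simp [hρ.idem], hgf⟩,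
    hle⟩
  rintro rfl
  exact hfree (Finset.mem_filter.1 hu).2

end IsFreeCliquePartition

end Cliques

section Chordal

variable {σ : Type*} {H : SimpleGraph σ} {u a b : σ} {p : H.Walk a b}

theorem isChordless_of_forall_length_le
    (hp : ∀ q : H.Walk a b, q.support ⊆ p.support → p.length ≤ q.length) : p.IsChordless := by
  classical
  rw [SimpleGraph.Walk.isChordless_iff_forall_mem_edges]
  induction p with
  | nil => simp +contextual
  | @cons u v w h p ih =>
    have hhead : ∀ z ∈ p.support, H.Adj u z → z = v := fun z hz huz => by
      have hshort := hp (.cons huz (p.dropUntil z hz)) (by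
        simpa using List.subset_cons_of_subset u (p.support_dropUntil_subset_support hz))
      have htake := congrArg SimpleGraph.Walk.length (p.take_spec hz)
      simp only [SimpleGraph.Walk.length_cons, SimpleGraph.Walk.length_append] at hshort htake
      exact (SimpleGraph.Walk.eq_of_length_eq_zero (p := p.takeUntil z hz) (by omega)).symm
    have htail := ih fun q hq => by
      simpa using hp (.cons h q) (by simpa using List.cons_subset_cons u hq)
    intro x y hx hy hxy
    rw [SimpleGraph.Walk.support_cons, List.mem_cons] at hx hy
    rw [SimpleGraph.Walk.edges_cons, List.mem_cons]
    rcases hx with rfl | hx <;> rcases hy with rfl | hy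
    · exact absurd rfl hxy.ne
    · exact Or.inl (by rw [hhead y hy hxy])
    · exact Or.inl (by rw [hhead x hx hxy.symm, Sym2.eq_swap])
    · exact Or.inr (htail hx hy hxy)

theorem exists_isPath_isChordless (p : H.Walk a b) :
    ∃ q : H.Walk a b, q.IsPath ∧ q.IsChordless ∧ q.support ⊆ p.support := by
  classical
  obtain ⟨_, -, hq⟩ := exists_minimal_le_of_wellFoundedLT
    (fun n => ∃ q : H.Walk a b, q.length = n ∧ q.support ⊆ p.support) p.length
    ⟨p, rfl, List.Subset.refl _⟩
  obtain ⟨⟨q, rfl, hqp⟩, hmin⟩ := hq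
  have hsub := q.support_bypass_subset_support
  refine ⟨q.bypass, q.bypass_isPath, isChordless_of_forall_length_le fun r hr => ?_,
    List.Subset.trans hsub hqp⟩
  have hr' := List.Subset.trans hr (List.Subset.trans hsub hqp)
  exact q.length_bypass_le_length.trans
    ((le_total _ _).elim id fun h => hmin ⟨r, rfl, hr'⟩ h)

theorem isCycle_cons_concat (hp : p.IsPath) (hu : u ∉ p.support) (hua : H.Adj u a)
    (hub : H.Adj u b) (hab : a ≠ b) : (SimpleGraph.Walk.cons hua (p.concat hub.symm)).IsCycle := by
  rw [SimpleGraph.Walk.cons_isCycle_iff, SimpleGraph.Walk.concat_isPath_iff,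
    SimpleGraph.Walk.edges_concat, List.concat_eq_append, List.mem_append, List.mem_singleton,
    Sym2.eq_iff]
  refine ⟨⟨hp, hu⟩, ?_⟩
  rintro (h | ⟨h, -⟩ | ⟨-, h⟩)
  · exact hu (p.fst_mem_support_of_mem_edges h)
  · exact hub.ne h
  · exact hab h

theorem isChordless_cons_concat (hp : p.IsChordless) (hua : H.Adj u a) (hub : H.Adj u b)
    (hnbr : ∀ z ∈ p.support, H.Adj u z → z = a ∨ z = b) :
    (SimpleGraph.Walk.cons hua (p.concat hub.symm)).IsChordless := by
  rw [SimpleGraph.Walk.isChordless_iff_forall_mem_edges]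
  have hmem {z : σ} : z ∈ (SimpleGraph.Walk.cons hua (p.concat hub.symm)).support ↔
      z = u ∨ z ∈ p.support := by
    simp only [SimpleGraph.Walk.support_cons, SimpleGraph.Walk.support_concat, List.mem_cons,
      List.mem_append, List.not_mem_nil, or_false]
    tauto
  have hedge {e : Sym2 σ} : e ∈ (SimpleGraph.Walk.cons hua (p.concat hub.symm)).edges ↔
      e = s(u, a) ∨ e = s(u, b) ∨ e ∈ p.edges := by
    simp [SimpleGraph.Walk.edges_concat, Sym2.eq_swap, or_comm]
  intro x y hx hy hxy
  rw [hedge]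
  rcases hmem.1 hx with rfl | hx' <;> rcases hmem.1 hy with rfl | hy'
  · exact absurd rfl hxy.ne
  · rcases hnbr y hy' hxy with rfl | rfl <;> simp
  · rcases hnbr x hx' hxy.symm with rfl | rfl <;> simp [Sym2.eq_swap]
  · exact Or.inr (Or.inr (hp.mem_edges hx' hy' hxy))

namespace IsChordal

theorem length_lt_of_isChordless (hH : IsChordal H) {c : H.Walk u u} (hc : c.IsCycle)
    (hchord : c.IsChordless) : c.length < 4 := by
  by_contra! hlen
  obtain ⟨x, hx, y, hy, hxy, hnot⟩ := hH u c hc hlen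
  exact hnot (hchord.mem_edges hx hy hxy)

theorem adj_of_walk (hH : IsChordal H) (hua : H.Adj u a) (hub : H.Adj u b) (hab : a ≠ b)
    (p : H.Walk a b) (hu : u ∉ p.support) (hnbr : ∀ z ∈ p.support, H.Adj u z → z = a ∨ z = b) :
    H.Adj a b := by
  obtain ⟨q, hq, hqc, hqp⟩ := exists_isPath_isChordless p
  have hlt := hH.length_lt_of_isChordless
    (isCycle_cons_concat hq (fun h => hu (hqp h)) hua hub hab)
    (isChordless_cons_concat hqc hua hub fun z hz => hnbr z (hqp hz))
  simp only [SimpleGraph.Walk.length_cons, SimpleGraph.Walk.length_concat] at hlt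
  have hzero : q.length ≠ 0 := fun h => hab (SimpleGraph.Walk.eq_of_length_eq_zero h)
  exact SimpleGraph.Walk.adj_of_length_eq_one (p := q) (by omega)

theorem adj_of_walk_of_adj (hH : IsChordal H) {x y : σ} (hua : H.Adj u a) (hub : H.Adj u b)
    (hab : a ≠ b) (hax : H.Adj a x) (hby : H.Adj b y) (p : H.Walk x y)
    (hp : ∀ z ∈ p.support, z ≠ u ∧ ¬ H.Adj u z) : H.Adj a b := by
  have hmem {z : σ} (hz : z ∈ (SimpleGraph.Walk.cons hax (p.concat hby.symm)).support) :
      z = a ∨ z ∈ p.support ∨ z = b := by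
    simpa [SimpleGraph.Walk.support_concat] using hz
  refine hH.adj_of_walk hua hub hab (.cons hax (p.concat hby.symm)) (fun hu => ?_)
    fun z hz huz => ?_
  · rcases hmem hu with h | h | h
    exacts [hua.ne h, (hp u h).1 rfl, hub.ne h]
  · exact (hmem hz).imp_right fun h => h.resolve_left fun h => (hp z h).2 huz

theorem exists_isClique_separator (hH : IsChordal H) {T : Finset σ} {w : σ} (hw : w ∈ T)
    (hwu : w ≠ u) (huw : ¬ H.Adj u w) :
    ∃ C S : Finset σ, w ∈ C ∧ (∀ x ∈ C, x ∈ T ∧ x ≠ u ∧ ¬ H.Adj u x) ∧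
      (∀ s ∈ S, s ∈ T ∧ H.Adj u s) ∧ H.IsClique (S : Set σ) ∧
      ∀ x ∈ C, ∀ y ∈ T, H.Adj x y → y ∈ C ∨ y ∈ S := by
  classical
  let A : Set σ := {x | x ∈ T ∧ x ≠ u ∧ ¬ H.Adj u x}
  let C : Finset σ := T.filter fun x => ∃ p : H.Walk w x, ∀ z ∈ p.support, z ∈ A
  let S : Finset σ := T.filter fun s => H.Adj u s ∧ ∃ x ∈ C, H.Adj s x
  have hCA : ∀ x ∈ C, x ∈ A := fun x hx =>
    let ⟨p, hp⟩ := (Finset.mem_filter.1 hx).2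
    hp x p.end_mem_support
  refine ⟨C, S, Finset.mem_filter.2 ⟨hw, .nil, by simp [A, hw, hwu, huw]⟩, hCA,
    fun s hs => ⟨(Finset.mem_filter.1 hs).1, (Finset.mem_filter.1 hs).2.1⟩,
    fun a ha b hb hab => ?_, fun x hx y hy hxy => ?_⟩
  · obtain ⟨-, hua, x, hx, hax⟩ := Finset.mem_filter.1 ha
    obtain ⟨-, hub, y, hy, hby⟩ := Finset.mem_filter.1 hb
    obtain ⟨-, p, hp⟩ := Finset.mem_filter.1 hx
    obtain ⟨-, q, hq⟩ := Finset.mem_filter.1 hy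
    exact hH.adj_of_walk_of_adj hua hub hab hax hby (p.reverse.append q) fun z hz =>
      (((p.reverse.mem_support_append_iff q).1 hz).elim (fun h => hp z (by simpa using h))
        (hq z)).2
  · obtain ⟨p, hp⟩ := (Finset.mem_filter.1 hx).2
    by_cases huy : H.Adj u y
    · exact Or.inr (Finset.mem_filter.2 ⟨hy, huy, x, hx, hxy.symm⟩)
    · have hyA : y ∈ A := ⟨hy, fun h => (hCA x hx).2.2 (h ▸ hxy.symm), huy⟩
      refine Or.inl (Finset.mem_filter.2 ⟨hy, p.concat hxy, fun z hz => ?_⟩)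
      rw [SimpleGraph.Walk.support_concat, List.mem_append, List.mem_singleton] at hz
      exact hz.elim (hp z) fun h => h ▸ hyA

end IsChordal

/-- `v` is a simplicial vertex of the subgraph of `H` induced on `T`: the neighbours of `v` in `T`
form a clique. We do not require `v ∈ T`. -/
def IsSimplicialIn (H : SimpleGraph σ) (T : Finset σ) (v : σ) : Prop :=
  H.IsClique {a | a ∈ T ∧ H.Adj v a}

namespace IsChordal

theorem exists_isSimplicialIn_not_adj (hH : IsChordal H) (T : Finset σ) (hu : u ∈ T)
    (hnon : ∃ w ∈ T, w ≠ u ∧ ¬ H.Adj u w) :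
    ∃ x ∈ T, x ≠ u ∧ ¬ H.Adj u x ∧ IsSimplicialIn H T x := by
  classical
  induction T using Finset.strongInduction generalizing u with
  | H T ih =>
  obtain ⟨w, hwT, hwu, huw⟩ := hnon
  obtain ⟨C, S, hwC, hC, hS, hSclique, hnbr⟩ := hH.exists_isClique_separator hwT hwu huw
  have hsub : C ∪ S ⊂ T := by
    refine Finset.ssubset_iff_subset_ne.2 ⟨Finset.union_subset (fun x hx => (hC x hx).1)
      fun x hx => (hS x hx).1, fun h => ?_⟩
    rcases Finset.mem_union.1 (h ▸ hu) with h | h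
    exacts [(hC u h).2.1 rfl, (hS u h).2.ne rfl]
  suffices ∃ x ∈ C, IsSimplicialIn H (C ∪ S) x by
    obtain ⟨x, hx, hsimp⟩ := this
    exact ⟨x, (hC x hx).1, (hC x hx).2.1, (hC x hx).2.2, fun a ha b hb => hsimp
      ⟨Finset.mem_union.2 (hnbr x hx a ha.1 ha.2), ha.2⟩
      ⟨Finset.mem_union.2 (hnbr x hx b hb.1 hb.2), hb.2⟩⟩
  have of_nonuniversal : ∀ s ∈ S, (∃ y ∈ C ∪ S, y ≠ s ∧ ¬ H.Adj s y) →
      ∃ x ∈ C, IsSimplicialIn H (C ∪ S) x := fun s hs hy => by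
    obtain ⟨x, hx, hxs, hsx, hsimp⟩ := ih _ hsub (Finset.mem_union_right _ hs) hy
    exact ⟨x, (Finset.mem_union.1 hx).resolve_right fun hxS => hsx (hSclique hs hxS hxs.symm),
      hsimp⟩
  by_cases hcl : H.IsClique ((C ∪ S : Finset σ) : Set σ)
  · exact ⟨w, hwC, hcl.subset fun a ha => ha.1⟩
  simp only [SimpleGraph.IsClique, Set.Pairwise, Finset.mem_coe] at hcl
  push Not at hcl
  obtain ⟨p, hp, q, hq, hpq, hnadj⟩ := hcl
  obtain ⟨x, hx, hxp, hpx, hsimp⟩ := ih _ hsub hp ⟨q, hq, hpq.symm, hnadj⟩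
  rcases Finset.mem_union.1 hx with hxC | hxS
  · exact ⟨x, hxC, hsimp⟩
  · exact of_nonuniversal x hxS ⟨p, hp, hxp.symm, fun h => hpx h.symm⟩

/-- Dirac's theorem. -/
theorem exists_isSimplicialIn (hH : IsChordal H) {T : Finset σ} (hT : T.Nonempty) :
    ∃ x ∈ T, IsSimplicialIn H T x := by
  by_cases hcl : H.IsClique (T : Set σ)
  · exact hT.imp fun x hx => ⟨hx, hcl.subset fun a ha => ha.1⟩
  simp only [SimpleGraph.IsClique, Set.Pairwise, Finset.mem_coe] at hcl
  push Not at hcl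
  obtain ⟨u, hu, w, hw, huw, hnadj⟩ := hcl
  obtain ⟨x, hx, -, -, hsimp⟩ := hH.exists_isSimplicialIn_not_adj T hu ⟨w, hw, huw.symm, hnadj⟩
  exact ⟨x, hx, hsimp⟩

end IsChordal

/-- `κ` maps every vertex in `T` to the representative of its class in a partition of `T` into
cliques whose representatives form an independent set. -/
structure IsCliquePartition (H : SimpleGraph σ) (T : Finset σ) (κ : σ → σ) : Prop where
  mem : ∀ v ∈ T, κ v ∈ T
  idem : ∀ v ∈ T, κ (κ v) = κ v
  adj : ∀ u ∈ T, ∀ v ∈ T, κ u = κ v → u ≠ v → H.Adj u v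
  not_adj : ∀ u ∈ T, ∀ v ∈ T, ¬ H.Adj (κ u) (κ v)

namespace IsCliquePartition

variable [DecidableEq σ] {T : Finset σ} {κ : σ → σ}

theorem ite_of_isSimplicialIn {T' : Finset σ} {x : σ}
    (hκ : IsCliquePartition H T' κ) (hx : x ∈ T) (hsimp : IsSimplicialIn H T x)
    (hT' : ∀ y, y ∈ T' ↔ y ∈ T ∧ y ≠ x ∧ ¬ H.Adj x y) :
    IsCliquePartition H T fun y => if y ∈ T' then κ y else x where
  mem v _ := by grind [hκ.mem v]
  idem v _ := by grind [hκ.mem v, hκ.idem v]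
  adj u hu v hv huv hne := by
    have hcl := @hsimp u
    have := H.adj_comm
    grind [hκ.mem u, hκ.mem v, hκ.adj u]
  not_adj u _ v _ := by
    have := H.adj_comm
    have := H.irrefl (v := x)
    grind [hκ.mem u, hκ.mem v, hκ.not_adj u]

end IsCliquePartition

namespace IsChordal

theorem exists_isCliquePartition (hH : IsChordal H) (T : Finset σ) :
    ∃ κ, IsCliquePartition H T κ := by
  classical
  induction T using Finset.strongInduction with
  | H T ih =>
  rcases T.eq_empty_or_nonempty with rfl | hT
  · exact ⟨id, by simp, by simp, by simp, by simp⟩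
  obtain ⟨x, hx, hsimp⟩ := hH.exists_isSimplicialIn hT
  obtain ⟨κ, hκ⟩ := ih (T.filter fun y => y ≠ x ∧ ¬ H.Adj x y)
    (Finset.filter_ssubset.2 ⟨x, hx, by simp⟩)
  exact ⟨_, hκ.ite_of_isSimplicialIn hx hsimp fun y => Finset.mem_filter⟩

theorem exists_isIndepSet_dominating (hH : IsChordal H) (T : Finset σ) {F : Set σ}
    (hF : H.IsClique F) :
    ∃ B : Set σ, B ⊆ T \ F ∧ H.IsIndepSet B ∧
      ∀ x ∈ F, x ∈ T → (∃ y ∈ (T : Set σ) \ F, H.Adj x y) → ∃ y ∈ B, H.Adj x y := by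
  classical
  induction T using Finset.strongInduction with
  | H T ih =>
  rcases T.eq_empty_or_nonempty with rfl | hT
  · exact ⟨∅, by simp, by simp, by simp⟩
  obtain ⟨v, hv, hsimp⟩ := hH.exists_isSimplicialIn hT
  obtain ⟨B, hBT, hB, hdom⟩ := ih (T.erase v) (Finset.erase_ssubset hv)
  have hBT' : B ⊆ T \ F := hBT.trans (by gcongr; exact Finset.erase_subset v T)
  by_cases hout : ∃ y ∈ (T : Set σ) \ F, H.Adj v y
  · obtain ⟨y, hy, hvy⟩ := hout
    by_cases hvF : v ∈ F
    · refine ⟨{y}, by simpa using hy, by simp, fun x hx hxT _ => ⟨y, rfl, ?_⟩⟩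
      rcases eq_or_ne v x with rfl | hvx
      · exact hvy
      · exact hsimp ⟨hxT, hF hvF hx hvx⟩ ⟨hy.1, hvy⟩ fun h => hy.2 (h ▸ hx)
    · refine ⟨B, hBT', hB, fun x hx hxT ⟨z, hz, hxz⟩ => hdom x hx (by grind) ?_⟩
      rcases eq_or_ne z v with rfl | hzv
      · exact ⟨y, by simpa [hvy.ne'] using hy, hsimp ⟨hxT, hxz.symm⟩ ⟨hy.1, hvy⟩
          fun h => hy.2 (h ▸ hx)⟩
      · exact ⟨z, by simpa [hzv] using hz, hxz⟩
  · push Not at hout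
    by_cases hvF : v ∈ F
    · refine ⟨B, hBT', hB, fun x hx hxT ⟨z, hz, hxz⟩ => hdom x hx ?_ ⟨z, ?_, hxz⟩⟩ <;> grind
    · refine ⟨insert v B, Set.insert_subset ⟨hv, hvF⟩ hBT', ?_, fun x hx hxT ⟨z, hz, hxz⟩ => ?_⟩
      · exact hB.insert fun z hz _ => ⟨hout z (hBT' hz), fun h => hout z (hBT' hz) h.symm⟩
      · rcases eq_or_ne z v with rfl | hzv
        · exact ⟨z, Set.mem_insert _ _, hxz⟩
        · exact (hdom x hx (by grind) ⟨z, by simpa [hzv] using hz, hxz⟩).imp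
            fun y hy => ⟨Or.inr hy.1, hy.2⟩

end IsChordal

namespace IsCliquePartition

variable [Fintype σ] {κ : σ → σ} {D : Finset σ}

theorem isMinVertexCover_compl [DecidableEq σ] (hκ : IsCliquePartition H Finset.univ κ) :
    IsMinVertexCover H (Finset.univ.filter fun v => κ v = v)ᶜ := by
  refine ⟨?_, fun E hE hsub z hz => ?_⟩
  · change H.IsVertexCover _
    rw [Finset.coe_compl, SimpleGraph.isVertexCover_compl]
    intro x hx y hy _ hxy
    rw [Finset.mem_coe, Finset.mem_filter] at hx hy
    exact hκ.not_adj x (Finset.mem_univ x) y (Finset.mem_univ y) (by rwa [hx.2, hy.2])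
  · have hz' : κ z ≠ z := by simpa using hz
    have hidem := hκ.idem z (Finset.mem_univ z)
    refine (hE (hκ.adj z (Finset.mem_univ z) (κ z) (Finset.mem_univ _) hidem.symm
      hz'.symm)).resolve_right fun h => ?_
    simpa [hidem] using hsub h

theorem card_compl_lt [DecidableEq σ] (hκ : IsCliquePartition H Finset.univ κ)
    (hD : H.IsVertexCover (D : Set σ)) {v : σ} (hv : ∀ x, κ x = κ v → x ∈ D) :
    Dᶜ.card < (Finset.univ.filter fun v => κ v = v).card := by
  have hmem : κ v ∈ Finset.univ.filter fun v => κ v = v := by simp [hκ.idem]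
  refine lt_of_le_of_lt (Finset.card_le_card_of_injOn κ (fun x hx => ?_) fun x hx y hy hxy => ?_)
    (Finset.card_erase_lt_of_mem hmem)
  · rw [Finset.coe_compl, Set.mem_compl_iff, Finset.mem_coe] at hx
    simpa [hκ.idem] using fun h => hx (hv x h)
  · rw [Finset.coe_compl, Set.mem_compl_iff] at hx hy
    by_contra hne
    exact (hD (hκ.adj x (Finset.mem_univ x) y (Finset.mem_univ y) hxy hne)).elim hx hy

theorem exists_notMem (hκ : IsCliquePartition H Finset.univ κ) (hu : IsUnmixed H)
    (hD : IsMinVertexCover H D) (v : σ) : ∃ x, κ x = κ v ∧ x ∉ D := by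
  classical
  by_contra! hv
  have hlt := hκ.card_compl_lt hD.1 hv
  have hcard := hu D _ hD hκ.isMinVertexCover_compl
  have := D.card_add_card_compl
  have := (Finset.univ.filter fun v => κ v = v).card_add_card_compl
  omega

theorem exists_free (hκ : IsCliquePartition H Finset.univ κ) (hu : IsUnmixed H)
    (hH : IsChordal H) (v : σ) : ∃ x, κ x = κ v ∧ ∀ y, H.Adj x y → κ y = κ v := by
  by_contra! hout
  have hclique : H.IsClique {x | κ x = κ v} := fun a ha b hb hne =>
    hκ.adj a (Finset.mem_univ a) b (Finset.mem_univ b) (Eq.trans ha (Eq.symm hb)) hne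
  obtain ⟨B, -, hB, hdom⟩ := hH.exists_isIndepSet_dominating Finset.univ hclique
  obtain ⟨D, hDB, hD⟩ := exists_minimal_le_of_wellFoundedLT
    (fun D : Finset σ => H.IsVertexCover (D : Set σ)) (Set.toFinite Bᶜ).toFinset
    (by simpa using hB)
  obtain ⟨x, hx, hxD⟩ := hκ.exists_notMem hu hD v
  obtain ⟨y, hxy, hy⟩ := hout x hx
  obtain ⟨z, hz, hxz⟩ := hdom x hx (Finset.mem_univ x) ⟨y, by simpa using hy, hxy⟩
  exact (hD.1 hxz).elim hxD fun h => by simpa [hz] using hDB h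

end IsCliquePartition

theorem hasLinearQuotients_coverSums_of_isChordal [Finite σ] (hu : IsUnmixed H)
    (hH : IsChordal H) (k : ℕ) : HasLinearQuotients (coverSums k H) := by
  classical
  have := Fintype.ofFinite σ
  obtain ⟨κ, hκ⟩ := hH.exists_isCliquePartition Finset.univ
  choose ρ hρ hfree using fun v => hκ.exists_free hu hH v
  have hidem (v : σ) : κ (κ v) = κ v := hκ.idem v (Finset.mem_univ v)
  have hκρ (v : σ) : κ (ρ (κ v)) = κ v := (hρ _).trans (hidem v)
  have hpart : IsFreeCliquePartition H (ρ ∘ κ) :=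
    { idem v := congrArg ρ (hκρ v)
      adj u v huv := hκ.adj u (Finset.mem_univ u) v (Finset.mem_univ v)
        ((hκρ u).symm.trans ((congrArg κ huv).trans (hκρ v)))
      eq_of_adj v w hvw := congrArg ρ ((hfree _ w hvw).trans (hidem v)) }
  exact hpart.hasLinearQuotients_coverSums k

end Chordal

/-! ### Forests -/

section Forests

variable {σ : Type*} {H : SimpleGraph σ} {k : ℕ} {l : σ → ℕ}

theorem exists_isLeafAt_of_isAcyclic [Finite σ] (hH : H.IsAcyclic) (hne : H ≠ ⊥) :
    ∃ i a, IsLeafAt H i a := by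
  obtain ⟨x, y, hxy⟩ := SimpleGraph.ne_bot_iff_exists_adj.1 hne
  have : Nonempty σ := ⟨x⟩
  obtain ⟨u, v, p, hp, hlong⟩ := SimpleGraph.Walk.exists_isPath_forall_isPath_length_le_length H
  have hnil : ¬ p.Nil := fun hnil => by
    have := hlong _ _ hxy.toWalk (by simp [hxy.ne])
    simp [SimpleGraph.Walk.length_eq_zero_iff.2 hnil] at this
  refine ⟨p.snd, u, fun w => ⟨fun huw => hH.eq_snd_of_adj_start hp huw ?_, ?_⟩⟩
  · by_contra hw
    have := hlong _ _ (.cons huw.symm p) (hp.cons hw)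
    simp at this
  · rintro rfl
    exact p.adj_snd hnil

/-- The exponent vectors `c ≥ l` with `c u + c v ≥ k` along every edge `uv`. Bounds `l` other than
`0` make the induction over forests possible. -/
def boundedEdgeSums (k : ℕ) (H : SimpleGraph σ) (l : σ → ℕ) : Set (σ → ℕ) :=
  {c | l ≤ c ∧ ∀ u v, H.Adj u v → k ≤ c u + c v}

theorem boundedEdgeSums_bot : boundedEdgeSums k ⊥ l = Set.Ici l := by
  ext c
  simp [boundedEdgeSums]

theorem boundedEdgeSums_deleteIncidenceSet_of_le {i a : σ} (ha : IsLeafAt H i a)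
    (hk : k ≤ l a + l i) :
    boundedEdgeSums k (H.deleteIncidenceSet a) l = boundedEdgeSums k H l := by
  ext c
  simp only [boundedEdgeSums, Set.mem_ofPred_eq, SimpleGraph.deleteIncidenceSet_adj]
  refine and_congr_right fun hl => ⟨fun h u v huv => ?_, fun h u v huv => h u v huv.1⟩
  have := hl a
  have := hl i
  grind [IsLeafAt, huv.symm]

theorem boundedEdgeSums_add_single [DecidableEq σ] (i : σ) :
    boundedEdgeSums k H (l + Pi.single i 1) = {c ∈ boundedEdgeSums k H l | l i < c i} := by
  have (c : σ → ℕ) : l + Pi.single i 1 ≤ c ↔ l ≤ c ∧ l i < c i := by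
    refine ⟨fun h => ⟨le_self_add.trans h, by simpa using h i⟩, fun ⟨h, hi⟩ j => ?_⟩
    rcases eq_or_ne j i with rfl | hj
    · simpa using hi
    · simpa [hj] using h j
  ext c
  simp only [boundedEdgeSums, Set.mem_ofPred_eq, this]
  tauto

open Classical in
/-- The bound on exponent vectors `c ≥ l` with `c i = l i` that the edges at `i` impose. -/
noncomputable def raisedBound (k : ℕ) (H : SimpleGraph σ) (l : σ → ℕ) (i : σ) : σ → ℕ :=
  fun v => if H.Adj i v then max (l v) (k - l i) else l v

theorem le_raisedBound (i : σ) : l ≤ raisedBound k H l i := fun v => by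
  grind [raisedBound]

theorem raisedBound_self (i : σ) : raisedBound k H l i i = l i := by
  simp [raisedBound]

theorem le_add_of_raisedBound_le {i v : σ} {c : σ → ℕ} (hc : raisedBound k H l i ≤ c)
    (hv : H.Adj i v) : k ≤ l i + c v := by
  have := hc v
  simp only [raisedBound, hv] at this
  grind

theorem boundedEdgeSums_raisedBound_subset (i : σ) :
    boundedEdgeSums k (H.deleteIncidenceSet i) (raisedBound k H l i) ⊆ boundedEdgeSums k H l := by
  rintro c ⟨hl, hc⟩
  have hlc := (le_raisedBound i).trans hl
  refine ⟨hlc, fun u v huv => ?_⟩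
  have hci := hlc i
  by_cases hu : u = i
  · grind [le_add_of_raisedBound_le hl (hu ▸ huv)]
  by_cases hv : v = i
  · grind [le_add_of_raisedBound_le hl (hv ▸ huv.symm)]
  exact hc u v (SimpleGraph.deleteIncidenceSet_adj.2 ⟨huv, hu, hv⟩)

theorem deleteIncidenceSet_lt_of_adj {u v : σ} (huv : H.Adj u v) : H.deleteIncidenceSet u < H :=
  (H.deleteIncidenceSet_le u).lt_of_not_ge fun h => by
    simpa [SimpleGraph.deleteIncidenceSet_adj] using h huv

theorem mem_boundedEdgeSums_raisedBound {i : σ} {c : σ → ℕ} (hc : c ∈ boundedEdgeSums k H l)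
    (hi : c i ≤ l i) :
    c ∈ boundedEdgeSums k (H.deleteIncidenceSet i) (raisedBound k H l i) := by
  obtain ⟨hl, hc⟩ := hc
  refine ⟨fun v => ?_, fun u v huv => hc u v (H.deleteIncidenceSet_le i huv)⟩
  have := hc i v
  have := hl v
  grind [raisedBound]

theorem le_of_mem_minElts_boundedEdgeSums_deleteIncidenceSet {i : σ} {c : σ → ℕ}
    (hc : c ∈ minElts (boundedEdgeSums k (H.deleteIncidenceSet i) l)) : c i ≤ l i := by
  classical
  have hle : Function.update c i (l i) ≤ c := update_le_self_iff.2 (hc.1.1 i)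
  have hmem : Function.update c i (l i) ∈ boundedEdgeSums k (H.deleteIncidenceSet i) l := by
    refine ⟨le_update_iff.2 ⟨le_rfl, fun j _ => hc.1.1 j⟩, fun u v huv => ?_⟩
    obtain ⟨-, hu, hv⟩ := SimpleGraph.deleteIncidenceSet_adj.1 huv
    simpa [hu, hv] using hc.1.2 u v huv
  simpa using hc.2 hmem hle i

theorem exchange_mem_boundedEdgeSums [DecidableEq σ] {i a : σ} {c : σ → ℕ} (ha : IsLeafAt H i a)
    (hk : l a + l i < k)
    (hc : c ∈ boundedEdgeSums k (H.deleteIncidenceSet i) (raisedBound k H l i)) :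
    exchange c a i ∈ boundedEdgeSums k H l := by
  obtain ⟨hl, hedge⟩ := boundedEdgeSums_raisedBound_subset i hc
  have hai : H.Adj a i := (ha i).2 rfl
  have hca := le_add_of_raisedBound_le hc.1 hai.symm
  have hexch := exchange_apply (w := c) hai.ne
  refine ⟨fun j => ?_, fun u v huv => ?_⟩
  · have := hl j
    grind
  · have := hedge u v huv
    have := hl i
    have := fun {v} => le_add_of_raisedBound_le hc.1 (v := v)
    grind [IsLeafAt, huv.symm, huv.ne]

theorem hasLinearQuotients_boundedEdgeSums_of_isLeafAt [Finite σ] {i a : σ} (ha : IsLeafAt H i a)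
    (hlt : ∀ H' < H, ∀ l, HasLinearQuotients (boundedEdgeSums k H' l)) (l : σ → ℕ) :
    HasLinearQuotients (boundedEdgeSums k H l) := by
  classical
  have hai : H.Adj a i := (ha i).2 rfl
  induction hd : k - l i using Nat.strong_induction_on generalizing l with | _ d ih
  rcases le_or_gt k (l a + l i) with hk | hk
  · rw [← boundedEdgeSums_deleteIncidenceSet_of_le ha hk]
    exact hlt _ (deleteIncidenceSet_lt_of_adj hai) l
  refine .of_split (i := i) (t := l i) ?_ (hlt _ (deleteIncidenceSet_lt_of_adj hai.symm) _)
    (boundedEdgeSums_raisedBound_subset i) (fun c => mem_boundedEdgeSums_raisedBound)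
    (fun c hc => ?_) fun c hc => ?_
  · rw [← boundedEdgeSums_add_single]
    exact ih _ (by simp; omega) _ rfl
  · exact (le_of_mem_minElts_boundedEdgeSums_deleteIncidenceSet hc).trans (raisedBound_self i).le
  · have hne := hai.ne
    have hci := (raisedBound_self i).ge.trans (hc.1.1 i)
    have hca := le_add_of_raisedBound_le hc.1.1 hai.symm
    exact ⟨exchange c a i, exchange_mem_boundedEdgeSums ha hk hc.1,
      by simpa [exchange, hne] using Nat.lt_succ_of_le hci, leAddSingle_exchange c a i, a,
      by simpa [exchange, hne] using by omega⟩

theorem hasLinearQuotients_boundedEdgeSums [Finite σ] (hH : H.IsAcyclic) (k : ℕ) (l : σ → ℕ) :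
    HasLinearQuotients (boundedEdgeSums k H l) := by
  induction H using WellFoundedLT.induction generalizing l with | _ H ih
  rcases eq_or_ne H ⊥ with rfl | hne
  · rw [boundedEdgeSums_bot]
    exact hasLinearQuotients_Ici l
  obtain ⟨i, a, ha⟩ := exists_isLeafAt_of_isAcyclic hH hne
  exact hasLinearQuotients_boundedEdgeSums_of_isLeafAt ha
    (fun H' hH' => ih H' hH' (hH.anti hH'.le)) l

theorem hasLinearQuotients_coverSums_of_isAcyclic [Finite σ] (hH : H.IsAcyclic) (k : ℕ) :
    HasLinearQuotients (coverSums k H) := by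
  obtain ⟨X, hX⟩ := exists_side_of_isBipartite hH.isBipartite
  have : coverSums k H = boundedEdgeSums k H 0 := by
    ext c
    simp [mem_coverSums_iff_of_bipartite hX, boundedEdgeSums]
  rw [this]
  exact hasLinearQuotients_boundedEdgeSums hH k 0

theorem isAcyclic_pathGraph (r : ℕ) : (SimpleGraph.pathGraph r).IsAcyclic := by
  intro u c hc
  obtain ⟨v, hv, hmax⟩ := c.support.toFinset.exists_max_image id ⟨u, by simp⟩
  simp only [List.mem_toFinset, id] at hv hmax
  -- On the cycle rotated to its largest vertex `v`, both neighbours of `v` would be `v - 1`.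
  have hd := hc.rotate hv
  have hle (i : ℕ) : (c.rotate v hv).getVert i ≤ v :=
    hmax _ ((c.mem_support_rotate_iff v hv).1 ((c.rotate v hv).getVert_mem_support i))
  have hsnd : (c.rotate v hv).snd ≤ v := hle _
  have hpen : (c.rotate v hv).penultimate ≤ v := hle _
  have hadj := SimpleGraph.pathGraph_adj.1 ((c.rotate v hv).adj_snd hd.not_nil)
  have hadj' := SimpleGraph.pathGraph_adj.1 ((c.rotate v hv).adj_penultimate hd.not_nil)
  refine hd.snd_ne_penultimate (Fin.ext ?_)
  rw [Fin.le_def] at hsnd hpen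
  omega

theorem IsPathGraph.isAcyclic (hH : IsPathGraph H) : H.IsAcyclic := by
  obtain ⟨r, ⟨e⟩⟩ := hH
  exact e.isAcyclic_iff.2 (isAcyclic_pathGraph r)

end Forests

/-! ### Cohen–Macaulay graphs -/

section CohenMacaulay

open RingTheory.Sequence in
/-- Modulo a regular element `r₁ = a + b` with `a ∈ I`, `b ∈ J`, a second regular element
annihilates `a`; so `a = r₁ c`, and depending on whether `c` or `1 - c` is a unit, `r₁` lies in `I`
or in `J`, hence annihilates the other ideal. -/
theorem IsCohenMacaulayLocal.eq_bot_or_eq_bot_of_mul_eq_bot {R : Type*} [CommRing R]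
    [IsLocalRing R] (hR : IsCohenMacaulayLocal R) (hdim : 2 ≤ ringKrullDim R) {I J : Ideal R}
    (hm : IsLocalRing.maximalIdeal R ≤ I ⊔ J) (hIJ : I * J = ⊥) : I = ⊥ ∨ J = ⊥ := by
  obtain ⟨rs, hrs, hreg, hlen⟩ := hR
  have hlen2 : 2 ≤ rs.length := by
    rw [← hlen] at hdim
    exact_mod_cast hdim
  obtain ⟨r₁, r₂, rs, rfl⟩ : ∃ r₁ r₂ rs', rs = r₁ :: r₂ :: rs' := by
    match rs, hlen2 with
    | r₁ :: r₂ :: rs, _ => exact ⟨r₁, r₂, rs, rfl⟩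
  obtain ⟨h₁, h₂, -⟩ := by simpa only [isRegular_cons_iff] using hreg
  have hmul {x y : R} (hx : x ∈ I) (hy : y ∈ J) : x * y = 0 :=
    (Submodule.mem_bot R).1 (hIJ ▸ Ideal.mul_mem_mul hx hy)
  have hr₁ {z : R} (hz : r₁ * z = 0) : z = 0 := h₁ (by simpa using hz)
  obtain ⟨a, ha, b, hb, rfl⟩ := Submodule.mem_sup.1 (hm (hrs r₁ (by simp)))
  obtain ⟨a', ha', b', hb', rfl⟩ := Submodule.mem_sup.1 (hm (hrs r₂ (by simp)))
  obtain ⟨c, hc⟩ : ∃ c, (a + b) * c = a := by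
    have : Submodule.Quotient.mk a = (0 : QuotSMulTop (a + b) R) := by
      refine h₂ ?_
      simp only [← Submodule.Quotient.mk_smul, smul_zero, Submodule.Quotient.mk_eq_zero,
        smul_eq_mul]
      rw [show (a' + b') * a = (a + b) * a' by
        linear_combination hmul ha hb' - hmul ha' hb]
      exact Submodule.smul_mem_pointwise_smul _ _ _ trivial
    rw [Submodule.Quotient.mk_eq_zero, Submodule.mem_smul_pointwise_iff_exists] at this
    exact this.imp fun c hc => hc.2
  rcases IsLocalRing.isUnit_or_isUnit_one_sub_self c with hu | hu
  · have hbI : b ∈ I := by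
      rw [← I.unit_mul_mem_iff_mem hu, show c * b = (1 - c) * a by linear_combination hc]
      exact I.mul_mem_left _ ha
    exact .inr (J.eq_bot_iff.2 fun y hy => hr₁ (hmul (I.add_mem ha hbI) hy))
  · have haJ : a ∈ J := by
      rw [← J.unit_mul_mem_iff_mem hu, show (1 - c) * a = c * b by linear_combination -hc]
      exact J.mul_mem_left _ hb
    refine .inl (I.eq_bot_iff.2 fun x hx => hr₁ ?_)
    rw [mul_comm]
    exact hmul hx (J.add_mem haJ hb)

variable {σ K : Type*} [Field K] {H : SimpleGraph σ} {F T T' : Set σ}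

open MvPolynomial

open Classical in
/-- The endomorphism of the polynomial ring that sets the variables outside `T` to zero. -/
noncomputable def restrictVars (K : Type*) [Field K] (T : Set σ) :
    MvPolynomial σ K →ₐ[K] MvPolynomial σ K :=
  aeval (T.indicator X)

theorem restrictVars_X (T : Set σ) (v : σ) :
    restrictVars K T (X v) = T.indicator X v :=
  aeval_X _ v

theorem restrictVars_comp_restrictVars (h : T ⊆ T') :
    (restrictVars K T).comp (restrictVars K T') = restrictVars K T := by
  ext v
  by_cases hv : v ∈ T'
  · simp [restrictVars_X, hv]
  · simp [restrictVars_X, hv, Set.indicator_of_notMem fun hvT => hv (h hvT)]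

theorem sub_restrictVars_mem_span (T : Set σ) (f : MvPolynomial σ K) :
    f - restrictVars K T f ∈ Ideal.span (X '' Tᶜ : Set (MvPolynomial σ K)) := by
  rw [← Ideal.Quotient.eq]
  let π := Ideal.Quotient.mkₐ K (Ideal.span (X '' Tᶜ : Set (MvPolynomial σ K)))
  suffices π = π.comp (restrictVars K T) from DFunLike.congr_fun this f
  ext v
  by_cases hv : v ∈ T
  · simp [restrictVars_X, hv]
  · simp only [AlgHom.comp_apply, restrictVars_X, Set.indicator_of_notMem hv, map_zero]
    exact Ideal.Quotient.eq_zero_iff_mem.2 (Ideal.subset_span ⟨v, hv, rfl⟩)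

theorem edgeIdeal_le_ker_restrictVars (hT : H.IsIndepSet T) :
    edgeIdeal K H ≤ RingHom.ker (restrictVars K T) := by
  refine Ideal.span_le.2 ?_
  rintro _ ⟨a, b, hab, rfl⟩
  rw [SetLike.mem_coe, RingHom.mem_ker, map_mul, restrictVars_X, restrictVars_X]
  by_cases ha : a ∈ T
  · rw [Set.indicator_of_notMem fun hb => hT ha hb hab.ne hab, mul_zero]
  · rw [Set.indicator_of_notMem ha, zero_mul]

/-- The ideal generated by the variables outside the independent set `T` in the edge ring of `H`,
encoded as the kernel of the map that sets these variables to zero. -/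
noncomputable def indepPrime (K : Type*) [Field K] (hT : H.IsIndepSet T) :
    Ideal (MvPolynomial σ K ⧸ edgeIdeal K H) :=
  RingHom.ker (Ideal.Quotient.lift (edgeIdeal K H) (restrictVars K T).toRingHom
    fun _ hf => edgeIdeal_le_ker_restrictVars hT hf)

instance isPrime_indepPrime (hT : H.IsIndepSet T) : (indepPrime K hT).IsPrime :=
  RingHom.ker_isPrime _

theorem mk_mem_indepPrime {hT : H.IsIndepSet T} {f : MvPolynomial σ K} :
    Ideal.Quotient.mk (edgeIdeal K H) f ∈ indepPrime K hT ↔ restrictVars K T f = 0 :=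
  Iff.rfl

theorem mk_X_mem_indepPrime {hT : H.IsIndepSet T} {v : σ} :
    Ideal.Quotient.mk (edgeIdeal K H) (X v) ∈ indepPrime K hT ↔ v ∉ T := by
  rw [mk_mem_indepPrime, restrictVars_X]
  simp [X_ne_zero]

theorem indepPrime_anti {hT : H.IsIndepSet T} {hT' : H.IsIndepSet T'} (h : T ⊆ T') :
    indepPrime K hT' ≤ indepPrime K hT := by
  intro p hp
  obtain ⟨f, rfl⟩ := Ideal.Quotient.mk_surjective p
  rw [mk_mem_indepPrime] at hp ⊢
  rw [← restrictVars_comp_restrictVars h, AlgHom.comp_apply, hp, map_zero]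

theorem height_indepPrime_add_one_le {hT : H.IsIndepSet T} {hT' : H.IsIndepSet T'} (h : T ⊂ T') :
    (indepPrime K hT').height + 1 ≤ (indepPrime K hT).height := by
  obtain ⟨v, hvT', hvT⟩ := Set.exists_of_ssubset h
  refine Ideal.height_add_one_le_of_lt_of_isPrime
    ((indepPrime_anti h.subset).lt_of_not_ge fun hle => ?_)
  exact mk_X_mem_indepPrime.1 (hle (mk_X_mem_indepPrime.2 hvT)) hvT'

/-- The vertices of the link of `F` in the independence complex of `H`. -/
def linkVertices (H : SimpleGraph σ) (F : Set σ) : Set σ :=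
  {v | v ∉ F ∧ ∀ u ∈ F, ¬ H.Adj u v}

theorem isIndepSet_insert {v : σ} (hF : H.IsIndepSet F) (hv : v ∈ linkVertices H F) :
    H.IsIndepSet (insert v F) := by
  have : Std.Symm fun v w => ¬ H.Adj v w := ⟨fun _ _ h h' => h h'.symm⟩
  exact hF.insert_of_symm fun u hu _ h => hv.2 u hu h.symm

variable (hF : H.IsIndepSet F)

/-- The image of the variable `x_v` in the localization of the edge ring at the prime of the
independent set `F`. -/
noncomputable def localVar (K : Type*) [Field K] (v : σ) :
    Localization.AtPrime (indepPrime K hF) :=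
  algebraMap _ _ (Ideal.Quotient.mk (edgeIdeal K H) (X v))

theorem localVar_mul_localVar_of_adj {u v : σ} (huv : H.Adj u v) :
    localVar hF K u * localVar hF K v = 0 := by
  have : (X u * X v : MvPolynomial σ K) ∈ edgeIdeal K H := Ideal.subset_span ⟨u, v, huv, rfl⟩
  rw [localVar, localVar, ← map_mul, ← map_mul, Ideal.Quotient.eq_zero_iff_mem.2 this, map_zero]

theorem isUnit_localVar {v : σ} (hv : v ∈ F) : IsUnit (localVar hF K v) :=
  IsLocalization.map_units _
    (⟨_, fun h => mk_X_mem_indepPrime.1 h hv⟩ : (indepPrime K hF).primeCompl)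

theorem localVar_ne_zero {v : σ} (hv : v ∈ linkVertices H F) : localVar hF K v ≠ 0 := by
  intro h0
  obtain ⟨s, hs⟩ := (IsLocalization.map_eq_zero_iff (indepPrime K hF).primeCompl _ _).1 h0
  have hmem : (s : MvPolynomial σ K ⧸ edgeIdeal K H) * Ideal.Quotient.mk _ (X v) ∈
      indepPrime K (isIndepSet_insert hF hv) := by
    rw [hs]
    exact Ideal.zero_mem _
  rcases (isPrime_indepPrime _).mem_or_mem hmem with h | h
  · exact s.2 (indepPrime_anti (Set.subset_insert _ _) h)
  · exact mk_X_mem_indepPrime.1 h (Set.mem_insert _ _)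

theorem maximalIdeal_le_span_localVar :
    IsLocalRing.maximalIdeal (Localization.AtPrime (indepPrime K hF)) ≤
      Ideal.span (localVar hF K '' linkVertices H F) := by
  rw [← Localization.AtPrime.map_eq_maximalIdeal, Ideal.map_le_iff_le_comap]
  intro p hp
  obtain ⟨f, rfl⟩ := Ideal.Quotient.mk_surjective p
  have hf := sub_restrictVars_mem_span F f
  rw [mk_mem_indepPrime.1 hp, sub_zero] at hf
  suffices Ideal.span (X '' Fᶜ : Set (MvPolynomial σ K)) ≤
      Ideal.comap ((algebraMap _ (Localization.AtPrime (indepPrime K hF))).comp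
        (Ideal.Quotient.mk (edgeIdeal K H))) (Ideal.span (localVar hF K '' linkVertices H F)) from
    this hf
  refine Ideal.span_le.2 ?_
  rintro _ ⟨v, hv, rfl⟩
  change localVar hF K v ∈ Ideal.span _
  by_cases hlink : ∀ u ∈ F, ¬ H.Adj u v
  · exact Ideal.subset_span ⟨v, ⟨hv, hlink⟩, rfl⟩
  · push Not at hlink
    obtain ⟨u, hu, huv⟩ := hlink
    rw [(isUnit_localVar hF hu).mul_right_eq_zero.1 (localVar_mul_localVar_of_adj hF huv)]
    exact Ideal.zero_mem _

theorem two_le_ringKrullDim_localization {a₁ a₂ : σ} (h₁ : a₁ ∈ linkVertices H F)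
    (h₂ : a₂ ∈ linkVertices H F) (hne : a₁ ≠ a₂) (hadj : ¬ H.Adj a₁ a₂) :
    2 ≤ ringKrullDim (Localization.AtPrime (indepPrime K hF)) := by
  have hF₁ := isIndepSet_insert hF h₁
  have h₂' : a₂ ∈ linkVertices H (insert a₁ F) := by grind [linkVertices]
  have hlt₁ := height_indepPrime_add_one_le (K := K) (hT := hF) (hT' := hF₁)
    (Set.ssubset_insert h₁.1)
  have hlt₂ := height_indepPrime_add_one_le (K := K) (hT := hF₁)
    (hT' := isIndepSet_insert hF₁ h₂') (Set.ssubset_insert h₂'.1)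
  rw [IsLocalization.AtPrime.ringKrullDim_eq_height (indepPrime K hF)
    (Localization.AtPrime (indepPrime K hF))]
  refine WithBot.coe_le_coe.2 ?_
  calc (2 : ℕ∞) = 1 + 1 := one_add_one_eq_two.symm
    _ ≤ (indepPrime K hF₁).height + 1 := by gcongr; exact le_add_self.trans hlt₂
    _ ≤ (indepPrime K hF).height := hlt₁

theorem IsCohenMacaulayGraph.isClique_of_join (hH : IsCohenMacaulayGraph K H)
    (hF : H.IsIndepSet F) {A B : Set σ}
    (hlink : linkVertices H F = A ∪ B) (hAB : ∀ a ∈ A, ∀ b ∈ B, H.Adj a b)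
    (hB : B.Nonempty) : H.IsClique A := by
  intro a₁ ha₁ a₂ ha₂ hne
  by_contra hadj
  have hA : A ⊆ linkVertices H F := hlink ▸ Set.subset_union_left
  have hB' : B ⊆ linkVertices H F := hlink ▸ Set.subset_union_right
  obtain ⟨b, hb⟩ := hB
  have hspan := maximalIdeal_le_span_localVar (K := K) hF
  rw [hlink, Set.image_union, Ideal.span_union] at hspan
  have hmul : Ideal.span (localVar hF K '' A) * Ideal.span (localVar hF K '' B) = ⊥ := by
    rw [Ideal.span_mul_span', ← le_bot_iff, Ideal.span_le]
    rintro _ ⟨_, ⟨a, ha, rfl⟩, _, ⟨b, hb, rfl⟩, rfl⟩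
    exact localVar_mul_localVar_of_adj hF (hAB a ha b hb)
  rcases (hH (indepPrime K hF)).eq_bot_or_eq_bot_of_mul_eq_bot
    (two_le_ringKrullDim_localization hF (hA ha₁) (hA ha₂) hne hadj) hspan hmul with h | h
  · exact localVar_ne_zero hF (hA ha₁) (Ideal.span_eq_bot.1 h _ ⟨a₁, ha₁, rfl⟩)
  · exact localVar_ne_zero hF (hB' hb) (Ideal.span_eq_bot.1 h _ ⟨b, hb, rfl⟩)

end CohenMacaulay

/-! ### Cohen–Macaulay bipartite graphs -/

section Bipartite

variable {σ K : Type*} [Field K] {H : SimpleGraph σ} {k : ℕ} {X : Set σ} {c c' : σ → ℕ}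

theorem exists_adj_add_eq_of_mem_minElts_coverSums (hX : ∀ u v, H.Adj u v → (u ∈ X ↔ v ∉ X))
    (hc : c ∈ minElts (coverSums k H)) {v : σ} (hv : 0 < c v) :
    ∃ u, H.Adj v u ∧ c v + c u = k := by
  classical
  by_contra! hne
  have hcover := (mem_coverSums_iff_of_bipartite hX).1 hc.1
  have hmem : Function.update c v (c v - 1) ∈ coverSums k H := by
    rw [mem_coverSums_iff_of_bipartite hX]
    intro x y hxy
    grind [Function.update_apply, H.ne_of_adj hxy, hxy.symm]
  have := congrFun (hc.eq_of_le hmem (update_le_self_iff.2 (Nat.sub_le _ _))) v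
  rw [Function.update_self] at this
  omega

theorem eq_of_eqOn_of_mem_minElts_coverSums (hX : ∀ u v, H.Adj u v → (u ∈ X ↔ v ∉ X))
    (hc : c ∈ minElts (coverSums k H)) (hc' : c' ∈ minElts (coverSums k H))
    (h : Set.EqOn c c' X) : c = c' := by
  refine hc'.eq_of_le hc.1 fun y => ?_
  by_cases hy : y ∈ X
  · exact (h hy).le
  obtain h0 | h0 := Nat.eq_zero_or_pos (c y)
  · exact h0.trans_le (Nat.zero_le _)
  · obtain ⟨u, hyu, hk⟩ := exists_adj_add_eq_of_mem_minElts_coverSums hX hc h0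
    have hu := h (by_contra fun hu => hy ((hX y u hyu).2 hu))
    have hle := le_add_of_mem_coverSums hc'.1 hyu
    exact Nat.le_of_add_le_add_right (by rwa [hk, hu])

theorem IsCohenMacaulayGraph.exists_existsUnique_adj [Finite σ] (hH : IsCohenMacaulayGraph K H)
    (hX : ∀ u v, H.Adj u v → (u ∈ X ↔ v ∉ X)) {S E : Set σ} (hS : Maximal H.IsIndepSet S)
    (hES : E ⊆ S) (hE : ∃ y, y ∉ X ∧ y ∉ S ∧ ∀ x ∈ E, ¬ H.Adj x y) :
    ∃ y, y ∉ X ∧ y ∉ S ∧ (∀ x ∈ E, ¬ H.Adj x y) ∧ ∃! x, x ∈ S ∧ H.Adj x y := by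
  let N (y : σ) : Set σ := {x | x ∈ S ∧ H.Adj x y}
  have hN {v : σ} (hv : v ∉ S) : (N v).Nonempty := by
    by_contra! hempty
    refine hv (hS.mem_of_prop_insert (isIndepSet_insert hS.prop ⟨hv, fun u hu huv => ?_⟩))
    exact Set.notMem_empty u (hempty ▸ ⟨hu, huv⟩)
  obtain ⟨y, ⟨hyX, hyS, hyE⟩, hmin⟩ := Set.Finite.exists_minimalFor N
    {y | y ∉ X ∧ y ∉ S ∧ ∀ x ∈ E, ¬ H.Adj x y} (Set.toFinite _) hE
  refine ⟨y, hyX, hyS, hyE, ?_⟩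
  have hF : H.IsIndepSet (S \ N y) := hS.prop.mono Set.sdiff_subset
  have hlink : linkVertices H (S \ N y) = N y ∪ {v | v ∉ X ∧ v ∉ S ∧ N v = N y} := by
    ext v
    simp only [linkVertices, Set.mem_union, Set.mem_ofPred_eq, Set.mem_sdiff]
    constructor
    · rintro ⟨hvF, hadj⟩
      have hsub : N v ⊆ N y := fun x hx => by_contra fun hxy => hadj x ⟨hx.1, hxy⟩ hx.2
      by_cases hvS : v ∈ S
      · exact .inl (by grind)
      · obtain ⟨x, hx⟩ := hN hvS
        have hvX : v ∉ X := by grind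
        exact .inr ⟨hvX, hvS, hsub.antisymm (hmin ⟨hvX, hvS, by grind⟩ hsub)⟩
    · rintro (hv | hv)
      · exact ⟨fun h => h.2 hv, fun u hu huv => hS.prop hu.1 hv.1 huv.ne huv⟩
      · exact ⟨fun h => hv.2.1 h.1, fun u hu huv => hu.2 (hv.2.2 ▸ ⟨hu.1, huv⟩)⟩
  have hclique := hH.isClique_of_join hF hlink (fun a ha b hb => (hb.2.2 ▸ ha : a ∈ N b).2)
    ⟨y, hyX, hyS, rfl⟩
  obtain ⟨x, hx⟩ := hN hyS
  refine ⟨x, hx, fun x' hx' => by_contra fun hne => ?_⟩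
  exact hS.prop hx'.1 hx.1 hne (hclique hx' hx hne)

theorem maximal_isIndepSet_threshold (hX : ∀ u v, H.Adj u v → (u ∈ X ↔ v ∉ X))
    (hc : c ∈ minElts (coverSums k H)) {j : ℕ} (hj : j < k) :
    Maximal H.IsIndepSet {v | (v ∈ X → c v ≤ j) ∧ (v ∉ X → j + c v < k)} := by
  have hcover {u v : σ} (huv : H.Adj u v) := le_add_of_mem_coverSums hc.1 huv
  refine ⟨fun u hu v hv _ huv => ?_, fun T hT hle v hv => ?_⟩
  · grind [hcover huv]
  · by_contra hvS
    have hpos : 0 < c v := by grind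
    obtain ⟨u, hvu, hk⟩ := exists_adj_add_eq_of_mem_minElts_coverSums hX hc hpos
    exact hT hv (hle (by grind)) hvu.ne hvu

theorem IsCohenMacaulayGraph.exists_adj_of_lt [Finite σ] (hH : IsCohenMacaulayGraph K H)
    (hX : ∀ u v, H.Adj u v → (u ∈ X ↔ v ∉ X)) (hc : c ∈ minElts (coverSums k H))
    (hc' : c' ∈ minElts (coverSums k H)) (hlt : ∃ x ∈ X, c x < c' x) :
    ∃ x ∈ X, ∃ y, c x < c' x ∧ H.Adj x y ∧ 0 < c y ∧
      ∀ x', H.Adj x' y → x' ≠ x → k < c x' + c y := by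
  obtain ⟨x₀, hx₀, hlt⟩ := hlt
  have hjk : c x₀ < k := hlt.trans_le (le_of_mem_minElts_coverSums hc' x₀)
  obtain ⟨y₀, hxy₀, htight⟩ :=
    exists_adj_add_eq_of_mem_minElts_coverSums hX hc' (Nat.zero_lt_of_lt hlt)
  obtain ⟨y, hyX, hyS, hyE, x, ⟨hxS, hxy⟩, huniq⟩ := hH.exists_existsUnique_adj hX
    (maximal_isIndepSet_threshold hX hc hjk) (E := {x | x ∈ X ∧ c x ≤ c x₀ ∧ c' x ≤ c x₀})
    (by grind) ⟨y₀, (hX _ _ hxy₀).1 hx₀,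
      by grind [le_add_of_mem_coverSums hc.1 hxy₀], fun x hx hxy => by
        grind [le_add_of_mem_coverSums hc'.1 hxy]⟩
  have hxX : x ∈ X := (hX x y hxy).2 hyX
  refine ⟨x, hxX, y, by grind, hxy, by grind, fun x' hx'y hne => ?_⟩
  have hx'X : x' ∈ X := (hX x' y hx'y).2 hyX
  grind

variable [DecidableEq σ] {x y : σ} (hX : ∀ u v, H.Adj u v → (u ∈ X ↔ v ∉ X)) (hxy : H.Adj x y)
  (hy : 0 < c y) (hother : ∀ x', H.Adj x' y → x' ≠ x → k < c x' + c y)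

include hX hxy hy hother

theorem exchange_mem_coverSums (hc : c ∈ coverSums k H) : exchange c y x ∈ coverSums k H := by
  rw [mem_coverSums_iff_of_bipartite hX] at hc ⊢
  intro u v huv
  simp only [exchange_apply hxy.ne']
  grind [hc u v huv, huv.ne, huv.symm]

theorem le_of_le_exchange (hc : c ∈ minElts (coverSums k H)) (hxX : x ∈ X) {g : σ → ℕ}
    (hg : g ∈ coverSums k H) (hle : g ≤ exchange c y x) : c x < g x ∧ ∀ v ∈ X, c v ≤ g v := by
  have hle' (v : σ) := (hle v).trans_eq (exchange_apply hxy.ne' v)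
  have hgsum {u v : σ} (huv : H.Adj u v) := le_add_of_mem_coverSums hg huv
  have htight {v : σ} := exists_adj_add_eq_of_mem_minElts_coverSums hX hc (v := v)
  have hlt : c x < g x := by
    obtain ⟨u, hyu, hk⟩ := htight hy
    grind [hle' y, hgsum hxy, hyu.symm]
  refine ⟨hlt, fun v hv => ?_⟩
  obtain h0 | h0 := Nat.eq_zero_or_pos (c v)
  · omega
  · obtain ⟨u, hvu, hk⟩ := htight h0
    grind [hle' u, hgsum hvu]

omit hX hxy hy hother [DecidableEq σ]

theorem hasLinearQuotients_coverSums_of_isCohenMacaulayGraph [Finite σ]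
    (hH : IsCohenMacaulayGraph K H) (hb : H.IsBipartite) (k : ℕ) :
    HasLinearQuotients (coverSums k H) := by
  classical
  have := Fintype.ofFinite σ
  obtain ⟨X, hX⟩ := exists_side_of_isBipartite hb
  have hkey : IsLinearQuotientsKey (fun c => OrderDual.toDual (∑ x with x ∈ X, c x))
      (minElts (coverSums k H)) := by
    intro c hc c' hc' hne hle
    have hlt : ∃ x ∈ X, c x < c' x := by
      by_contra! hge
      have hsum := (Finset.sum_eq_sum_iff_of_le fun x hx => hge x (Finset.mem_filter.1 hx).2).1
        (le_antisymm (Finset.sum_le_sum fun x hx => hge x (Finset.mem_filter.1 hx).2) hle)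
      exact hne (eq_of_eqOn_of_mem_minElts_coverSums hX hc' hc fun x hx => hsum x (by simp [hx]))
    obtain ⟨x, hxX, y, hlt, hxy, hy, hother⟩ := hH.exists_adj_of_lt hX hc hc' hlt
    obtain ⟨g, hg, hle⟩ := exists_mem_minElts_le (exchange_mem_coverSums hX hxy hy hother hc.1)
    obtain ⟨hxg, hcg⟩ := le_of_le_exchange hX hxy hy hother hc hxX hg.1 hle
    refine ⟨x, hlt, g, hg, ?_, (leAddSingle_exchange c y x).of_le_left hle⟩
    exact OrderDual.toDual_lt_toDual.2 (Finset.sum_lt_sum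
      (fun v hv => hcg v (Finset.mem_filter.1 hv).2) ⟨x, by simp [hxX], hxg⟩)
  exact hkey.hasLinearQuotientsOrder (finite_minElts _)

end Bipartite

/-! ### Cameron–Walker graphs -/

section EmptyFibres

theorem HasLinearQuotients.fiberedSet_singleton {V τ : Type*} [Finite V] [Finite τ]
    {U : Set (τ → ℕ)} (hU : HasLinearQuotients U) (l : V → ℕ) :
    HasLinearQuotients (fiberedSet {l} fun _ => U) := by
  classical
  have hF : IsFiberedFamily {l} fun _ => U :=
    { add_single_mem := by grind
      mono := fun _ _ _ _ _ => subset_rfl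
      exists_lt := by simp +contextual }
  exact hF.hasLinearQuotients fun _ _ => hU

theorem mem_shiftedCoverSums_of_isEmpty {τ : Type*} [IsEmpty τ] (H : SimpleGraph τ) (k n : ℕ)
    (s : τ → ℕ) : s ∈ shiftedCoverSums k n H :=
  ⟨0, ⟨fun _ => Set.univ, fun _ _ _ _ => .inl trivial, fun w => isEmptyElim w⟩,
    fun w => isEmptyElim w⟩

variable {V : Type*} {W : V → Type*}

open Classical in
/-- The vertices of `attach G H`, rearranged so that the vertices `v` with `W v` empty appear on the
side of the fibres. -/
noncomputable def attachEquivOfIsEmpty (W : V → Type*) :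
    (V ⊕ Σ v, W v) ≃ {v // Nonempty (W v)} ⊕ {v // ¬ Nonempty (W v)} ⊕
      Σ v : {v // Nonempty (W v)}, W v :=
  ((Equiv.sumCompl fun v => Nonempty (W v)).symm.sumCongr
    (Equiv.sigmaSubtypeEquivOfSubset W _ fun _ => Nonempty.intro).symm).trans
    (Equiv.sumAssoc _ _ _)

variable {G : SimpleGraph V} {X : Set V} {H : ∀ v, SimpleGraph (W v)} {k : ℕ}

theorem mem_coverSums_attach_iff_of_isEmpty (hX : ∀ u v, G.Adj u v → (u ∈ X ↔ v ∉ X))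
    (hG : ∀ u v, G.Adj u v → Nonempty (W u) ∨ Nonempty (W v)) {t : (V ⊕ Σ v, W v) → ℕ} :
    t ∈ coverSums k (attach G H) ↔ ∃ a : {v // Nonempty (W v)} → ℕ,
      ((∀ v, a v ≤ k) ∧ ∀ u v : {v // Nonempty (W v)}, G.Adj u v → k ≤ a u + a v) ∧
      (∀ v, a v ≤ t (.inl v)) ∧
      (∀ (u : {v // Nonempty (W v)}) (v : {v // ¬ Nonempty (W v)}), G.Adj u v →
        k ≤ a u + t (.inl v)) ∧
      ∀ v, (fun w => t (.inr ⟨v, w⟩)) ∈ shiftedCoverSums k (a v) (H v) := by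
  classical
  constructor
  · intro ht
    obtain ⟨a, ⟨haG, hak⟩, hat, hfib⟩ := exists_mem_shiftedCoverSums_of_mem_coverSums_attach ht
    exact ⟨fun v => a v, ⟨fun v => hak v, fun u v huv => le_add_of_mem_coverSums haG huv⟩,
      fun v => hat v,
      fun u v huv => (le_add_of_mem_coverSums haG huv).trans (Nat.add_le_add_left (hat v) _),
      fun v => hfib v⟩
  · rintro ⟨a, ⟨hak, haG⟩, hat, hempty, hfib⟩
    refine mem_coverSums_attach_of_mem_shiftedCoverSums
      (a := fun v => if h : Nonempty (W v) then a ⟨v, h⟩ else min (t (.inl v)) k)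
      ((mem_coverSums_iff_of_bipartite hX).2 fun u v huv => ?_) (fun v => ?_) (fun v => ?_)
      fun v => ?_
    · have hu := hG u v huv
      have := huv.symm
      have := hat
      split_ifs with hu hv hv
      · exact haG _ _ huv
      · have := hempty ⟨u, hu⟩ ⟨v, hv⟩ huv
        grind
      · have := hempty ⟨v, hv⟩ ⟨u, hu⟩ huv.symm
        grind
      · grind
    · grind
    · grind
    · split_ifs with hv
      · exact hfib ⟨v, hv⟩
      · have := not_nonempty_iff.1 hv
        exact mem_shiftedCoverSums_of_isEmpty _ _ _ _

/-- The part of an exponent vector in `coverSums k (attach G H)` that lies over its restriction `a`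
to the vertices `v` with `W v` nonempty. -/
def emptyFibreSet (G : SimpleGraph V) (H : ∀ v, SimpleGraph (W v)) (k : ℕ)
    (a : {v // Nonempty (W v)} → ℕ) :
    Set ({v // ¬ Nonempty (W v)} ⊕ (Σ v : {v // Nonempty (W v)}, W v) → ℕ) :=
  {s | (∀ (u : {v // Nonempty (W v)}) (v : {v // ¬ Nonempty (W v)}), G.Adj u v →
      k ≤ a u + s (.inl v)) ∧
    s ∘ Sum.inr ∈ sigmaSet fun v : {v // Nonempty (W v)} => shiftedCoverSums k (a v) (H v)}

theorem isFiberedFamily_emptyFibreSet [DecidableEq {v // Nonempty (W v)}] (G : SimpleGraph V)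
    (H : ∀ v, SimpleGraph (W v)) (k : ℕ) :
    IsFiberedFamily {a : {v // Nonempty (W v)} → ℕ |
      (∀ v, a v ≤ k) ∧ ∀ u v : {v // Nonempty (W v)}, G.Adj u v → k ≤ a u + a v}
      (emptyFibreSet G H k) := by
  have hmono : ∀ a b : {v // Nonempty (W v)} → ℕ, (∀ v, b v ≤ k) → a ≤ b →
      emptyFibreSet G H k a ⊆ emptyFibreSet G H k b := fun a b hb hab s hs =>
    ⟨fun u v huv => (hs.1 u v huv).trans (Nat.add_le_add_right (hab u) _),
      fun v => shiftedCoverSums_mono (hab v) (hb v) (hs.2 v)⟩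
  refine ⟨fun a ha b hb v hv => ⟨fun u => ?_, fun u w huw => ?_⟩,
    fun a _ b hb => hmono a b hb.1, fun a _ v hav s hs => ?_⟩
  · rcases eq_or_ne u v with rfl | hu
    · simpa using hv.trans_le (hb.1 u)
    · simpa [hu] using ha.1 u
  · exact (ha.2 u w huw).trans (Nat.add_le_add (Nat.le_add_right _ _) (Nat.le_add_right _ _))
  · have hlt : a v < k := by simpa using hav.1 v
    obtain ⟨r, hr, hrs⟩ := exists_lt_mem_shiftedCoverSums hlt v.2.some (hs.2 v)
    have hs' := hmono a _ hav.1 le_self_add hs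
    refine ⟨Sum.elim (s ∘ Sum.inl) (updateBlock (s ∘ Sum.inr) v r),
      ⟨hs'.1, updateBlock_mem_sigmaSet hs'.2 (by simpa using hr)⟩, ?_⟩
    rw [← Sum.elim_comp_inl_inr s]
    refine lt_of_le_of_ne (Sum.elim_le_elim_iff.2 ⟨le_rfl, updateBlock_le hrs.le⟩)
      fun h => hrs.ne (funext fun w => ?_)
    rw [← updateBlock_same (s ∘ Sum.inr) v r w]
    exact congrFun h (.inr ⟨v, w⟩)

theorem hasLinearQuotients_emptyFibreSet [Finite V] [∀ v, Finite (W v)] {G : SimpleGraph V}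
    {H : ∀ v, SimpleGraph (W v)} (h : ∀ v n, HasLinearQuotients (coverSums n (H v))) (k : ℕ)
    (a : {v // Nonempty (W v)} → ℕ) : HasLinearQuotients (emptyFibreSet G H k a) := by
  classical
  have := Fintype.ofFinite {v // Nonempty (W v)}
  convert HasLinearQuotients.fiberedSet_singleton
    (.sigmaSet fun v : {v // Nonempty (W v)} => (h v (a v)).shiftedCoverSums k)
    fun v : {v // ¬ Nonempty (W v)} =>
      Finset.univ.sup fun u : {v // Nonempty (W v)} => if G.Adj u v then k - a u else 0 using 1
  ext s
  simp only [fiberedSet, emptyFibreSet, Set.mem_singleton_iff, exists_eq_left, Pi.le_def,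
    Finset.sup_le_iff, Set.mem_ofPred_eq, Function.comp_apply, Finset.mem_univ, true_imp_iff]
  refine and_congr_left' ⟨fun hs v u => ?_, fun hs u v huv => ?_⟩
  · split_ifs with huv
    · exact Nat.sub_le_iff_le_add'.2 (hs u v huv)
    · exact Nat.zero_le _
  · exact Nat.sub_le_iff_le_add'.1 (by simpa [huv] using hs v u)

theorem hasLinearQuotients_coverSums_attach_of_isEmpty [Finite V] [∀ v, Finite (W v)]
    (hX : ∀ u v, G.Adj u v → (u ∈ X ↔ v ∉ X))
    (hG : ∀ u v, G.Adj u v → Nonempty (W u) ∨ Nonempty (W v))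
    (h : ∀ v n, HasLinearQuotients (coverSums n (H v))) (k : ℕ) :
    HasLinearQuotients (coverSums k (attach G H)) := by
  classical
  convert ((isFiberedFamily_emptyFibreSet G H k).hasLinearQuotients fun a _ =>
    hasLinearQuotients_emptyFibreSet h k a).comp_equiv (attachEquivOfIsEmpty W) using 1
  ext t
  rw [mem_coverSums_attach_iff_of_isEmpty hX hG]
  rfl

end EmptyFibres

section CameronWalker

variable {σ : Type*} {H : SimpleGraph σ}

theorem isAcyclic_of_subsingleton_neighborSet (h : ∀ v, (H.neighborSet v).Subsingleton) :
    H.IsAcyclic := fun v _ hc =>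
  hc.snd_ne_penultimate (h v (SimpleGraph.Walk.adj_snd hc.not_nil)
    (SimpleGraph.Walk.adj_penultimate hc.not_nil).symm)

variable {B : Set σ}

open Classical in
/-- A graph in which every vertex `w` outside `B` has exactly one neighbour `f w` in `B`, and in
which adjacent vertices outside `B` share this neighbour, is obtained from the induced graph on `B`
by attaching the induced graphs on the fibres of `f`. -/
noncomputable def attachIso (f : {w // w ∉ B} → {v // v ∈ B})
    (hf : ∀ (w : {w // w ∉ B}) (v : {v // v ∈ B}), H.Adj v w ↔ f w = v)
    (hadj : ∀ w w' : {w // w ∉ B}, H.Adj w w' → f w = f w') :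
    attach (H.comap ((↑) : {v // v ∈ B} → σ))
      (fun v => H.comap fun w : {w // f w = v} => (w : σ)) ≃g H where
  toEquiv := ((Equiv.refl _).sumCongr (Equiv.sigmaFiberEquiv f)).trans (Equiv.sumCompl (· ∈ B))
  map_rel_iff' := by
    rintro (v | ⟨v, w, hw⟩) (v' | ⟨v', w', hw'⟩)
    · exact ⟨fun h => .base h, fun | .base h => h⟩
    · constructor
      · intro h
        obtain rfl : v' = v := hw'.symm.trans ((hf w' v).1 h)
        exact .up (W := fun v => {w // f w = v}) v' ⟨w', hw'⟩
      · rintro ⟨⟩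
        exact (hf w' v).2 hw'
    · constructor
      · intro h
        obtain rfl : v = v' := hw.symm.trans ((hf w v').1 h.symm)
        exact .down (W := fun v => {w // f w = v}) v ⟨w, hw⟩
      · rintro ⟨⟩
        exact ((hf w v).2 hw).symm
    · constructor
      · intro h
        obtain rfl : v = v' := hw.symm.trans ((hadj w w' h).trans hw')
        exact .fiber (W := fun v => {w // f w = v}) h
      · rintro (h | h)
        exact h

variable {X Y : Set σ}

theorem IsCameronWalkerOn.exists_outer (hH : IsCameronWalkerOn H X Y) {w : σ} (hw : w ∉ X ∪ Y) :
    ∃ b ∈ X ∪ Y, (∀ v ∈ X ∪ Y, H.Adj v w ↔ b = v) ∧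
      (∀ u ∉ X ∪ Y, H.Adj w u → H.Adj b u) ∧ (H.neighborSet w \ (X ∪ Y)).Subsingleton := by
  rcases hH.rest w hw with ⟨x, hx, hl⟩ | ⟨y, hy, v', hv', hl⟩
  · refine ⟨x, .inl hx, ?_, ?_, ?_⟩
    · grind [IsLeafAt, H.adj_comm]
    · grind [IsLeafAt]
    · intro u _ v _
      grind [IsLeafAt, H.mem_neighborSet]
  · refine ⟨y, .inr hy, ?_, ?_, ?_⟩
    · grind [IsPendantTriangleAt, H.adj_comm]
    · grind [IsPendantTriangleAt, H.adj_comm]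
    · intro u _ v _
      grind [IsPendantTriangleAt, H.mem_neighborSet]

theorem IsCameronWalkerOn.hasLinearQuotients_coverSums [Finite σ] (hH : IsCameronWalkerOn H X Y)
    (k : ℕ) : HasLinearQuotients (coverSums k H) := by
  choose! f hfB hf hfadj hsub using fun w (hw : w ∉ X ∪ Y) => hH.exists_outer hw
  let f' (w : {w // w ∉ X ∪ Y}) : {v // v ∈ X ∪ Y} := ⟨f w, hfB w w.2⟩
  refine .coverSums_of_iso (attachIso f' (fun w v => ?_) fun w w' hww' => ?_).symm ?_
  · rw [hf w w.2 v v.2, Subtype.ext_iff]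
  · exact Subtype.ext ((hf w' w'.2 _ (hfB w w.2)).1 (hfadj w w.2 w' w'.2 hww')).symm
  refine hasLinearQuotients_coverSums_attach_of_isEmpty (X := {v | (v : σ) ∈ X})
    (W := fun v => {w // f' w = v}) (fun u v huv => ?_)
    (fun u v huv => ?_) (fun v n => ?_) k
  · exact ⟨fun hu hv => hH.indep_left _ hu _ hv huv, fun hv => by_contra fun hu =>
      hH.indep_right _ (u.2.resolve_left hu) _ (v.2.resolve_left hv) huv⟩
  · have hleaf (x : {v // v ∈ X ∪ Y}) (hx : (x : σ) ∈ X) : Nonempty {w // f' w = x} := by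
      obtain ⟨w, hw, hwx⟩ := hH.exists_leaf x hx
      exact ⟨⟨w, hw⟩, Subtype.ext ((hf w hw x x.2).1 ((hwx x).2 rfl).symm)⟩
    rcases u.2 with hu | hu
    · exact .inl (hleaf u hu)
    · exact .inr (hleaf v (v.2.resolve_right fun hv => hH.indep_right _ hu _ hv huv))
  · refine hasLinearQuotients_coverSums_of_isAcyclic
      (isAcyclic_of_subsingleton_neighborSet fun w w₁ h₁ w₂ h₂ => ?_) n
    exact Subtype.ext (Subtype.ext (hsub w w.1.2 ⟨h₁, w₁.1.2⟩ ⟨h₂, w₂.1.2⟩))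

end CameronWalker

end CoverPowers

theorem mainTheorem6_general {K : Type*} [Field K] {V : Type*} [Finite V] (G : SimpleGraph V)
    {W : V → Type*} [∀ v, Finite (W v)] [∀ v, Nonempty (W v)] (H : ∀ v, SimpleGraph (W v))
    (hH : ∀ v,
      (CoverPowers.IsUnmixed (H v) ∧ CoverPowers.IsChordal (H v)) ∨
      (CoverPowers.IsCohenMacaulayGraph K (H v) ∧ (H v).IsBipartite) ∨
      (H v).IsAcyclic ∨
      ∃ X Y, CoverPowers.IsCameronWalkerOn (H v) X Y)
    (k : ℕ) :
    CoverPowers.HasLinearQuotientsOnMinGens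
        (CoverPowers.coverIdeal K (CoverPowers.attach G H) ^ k) ∧
      CoverPowers.IsComponentwiseLinear
        (CoverPowers.coverIdeal K (CoverPowers.attach G H) ^ k) := by
  have hfib (v : V) (n : ℕ) :
      CoverPowers.HasLinearQuotients (CoverPowers.coverSums n (H v)) := by
    rcases hH v with ⟨hu, hc⟩ | ⟨hcm, hb⟩ | ha | ⟨X, Y, hcw⟩
    · exact CoverPowers.hasLinearQuotients_coverSums_of_isChordal hu hc n
    · exact CoverPowers.hasLinearQuotients_coverSums_of_isCohenMacaulayGraph hcm hb n
    · exact CoverPowers.hasLinearQuotients_coverSums_of_isAcyclic ha n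
    · exact hcw.hasLinearQuotients_coverSums n
  have hlq := CoverPowers.hasLinearQuotients_coverSums_attach G H hfib k
  have hup := CoverPowers.isUpperSet_coverSums k (CoverPowers.attach G H)
  rw [CoverPowers.coverIdeal_pow_eq_span_mon]
  exact ⟨hlq.hasLinearQuotientsOnMinGens hup, hlq.isComponentwiseLinear hup⟩

theorem mainTheorem6 {K : Type*} [Field K] {V : Type*} [Finite V] (G : SimpleGraph V)
    {W : V → Type*} [∀ v, Finite (W v)] [∀ v, Nonempty (W v)] (H : ∀ v, SimpleGraph (W v))
    (hH : ∀ v,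
      (CoverPowers.IsUnmixed (H v) ∧ CoverPowers.IsChordal (H v)) ∨
      (CoverPowers.IsCohenMacaulayGraph K (H v) ∧ (H v).IsBipartite) ∨
      CoverPowers.IsPathGraph (H v) ∨
      CoverPowers.IsCompleteCameronWalker (H v))
    (k : ℕ) :
    CoverPowers.HasLinearQuotientsOnMinGens
        (CoverPowers.coverIdeal K (CoverPowers.attach G H) ^ k) ∧
      CoverPowers.IsComponentwiseLinear
        (CoverPowers.coverIdeal K (CoverPowers.attach G H) ^ k) :=
  mainTheorem6_general G H (fun v => (hH v).imp_right <| .imp_right <|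
    .imp CoverPowers.IsPathGraph.isAcyclic fun ⟨X, Y, h, _⟩ => ⟨X, Y, h⟩) k
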